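/- \textbf{Setting.} Let $X(\cdot)$ be a real, centered, jointly measurable stationary Gaussian process with power spectral density (PSD) $S_X\ge 0$, where $S_X$ is even and integrable, $\mathbb E[X(t)X(s)]=\int S_X(f)e^{2\pi i f(t-s)}\,df$ and $\sigma_X^2=\int S_X(f)\,df$. Let $\eta$ be a real centered stationary Gaussian noise independent of $X$ with even PSD $S_\eta\ge 0$; the noise may have infinite power (e.g. white noise), in which case it is a generalized process, and it is only assumed that $\int S_\eta(f)(1+f^2)^{-n}df<\infty$ for some $n$. Put $S_{X+\eta}=S_X+S_\eta$ and $\rho=S_X^2/S_{X+\eta}$ (with $0/0=0$). A filter $H:\mathbb R\to\mathbb C$ is \emph{admissible} if it is measurable and $\int S_{X+\eta}(f)|H(f)|^2df<\infty$. Its output is $Z(t)=\int e^{2\pi i ft}H(f)\,d\Phi(f)$, with $\Phi$ the random spectral measure of $X+\eta$, and its samples at frequency $f_s>0$ are $Y[n]=Z(n/f_s)$, $n\in\mathbb Z$. The filter is \emph{real} if $H(-f)=\overline{H(f)}$ for almost every $f$ (so that $Z$ and $Y$ are real). Let $$\mathsf{mmse}_{X|Y}(f_s)=\lim_{T\to\infty}\frac1{2T}\int_{-T}^{T}\mathbb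 E\big[(X(t)-\tilde X(t))^2\big]dt,\qquad \tilde X(t)=\mathbb E[X(t)\mid Y[\cdot]],$$ for real filters; for general complex filters let $\mathsf{mmse}_{X|Y}(f_s)$ be the same quantity with $\mathbb E[(X(t)-\tilde X(t))^2]$ replaced by the least mean squared error (the infimum of $\mathbb E|X(t)-\cdot|^2$) over complex linear combinations of the samples. Let $$\widetilde S_{X|Y}(f)=\frac{\sum_{k\in\mathbb Z}S_X^2(f-f_sk)|H(f-f_sk)|^2}{\sum_{k\in\mathbb Z}S_{X+\eta}(f-f_sk)|H(f-f_sk)|^2}.$$ A measurable set $F\subset\mathbb R$ is \emph{aliasing-free} if, after removing a Lebesgue null set from $F$, no two distinct points of $F$ differ by an integer multiple of $f_s$; $AF(f_s)$ is the collection of bounded aliasing-free sets. An aliasing-free set $F^\star$ is \emph{maximal} if $\int_{F^\star}\rho\,df=\sup_{F\in AF(f_s)}\int_F\rho\,df$. \textbf{Theorem.} Fix $f_s>0$. (1) Every admissible filter has an output, and $\mathsf{mmse}_{X|Y}(f_s)$ exists (as a limit) for it; for real filters the two definitions agree. (2) Let $F^\star$ be a maximal aliasing-free set which is bounded, or, if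 unbounded, satisfies $\int_{F^\star}S_{X+\eta}\,df<\infty$. Then $H^\star=\mathbf 1_{F^\star}$ is admissible; for every admissible $H$, $\widetilde S_{X|Y}$ of $H$ is at most $\widetilde S_{X|Y}$ of $H^\star$ almost everywhere on $(-f_s/2,f_s/2)$, and the latter equals $\sup_k\rho(f-f_sk)$ there almost everywhere. Moreover $H^\star$ minimizes $\mathsf{mmse}_{X|Y}(f_s)$ (linear estimation) over all admissible filters, and if $H^\star$ is real (i.e. $F^\star$ is symmetric up to a null set) it minimizes $\mathsf{mmse}_{X|Y}(f_s)$ (conditional expectation) over all admissible real filters. In both cases the minimum is $$\mathsf{mmse}^\star_{X|Y}(f_s)=\sigma_X^2-\int_{F^\star}\frac{S_X^2(f)}{S_{X+\eta}(f)}\,df=\sigma_X^2-\int_{-f_s/2}^{f_s/2}\sup_{k\in\mathbb Z}\frac{S_X^2(f-f_sk)}{S_{X+\eta}(f-f_sk)}\,df ,$$ and for every maximal $F^\star$ as above, symmetric or not, this value is also a lower bound for $\mathsf{mmse}_{X|Y}(f_s)$ (conditional expectation) over all admissible real filters. (3) In all cases $\sup_{F\in AF(f_s)}\int_F\rho\,df=\int_{-f_s/2}^{f_s/2}\sup_k\rho(f-f_sk)\,df$,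 and $\sigma_X^2$ minus this number is the infimum of $\mathsf{mmse}_{X|Y}(f_s)$ (linear estimation) over all admissible filters and the infimum of $\mathsf{mmse}_{X|Y}(f_s)$ (conditional expectation) over all admissible real filters. (4) There is a maximal aliasing-free set that is symmetric about $0$, and it can be taken bounded if $S_X$ vanishes almost everywhere outside a bounded set. -/

import Mathlib

open MeasureTheory ProbabilityTheory Filter Topology Set
open scoped SchwartzMap ENNReal

noncomputable section

namespace SubNyquist

/-! ### Power spectral densities, the source and the noise -/

/-- A power spectral density of a real process: measurable, nonnegative and (almost everywhere)
even. -/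
structure IsPSD (S : ℝ → ℝ) : Prop where
  measurable : Measurable S
  nonneg : ∀ f, 0 ≤ S f
  even : ∀ᵐ f, S (-f) = S f

/-- `X` is a real, centered, (jointly measurable) stationary Gaussian process with finite variance
and power spectral density `S`: its autocovariance `𝔼[X(t) X(s)]` is the Fourier integral
`∫ S(f) e^{2πi f (t - s)} df`. -/
structure IsGaussianSource {Ω : Type*} [MeasurableSpace Ω] (P : Measure Ω)
    (X : ℝ → Ω → ℝ) (S : ℝ → ℝ) : Prop where
  measurable : Measurable (fun p : ℝ × Ω => X p.1 p.2)
  gaussian : IsGaussianProcess X P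
  centered : ∀ t, ∫ ω, X t ω ∂P = 0
  psd : IsPSD S
  integrable : Integrable S
  covariance : ∀ s t : ℝ, ((∫ ω, X t ω * X s ω ∂P : ℝ) : ℂ) =
    ∫ f : ℝ, (S f : ℂ) * Complex.exp (2 * Real.pi * Complex.I * f * (t - s))

/-- `∫ u(s) e^{2πi f s} ds`: the spectral multiplier of the functional `∫ u(s) U(s) ds` of a
stationary process `U`. -/
def multiplier (u : 𝓢(ℝ, ℝ)) (f : ℝ) : ℂ :=
  ∫ s : ℝ, Complex.exp (2 * Real.pi * Complex.I * f * s) * (u s : ℂ)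

/-- `η` is a real, centered, stationary Gaussian noise with power spectral density `S`. To allow
noise of infinite power (such as white noise, `S` constant), the noise is a generalized process,
observed through test functions: `η u` stands for `∫ η(s) u(s) ds`. The density `S` has at most
polynomial growth in the integrated sense (is tempered) and need not be integrable. Stationarity
and almost sure linearity in `u` follow from the form of the covariance. -/
structure IsGaussianNoise {Ω : Type*} [MeasurableSpace Ω] (P : Measure Ω)
    (η : 𝓢(ℝ, ℝ) → Ω → ℝ) (S : ℝ → ℝ) : Prop where
  measurable : ∀ u, Measurable (η u)
  gaussian : IsGaussianProcess η P
  centered : ∀ u, ∫ ω, η u ω ∂P = 0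
  psd : IsPSD S
  tempered : ∃ n : ℕ, Integrable (fun f : ℝ => S f / (1 + f ^ 2) ^ n)
  covariance : ∀ u v : 𝓢(ℝ, ℝ), ((∫ ω, η u ω * η v ω ∂P : ℝ) : ℂ) =
    ∫ f : ℝ, (S f : ℂ) * (multiplier u f * (starRingEnd ℂ) (multiplier v f))

/-! ### Pre-sampling filter and uniform sampler -/

/-- The noisy input `X + η` tested against `u`: `∫ X(s) u(s) ds + η(u)`. -/
def noisyInput {Ω : Type*} (X : ℝ → Ω → ℝ) (η : 𝓢(ℝ, ℝ) → Ω → ℝ) (u : 𝓢(ℝ, ℝ)) (ω : Ω) : ℝ :=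
  (∫ s : ℝ, X s ω * u s) + η u ω

/-- The spectral measure `S(f) df`. -/
def spectralMeasure (S : ℝ → ℝ) : Measure ℝ :=
  volume.withDensity (fun f => ENNReal.ofReal (S f))

/-- Admissible frequency responses: `∫ S_{X+η}(f) |H(f)|² df < ∞`. -/
structure IsAdmissible (SX Sη : ℝ → ℝ) (H : ℝ → ℂ) : Prop where
  measurable : Measurable H
  integrable : Integrable (fun f : ℝ => (SX f + Sη f) * ‖H f‖ ^ 2)

/-- Filters with a real impulse response (so that the filtered process is real). -/
def IsRealFilter (H : ℝ → ℂ) : Prop :=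
  ∀ᵐ f, H (-f) = (starRingEnd ℂ) (H f)

/-- `Z` is the output of the linear time invariant system with frequency response `H` whose input
is `X + η`, that is, `Z(t) = ∫ e^{2πi f t} H(f) dΦ(f)` with `Φ` the random spectral measure of
`X + η`. Concretely, `Z(t)` is the limit in `L²(P)` of functionals
`∫ (X + η)(s) w_j(s) ds`, where the `w_j = u_j + i v_j` are test functions whose spectral
multipliers tend to `f ↦ e^{2πi f t} H(f)` in `L²(S_{X+η}(f) df)`. -/
structure IsFilterOutput {Ω : Type*} [MeasurableSpace Ω] (P : Measure Ω)
    (X : ℝ → Ω → ℝ) (η : 𝓢(ℝ, ℝ) → Ω → ℝ) (SX Sη : ℝ → ℝ) (H : ℝ → ℂ)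
    (Z : ℝ → Ω → ℂ) : Prop where
  measurable : ∀ t, Measurable (Z t)
  approx : ∀ t : ℝ, ∃ u v : ℕ → 𝓢(ℝ, ℝ),
    Tendsto (fun j => eLpNorm
      (fun f : ℝ => multiplier (u j) f + Complex.I * multiplier (v j) f
        - Complex.exp (2 * Real.pi * Complex.I * f * t) * H f)
      2 (spectralMeasure (fun f => SX f + Sη f))) atTop (𝓝 0) ∧
    Tendsto (fun j => eLpNorm
      (fun ω => Z t ω - ((noisyInput X η (u j) ω : ℂ) + Complex.I * (noisyInput X η (v j) ω : ℂ)))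
      2 P) atTop (𝓝 0)

/-- Uniform samples at frequency `fs`: `Y[n] = Z(n / fs)`. -/
def samples {Ω : Type*} (fs : ℝ) (Z : ℝ → Ω → ℂ) (n : ℤ) : Ω → ℂ :=
  Z ((n : ℝ) / fs)

/-! ### Minimal mean squared error -/

/-- The σ-algebra generated by the samples. -/
abbrev sampleSigma {Ω : Type*} (Y : ℤ → Ω → ℂ) : MeasurableSpace Ω :=
  ⨆ n, MeasurableSpace.comap (Y n) inferInstance

/-- `𝔼[(X(t) - 𝔼[X(t) | Y])²]`. -/
def condError {Ω : Type*} [MeasurableSpace Ω] (P : Measure Ω) (X : ℝ → Ω → ℝ)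
    (Y : ℤ → Ω → ℂ) (t : ℝ) : ℝ :=
  ∫ ω, (X t ω - (P[X t | sampleSigma Y]) ω) ^ 2 ∂P

/-- `m` is the minimal mean squared error in estimating `X` from `Y`, i.e. the long-time average
of the error of the estimator `𝔼[X(t) | Y]`. -/
def HasMMSE {Ω : Type*} [MeasurableSpace Ω] (P : Measure Ω) (X : ℝ → Ω → ℝ)
    (Y : ℤ → Ω → ℂ) (m : ℝ) : Prop :=
  Tendsto (fun T : ℝ => (2 * T)⁻¹ * ∫ t in (-T)..T, condError P X Y t) atTop (𝓝 m)

/-- The least mean squared error in estimating `X(t)` by complex linear combinations of the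
samples. -/
def linearError {Ω : Type*} [MeasurableSpace Ω] (P : Measure Ω) (X : ℝ → Ω → ℝ)
    (Y : ℤ → Ω → ℂ) (t : ℝ) : ℝ :=
  ⨅ c : ℤ →₀ ℂ, ∫ ω, ‖(X t ω : ℂ) - c.sum (fun n a => a * Y n ω)‖ ^ 2 ∂P

/-- `m` is the minimal mean squared error in estimating `X` linearly from `Y`, i.e. the long-time
average of the error of the best linear estimator. -/
def HasLinearMMSE {Ω : Type*} [MeasurableSpace Ω] (P : Measure Ω) (X : ℝ → Ω → ℝ)
    (Y : ℤ → Ω → ℂ) (m : ℝ) : Prop :=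
  Tendsto (fun T : ℝ => (2 * T)⁻¹ * ∫ t in (-T)..T, linearError P X Y t) atTop (𝓝 m)

/-! ### Spectral quantities -/

/-- `S_X² / S_{X+η}` (zero where `S_{X+η}` vanishes, since there `S_X` vanishes as well). -/
def ratioPSD (SX Sη : ℝ → ℝ) (f : ℝ) : ℝ :=
  SX f ^ 2 / (SX f + Sη f)

/-- The function `S̃_{X|Y}` of the filter `H` at sampling frequency `fs`. -/
def estimatorPSD (fs : ℝ) (SX Sη : ℝ → ℝ) (H : ℝ → ℂ) (f : ℝ) : ℝ :=
  (∑' k : ℤ, SX (f - fs * k) ^ 2 * ‖H (f - fs * k)‖ ^ 2) /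
    (∑' k : ℤ, (SX (f - fs * k) + Sη (f - fs * k)) * ‖H (f - fs * k)‖ ^ 2)

/-- `sup_k S(f - fs k)`. -/
def supPSD (fs : ℝ) (S : ℝ → ℝ) (f : ℝ) : ℝ :=
  ⨆ k : ℤ, S (f - fs * k)

/-! ### Aliasing-free sets -/

/-- Aliasing-free sets: outside a null set, no two distinct points differ by an integer multiple
of `fs`. -/
def IsAliasingFree (fs : ℝ) (F : Set ℝ) : Prop :=
  MeasurableSet F ∧ ∃ N : Set ℝ, volume N = 0 ∧
    ∀ f₁ ∈ F \ N, ∀ f₂ ∈ F \ N, f₁ ≠ f₂ → ∀ k : ℤ, f₁ - f₂ ≠ fs * k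

/-- `AF(fs)`: the bounded aliasing-free sets. -/
def AF (fs : ℝ) : Set (Set ℝ) :=
  {F | IsAliasingFree fs F ∧ Bornology.IsBounded F}

/-- `F` is aliasing-free and `∫_F S = sup_{G ∈ AF(fs)} ∫_G S`. (The set `F` itself is allowed to be
unbounded; where boundedness is wanted it is said separately.) -/
def IsMaximalAliasingFree (fs : ℝ) (S : ℝ → ℝ) (F : Set ℝ) : Prop :=
  IsAliasingFree fs F ∧ IsLUB ((fun G : Set ℝ => ∫ f in G, S f) '' AF fs) (∫ f in F, S f)

/-- The filter with frequency response `1` on `F` and `0` elsewhere. -/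
def indicatorFilter (F : Set ℝ) : ℝ → ℂ :=
  F.indicator (fun _ => 1)

end SubNyquist

end

/-! The estimation problem is moved to the frequency side. Testing `X + η` against Schwartz
functions has, by independence, the same Gram matrix as their multipliers in `L²(S_{X+η})`. These
multipliers are total there, so the correspondence extends to an isometry into `L²(P)`
(`exists_spectralIsometry`). It sends `e^{2πift} H` to the output `Z(t)`, hence a trigonometric
polynomial times `H` to a linear combination of samples, and its pairing with `X(t)` is an integral
against `S_X`.

A trigonometric polynomial `p` in the sampling instants is `fs`-periodic, so the squared error folds
into one period as `σ² - 2 Re ∫ p K_t + ∫ A |p|²`, where `K_t` and `A` are the periodizations of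
`crossPSD` and `outputPSD`. Completing the square, together with the density of trigonometric
polynomials in `L²(A)`, gives the exact error `σ² - ∫ |K_t|² / A` (`linearError_eq`). For almost
every fixed `f`, `t ↦ K_t(f)` is an absolutely convergent sum of exponentials with distinct
frequencies, so Parseval (`tendsto_average_norm_tsum_sq`) averages `|K_t|² / A` to `S̃`.
Cauchy–Schwarz bounds this quotient by the periodization of `ρ`, uniformly in `t`, which justifies
the limit (`hasLinearMMSE`).

Since `S_X² |H|² = ρ · S_{X+η} |H|²`, the value `S̃(f)` is a weighted mean of `ρ` over the aliases
of `f`, hence at most their supremum (`estimatorPSD_le_supPSD`). An aliasing-free set keeps at most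
one alias, and its indicator makes `S̃` equal to `ρ` at that alias; maximality forces this to be the
supremum. Summability of `ρ` over the aliases makes a positive supremum attained. Choosing a
maximizing alias for half of the classes modulo `fs` and reflecting gives a symmetric maximal set
(`exists_symmetric_aliasingFree`). It may be unbounded, but its truncations reach the supremum over
bounded sets and the infimum of the errors.

For a real filter the samples are almost surely real and lie, together with `X(t)`, in a Gaussian
subspace of `L²`, where uncorrelated means independent. The conditional expectation is therefore an
orthogonal projection, and both notions of error agree (`condError_eq_linearError`). -/

namespace SubNyquist

noncomputable section

open scoped FourierTransform InnerProductSpace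

/-! ### Spectral multipliers of test functions -/

/-- A real-valued Schwartz function viewed as a complex-valued one. -/
def complexify : 𝓢(ℝ, ℝ) →L[ℝ] 𝓢(ℝ, ℂ) := SchwartzMap.postcompCLM Complex.ofRealCLM

lemma complexify_apply (u : 𝓢(ℝ, ℝ)) (x : ℝ) : complexify u x = (u x : ℂ) := rfl

lemma multiplier_eq_fourierInv (u : 𝓢(ℝ, ℝ)) : multiplier u = ⇑(𝓕⁻ (complexify u) : 𝓢(ℝ, ℂ)) := by
  ext f
  rw [SchwartzMap.fourierInv_coe, Real.fourierInv_eq']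
  simp only [multiplier]
  congr 1 with s
  rw [complexify_apply, smul_eq_mul]
  congr 2
  simp
  ring

/-- Splitting into real and imaginary parts is done in time, not in frequency; hence pairs of real
test functions produce every complex Schwartz function as a multiplier. -/
lemma multiplier_add_I_mul (w : 𝓢(ℝ, ℂ)) (f : ℝ) :
    multiplier (SchwartzMap.postcompCLM Complex.reCLM w) f
      + Complex.I * multiplier (SchwartzMap.postcompCLM Complex.imCLM w) f = (𝓕⁻ w : 𝓢(ℝ, ℂ)) f := by
  rw [multiplier_eq_fourierInv, multiplier_eq_fourierInv]
  have h : w = complexify (SchwartzMap.postcompCLM Complex.reCLM w)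
      + Complex.I • complexify (SchwartzMap.postcompCLM Complex.imCLM w) := by
    ext x
    simp only [add_apply, smul_apply, complexify_apply, smul_eq_mul,
      SchwartzMap.postcompCLM_apply, Complex.reCLM_apply, Complex.imCLM_apply]
    rw [mul_comm]
    exact (Complex.re_add_im _).symm
  conv_rhs => rw [h]
  rw [FourierInvAdd.fourierInv_add, FourierInvSMul.fourierInv_smul]
  rfl

lemma continuous_multiplier (u : 𝓢(ℝ, ℝ)) : Continuous (multiplier u) := by
  rw [multiplier_eq_fourierInv]
  exact SchwartzMap.continuous _

lemma memLp_multiplier (μ : Measure ℝ) [μ.HasTemperateGrowth] (u : 𝓢(ℝ, ℝ)) :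
    MemLp (multiplier u) 2 μ := by
  rw [multiplier_eq_fourierInv]
  exact SchwartzMap.memLp _ _ _

/-- The multipliers of complex test functions are dense in `L²`. -/
lemma exists_multiplier_eLpNorm_sub_le (μ : Measure ℝ) [μ.HasTemperateGrowth]
    [IsFiniteMeasureOnCompacts μ] {g : ℝ → ℂ} (hg : MemLp g 2 μ) {ε : ℝ≥0∞} (hε : 0 < ε) :
    ∃ u v : 𝓢(ℝ, ℝ),
      eLpNorm (fun f => multiplier u f + Complex.I * multiplier v f - g f) 2 μ ≤ ε := by
  obtain ⟨w, hw⟩ := (SchwartzMap.denseRange_toLpCLM (F := ℂ) (p := 2) (μ := μ)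
    ENNReal.ofNat_ne_top).exists_mem_open (Metric.isOpen_eball (x := hg.toLp g) (ε := ε))
    ⟨_, Metric.mem_eball_self hε⟩
  -- The test function is the Fourier transform of `w`, so that its multiplier is `w` itself.
  refine ⟨SchwartzMap.postcompCLM Complex.reCLM (𝓕 w),
    SchwartzMap.postcompCLM Complex.imCLM (𝓕 w), ?_⟩
  simp only [multiplier_add_I_mul, FourierTransform.fourierInv_fourier_eq]
  rw [Metric.mem_eball, Lp.edist_def] at hw
  refine le_trans (le_of_eq (eLpNorm_congr_ae ?_)) hw.le
  filter_upwards [hg.coeFn_toLp, SchwartzMap.coeFn_toLp w 2 μ] with x h1 h2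
  simp only [Pi.sub_apply, SchwartzMap.toLpCLM_apply, h1, h2]

lemma exists_multiplier_tendsto (μ : Measure ℝ) [μ.HasTemperateGrowth]
    [IsFiniteMeasureOnCompacts μ] {g : ℝ → ℂ} (hg : MemLp g 2 μ) :
    ∃ u v : ℕ → 𝓢(ℝ, ℝ), Tendsto (fun j =>
      eLpNorm (fun f => multiplier (u j) f + Complex.I * multiplier (v j) f - g f) 2 μ)
      atTop (𝓝 0) := by
  choose u v h using fun j : ℕ => exists_multiplier_eLpNorm_sub_le μ hg
    (ε := ((j : ℝ≥0∞) + 1)⁻¹) (by simp)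
  refine ⟨u, v, tendsto_of_tendsto_of_tendsto_of_le_of_le tendsto_const_nhds ?_
    (fun _ => zero_le) h⟩
  have := (tendsto_add_atTop_iff_nat 1).2 ENNReal.tendsto_inv_nat_nhds_zero
  simpa using this

/-! ### Isometries between Hilbert spaces from equal Gram matrices -/

/-- Two families with the same Gram matrix, the first one total, are related by a linear
isometry. -/
theorem exists_linearIsometry_of_inner_eq {ι E F : Type*} [NormedAddCommGroup E]
    [InnerProductSpace ℂ E] [NormedAddCommGroup F] [InnerProductSpace ℂ F] [CompleteSpace F]
    (x : ι → E) (y : ι → F) (hx : Dense (Submodule.span ℂ (range x) : Set E))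
    (h : ∀ i j, ⟪x i, x j⟫_ℂ = ⟪y i, y j⟫_ℂ) :
    ∃ Ψ : E →ₗᵢ[ℂ] F, ∀ i, Ψ (x i) = y i := by
  let e : (ι →₀ ℂ) →ₗ[ℂ] E := Finsupp.linearCombination ℂ x
  let f : (ι →₀ ℂ) →ₗ[ℂ] F := Finsupp.linearCombination ℂ y
  have hinner : ∀ c : ι →₀ ℂ, ⟪e c, e c⟫_ℂ = ⟪f c, f c⟫_ℂ := by
    intro c
    simp only [e, f, Finsupp.linearCombination_apply, Finsupp.sum_inner, Finsupp.inner_sum,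
      inner_smul_left, inner_smul_right, h]
  -- Neither map need be injective; equality of norms is what lets `f` factor through `e` and extend
  -- to the closure.
  have hnorm : ∀ c, ‖f c‖ = ‖e c‖ := by
    intro c
    rw [norm_eq_sqrt_re_inner (𝕜 := ℂ), norm_eq_sqrt_re_inner (𝕜 := ℂ), hinner]
  have hd : DenseRange e := by
    change Dense (range e)
    rwa [← LinearMap.coe_range, Finsupp.range_linearCombination]
  have hb : ∃ C, ∀ c, ‖f c‖ ≤ C * ‖e c‖ := ⟨1, fun c => by rw [one_mul, hnorm]⟩
  refine ⟨{ toLinearMap := (f.extendOfNorm e).toLinearMap, norm_map' := fun z => ?_ },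
    fun i => ?_⟩
  · refine hd.induction (P := fun z => ‖f.extendOfNorm e z‖ = ‖z‖) ?_
      (isClosed_eq (by fun_prop) (by fun_prop)) z
    rintro _ ⟨c, rfl⟩
    rw [LinearMap.extendOfNorm_eq hd hb, hnorm]
  · have := LinearMap.extendOfNorm_eq hd hb (Finsupp.single i 1)
    simpa [e, f] using this

/-! ### The spectral measure -/

lemma hasTemperateGrowth_spectralMeasure {S : ℝ → ℝ} (hm : Measurable S) (h0 : ∀ f, 0 ≤ S f)
    {n : ℕ} (hS : Integrable (fun f : ℝ => S f / (1 + f ^ 2) ^ n)) :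
    (spectralMeasure S).HasTemperateGrowth := by
  -- The exponent doubles because the two weights are compared through `1 + f ^ 2 ≤ (1 + |f|) ^ 2`.
  refine ⟨⟨2 * n, ?_⟩⟩
  rw [spectralMeasure, integrable_withDensity_iff_integrable_smul' (by fun_prop) (by simp)]
  refine hS.mono' (by fun_prop) (ae_of_all _ fun f => ?_)
  rw [ENNReal.toReal_ofReal (h0 f), smul_eq_mul, norm_mul, Real.norm_of_nonneg (h0 f),
    div_eq_mul_inv]
  refine mul_le_mul_of_nonneg_left ?_ (h0 f)
  rw [Real.norm_of_nonneg (by positivity), Real.rpow_neg (by positivity), Real.rpow_natCast,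
    pow_mul]
  gcongr
  nlinarith [abs_nonneg f, sq_abs f, Real.norm_eq_abs f]

/-- The integrable weight `(1 + ‖x‖) ^ (-n)` is bounded below on a compact set, so Markov's
inequality bounds the mass. -/
lemma isFiniteMeasureOnCompacts_of_hasTemperateGrowth (μ : Measure ℝ)
    [h : μ.HasTemperateGrowth] : IsFiniteMeasureOnCompacts μ := by
  refine ⟨fun K hK => ?_⟩
  obtain ⟨n, hn⟩ := h.exists_integrable
  obtain ⟨R, hR0, hR⟩ := hK.isBounded.exists_pos_norm_le
  refine lt_of_le_of_lt (measure_mono fun x hx => ?_)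
    (hn.measure_norm_ge_lt_top (ε := (1 + R) ^ (-(n : ℝ))) (by positivity))
  rw [mem_ofPred_eq, Real.norm_of_nonneg (by positivity)]
  exact Real.rpow_le_rpow_of_nonpos (by positivity) (by linarith [hR x hx]) (by simp)

lemma integral_spectralMeasure {E : Type*} [NormedAddCommGroup E] [NormedSpace ℝ E] {S : ℝ → ℝ}
    (hm : Measurable S) (h0 : ∀ f, 0 ≤ S f) (g : ℝ → E) :
    ∫ f, g f ∂(spectralMeasure S) = ∫ f, S f • g f := by
  rw [spectralMeasure, integral_withDensity_eq_integral_toReal_smul (by fun_prop) (by simp)]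
  simp only [ENNReal.toReal_ofReal (h0 _)]

lemma integrable_spectralMeasure_iff {E : Type*} [NormedAddCommGroup E] [NormedSpace ℝ E]
    {S : ℝ → ℝ} (hm : Measurable S) (h0 : ∀ f, 0 ≤ S f) {g : ℝ → E} :
    Integrable g (spectralMeasure S) ↔ Integrable (fun f => S f • g f) := by
  rw [spectralMeasure, integrable_withDensity_iff_integrable_smul' (by fun_prop) (by simp)]
  simp only [ENNReal.toReal_ofReal (h0 _)]

lemma memLp_two_spectralMeasure_iff {S : ℝ → ℝ} (hm : Measurable S) (h0 : ∀ f, 0 ≤ S f)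
    {g : ℝ → ℂ} (hg : Measurable g) :
    MemLp g 2 (spectralMeasure S) ↔ Integrable (fun f => S f * ‖g f‖ ^ 2) := by
  rw [← memLp_norm_iff hg.aestronglyMeasurable,
    memLp_two_iff_integrable_sq hg.norm.aestronglyMeasurable, integrable_spectralMeasure_iff hm h0]
  simp only [smul_eq_mul]

lemma spectralMeasure_absolutelyContinuous (S : ℝ → ℝ) : spectralMeasure S ≪ volume :=
  withDensity_absolutelyContinuous _ _

/-! ### Integrals of a second order process against a test function -/

section TestIntegral

variable {Ω : Type*} [MeasurableSpace Ω] {P : Measure Ω}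
  {X : ℝ → Ω → ℝ} {C : ℝ}

lemma lintegral_sq_le_of_integral_sq_le {V : Ω → ℝ} (hV : MemLp V 2 P)
    (hC : ∫ ω, V ω ^ 2 ∂P ≤ C) : ∫⁻ ω, ‖V ω‖ₑ ^ 2 ∂P ≤ ENNReal.ofReal C := by
  have h1 : ∀ ω, ‖V ω‖ₑ ^ 2 = ENNReal.ofReal (V ω ^ 2) := by
    intro ω
    rw [← enorm_pow, Real.enorm_eq_ofReal (sq_nonneg _)]
  simp only [h1]
  rw [← ofReal_integral_eq_lintegral_ofReal hV.integrable_sq (ae_of_all _ fun _ => sq_nonneg _)]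
  exact ENNReal.ofReal_le_ofReal hC

lemma sq_lintegral_le {α : Type*} [MeasurableSpace α] (ν : Measure α) {g : α → ℝ≥0∞}
    (hg : AEMeasurable g ν) : (∫⁻ a, g a ∂ν) ^ 2 ≤ (∫⁻ a, g a ^ 2 ∂ν) * ν univ := by
  have h := ENNReal.lintegral_mul_le_Lp_mul_Lq ν Real.HolderConjugate.two_two hg
    (aemeasurable_const (b := (1 : ℝ≥0∞)))
  simp only [Pi.mul_apply, mul_one, lintegral_const,
    ENNReal.rpow_two, one_pow, one_mul] at h
  calc (∫⁻ a, g a ∂ν) ^ 2 ≤ ((∫⁻ a, g a ^ 2 ∂ν) ^ (1 / 2 : ℝ) * ν univ ^ (1 / 2 : ℝ)) ^ 2 := by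
        gcongr
    _ = _ := by
        rw [mul_pow, ← ENNReal.rpow_two, ← ENNReal.rpow_two, ← ENNReal.rpow_mul,
          ← ENNReal.rpow_mul]
        norm_num

variable [IsProbabilityMeasure P] (hXm : Measurable (fun p : ℝ × Ω => X p.1 p.2)) (hX2 : ∀ t, MemLp (X t) 2 P)
  (hC : ∀ t, ∫ ω, X t ω ^ 2 ∂P ≤ C)
include hXm hX2 hC

/-- Cauchy–Schwarz for the finite measure `|u(s)| ds`, followed by Tonelli, bounds the second moment
by `C ‖u‖₁²`. -/
lemma memLp_integral_mul {u : ℝ → ℝ} (hum : Measurable u) (hu : Integrable u) :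
    MemLp (fun ω => ∫ s, X s ω * u s) 2 P := by
  have hm : Measurable (fun p : Ω × ℝ => X p.2 p.1 * u p.2) :=
    (hXm.comp measurable_swap).mul (hum.comp measurable_snd)
  have hsm : StronglyMeasurable (fun ω => ∫ s, X s ω * u s) :=
    hm.stronglyMeasurable.integral_prod_right
  refine ⟨hsm.aestronglyMeasurable, ?_⟩
  rw [eLpNorm_lt_top_iff_lintegral_rpow_enorm_lt_top (by norm_num) (by norm_num)]
  simp only [ENNReal.toReal_ofNat, ENNReal.rpow_two]
  let ν : Measure ℝ := volume.withDensity (fun s => ‖u s‖ₑ)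
  have hν : ν univ < ∞ := by
    simp only [ν, withDensity_apply _ MeasurableSet.univ, Measure.restrict_univ]
    exact hu.2
  have : IsFiniteMeasure ν := ⟨hν⟩
  have hle : ∀ ω, ‖∫ s, X s ω * u s‖ₑ ^ 2 ≤ (∫⁻ s, ‖X s ω‖ₑ ^ 2 ∂ν) * ν univ := by
    intro ω
    have hXω : Measurable (fun s => ‖X s ω‖ₑ) := (hXm.comp measurable_prodMk_right).enorm
    refine le_trans ?_ (sq_lintegral_le ν hXω.aemeasurable)
    gcongr
    refine (enorm_integral_le_lintegral_enorm _).trans (le_of_eq ?_)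
    rw [lintegral_withDensity_eq_lintegral_mul _ hum.enorm hXω]
    simp only [enorm_mul, Pi.mul_apply, mul_comm]
  calc ∫⁻ ω, ‖∫ s, X s ω * u s‖ₑ ^ 2 ∂P
      ≤ ∫⁻ ω, (∫⁻ s, ‖X s ω‖ₑ ^ 2 ∂ν) * ν univ ∂P := lintegral_mono hle
    _ = (∫⁻ ω, (∫⁻ s, ‖X s ω‖ₑ ^ 2 ∂ν) ∂P) * ν univ := lintegral_mul_const' _ _ hν.ne
    _ = (∫⁻ s, (∫⁻ ω, ‖X s ω‖ₑ ^ 2 ∂P) ∂ν) * ν univ := by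
        rw [lintegral_lintegral_swap]
        exact ((hXm.comp measurable_swap).enorm.pow_const 2).aemeasurable
    _ ≤ (∫⁻ s, ENNReal.ofReal C ∂ν) * ν univ := by
        gcongr with s
        exact lintegral_sq_le_of_integral_sq_le (hX2 s) (hC s)
    _ < ∞ := by
        rw [lintegral_const]
        exact ENNReal.mul_lt_top (ENNReal.mul_lt_top ENNReal.ofReal_lt_top hν) hν

/-- Fubini applies because `|V X(s)| ≤ V² + X(s)²` has expectation bounded uniformly in `s`. -/
lemma integral_mul_integral_mul {u : ℝ → ℝ} (hum : Measurable u) (hu : Integrable u)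
    {V : Ω → ℝ} (hVm : Measurable V) (hV : MemLp V 2 P) :
    ∫ ω, V ω * (∫ s, X s ω * u s) ∂P = ∫ s, u s * ∫ ω, V ω * X s ω ∂P := by
  have hm : Measurable (fun p : ℝ × Ω => u p.1 * (V p.2 * X p.1 p.2)) :=
    (hum.comp measurable_fst).mul ((hVm.comp measurable_snd).mul hXm)
  have hint : ∀ s, Integrable (fun ω => V ω * X s ω) P := fun s => hV.integrable_mul (hX2 s)
  have hprod : Integrable (fun p : ℝ × Ω => u p.1 * (V p.2 * X p.1 p.2)) (volume.prod P) := by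
    rw [integrable_prod_iff hm.aestronglyMeasurable]
    refine ⟨ae_of_all _ fun s => (hint s).const_mul (u s), ?_⟩
    refine (hu.norm.mul_const ((∫ ω, V ω ^ 2 ∂P) + C)).mono'
      hm.norm.aestronglyMeasurable.integral_prod_right' (ae_of_all _ fun s => ?_)
    rw [Real.norm_of_nonneg (integral_nonneg fun _ => norm_nonneg _)]
    simp only [norm_mul (u s), integral_const_mul]
    gcongr
    calc ∫ ω, ‖V ω * X s ω‖ ∂P ≤ ∫ ω, (V ω ^ 2 + X s ω ^ 2) ∂P := by
          refine integral_mono (hint s).norm (hV.integrable_sq.add (hX2 s).integrable_sq)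
            fun ω => ?_
          simp only [norm_mul, Real.norm_eq_abs]
          nlinarith [sq_nonneg (|V ω| - |X s ω|), sq_abs (V ω), sq_abs (X s ω),
            sq_nonneg (V ω), sq_nonneg (X s ω)]
      _ = (∫ ω, V ω ^ 2 ∂P) + ∫ ω, X s ω ^ 2 ∂P :=
          integral_add hV.integrable_sq (hX2 s).integrable_sq
      _ ≤ _ := by gcongr; exact hC s
  have hswap := integral_integral_swap (f := fun s ω => u s * (V ω * X s ω)) hprod
  simp only [integral_const_mul] at hswap
  rw [hswap]
  refine integral_congr_ae (ae_of_all _ fun ω => ?_)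
  simp only
  rw [← integral_const_mul]
  refine integral_congr_ae (ae_of_all _ fun s => ?_)
  simp only
  ring

end TestIntegral

/-! ### Conjugation, bounds and Fubini for multipliers. -/

lemma conj_multiplier (u : 𝓢(ℝ, ℝ)) (f : ℝ) :
    (starRingEnd ℂ) (multiplier u f) =
      ∫ s : ℝ, (u s : ℂ) * Complex.exp (-(2 * Real.pi * Complex.I * f * s)) := by
  rw [multiplier, ← integral_conj]
  refine integral_congr_ae (ae_of_all _ fun s => ?_)
  simp only [map_mul, ← Complex.exp_conj, Complex.conj_I, Complex.conj_ofReal, map_ofNat]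
  rw [mul_comm]
  congr 2
  ring

lemma exists_norm_multiplier_le (u : 𝓢(ℝ, ℝ)) : ∃ C, ∀ f, ‖multiplier u f‖ ≤ C := by
  rw [multiplier_eq_fourierInv]
  exact ⟨_, fun f => BoundedContinuousFunction.norm_coe_le_norm
    (SchwartzMap.toBoundedContinuousFunction (𝓕⁻ (complexify u) : 𝓢(ℝ, ℂ))) f⟩

lemma norm_exp_two_pi_mul (f t : ℝ) : ‖Complex.exp (2 * Real.pi * Complex.I * f * t)‖ = 1 := by
  rw [show (2 * Real.pi * Complex.I * f * t : ℂ) = ((2 * Real.pi * f * t : ℝ) : ℂ) * Complex.I by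
    push_cast; ring]
  exact Complex.norm_exp_ofReal_mul_I _

/-- Fubini with a kernel of modulus one. It turns a covariance function integrated against `u` into
a spectral integral. -/
lemma integral_mul_integral_exp (u : 𝓢(ℝ, ℝ)) {k : ℝ → ℂ} (hk : Integrable k) :
    ∫ s : ℝ, (u s : ℂ) * ∫ f : ℝ, k f * Complex.exp (-(2 * Real.pi * Complex.I * f * s)) =
      ∫ f : ℝ, k f * (starRingEnd ℂ) (multiplier u f) := by
  have hprod : Integrable (fun p : ℝ × ℝ => (u p.1 : ℂ) *
      (k p.2 * Complex.exp (-(2 * Real.pi * Complex.I * p.2 * p.1)))) (volume.prod volume) := by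
    have h1 := (u.integrable (μ := volume)).ofReal (𝕜 := ℂ) |>.mul_prod hk
    have h2 : Integrable (fun p : ℝ × ℝ => ((u p.1 : ℂ) * k p.2) *
        Complex.exp (-(2 * Real.pi * Complex.I * p.2 * p.1))) (volume.prod volume) := by
      refine h1.mul_bdd (c := 1) (by fun_prop) (ae_of_all _ fun p => ?_)
      rw [Complex.exp_neg, norm_inv, norm_exp_two_pi_mul, inv_one]
    simpa only [mul_assoc] using h2
  have hswap := integral_integral_swap (f := fun s f => (u s : ℂ) *
      (k f * Complex.exp (-(2 * Real.pi * Complex.I * f * s)))) hprod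
  simp only [integral_const_mul] at hswap
  rw [hswap]
  refine integral_congr_ae (ae_of_all _ fun f => ?_)
  simp only
  rw [conj_multiplier, ← integral_const_mul]
  refine integral_congr_ae (ae_of_all _ fun s => ?_)
  simp only
  ring

/-! ### Second moments of the source and of the noisy input -/

section Covariance

variable {Ω : Type*} [MeasurableSpace Ω] {P : Measure Ω}
  {X : ℝ → Ω → ℝ} {η : 𝓢(ℝ, ℝ) → Ω → ℝ} {SX Sη : ℝ → ℝ}

lemma IsGaussianSource.measurable_eval (hX : IsGaussianSource P X SX) (t : ℝ) :
    Measurable (X t) := hX.measurable.comp measurable_prodMk_left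

lemma IsGaussianSource.memLp (hX : IsGaussianSource P X SX) (t : ℝ) : MemLp (X t) 2 P :=
  (hX.gaussian.hasGaussianLaw_eval t).memLp_two

lemma IsGaussianNoise.memLp (hη : IsGaussianNoise P η Sη) (u : 𝓢(ℝ, ℝ)) : MemLp (η u) 2 P :=
  (hη.gaussian.hasGaussianLaw_eval u).memLp_two

lemma IsGaussianSource.integral_sq (hX : IsGaussianSource P X SX) (t : ℝ) :
    ∫ ω, X t ω ^ 2 ∂P = ∫ f, SX f := by
  have h := hX.covariance t t
  simp only [sub_self, mul_zero, Complex.exp_zero, mul_one, integral_complex_ofReal] at h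
  simpa only [sq] using Complex.ofReal_injective h

/-- The source tested against `u`. -/
def sourceInput (X : ℝ → Ω → ℝ) (u : 𝓢(ℝ, ℝ)) (ω : Ω) : ℝ := ∫ s : ℝ, X s ω * u s

lemma measurable_sourceInput (hX : IsGaussianSource P X SX) (u : 𝓢(ℝ, ℝ)) :
    Measurable (sourceInput X u) := by
  have hm : Measurable (fun p : Ω × ℝ => X p.2 p.1 * u p.2) :=
    (hX.measurable.comp measurable_swap).mul (u.continuous.measurable.comp measurable_snd)
  exact hm.stronglyMeasurable.integral_prod_right.measurable

variable [IsProbabilityMeasure P]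

lemma memLp_sourceInput (hX : IsGaussianSource P X SX) (u : 𝓢(ℝ, ℝ)) :
    MemLp (sourceInput X u) 2 P :=
  memLp_integral_mul hX.measurable hX.memLp (fun t => (hX.integral_sq t).le)
    u.continuous.measurable u.integrable

lemma memLp_noisyInput (hX : IsGaussianSource P X SX) (hη : IsGaussianNoise P η Sη)
    (u : 𝓢(ℝ, ℝ)) : MemLp (noisyInput X η u) 2 P :=
  (memLp_sourceInput hX u).add (hη.memLp u)

lemma integral_mul_sourceInput (hX : IsGaussianSource P X SX) (u : 𝓢(ℝ, ℝ)) {V : Ω → ℝ}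
    (hVm : Measurable V) (hV : MemLp V 2 P) :
    ∫ ω, V ω * sourceInput X u ω ∂P = ∫ s, u s * ∫ ω, V ω * X s ω ∂P :=
  integral_mul_integral_mul hX.measurable hX.memLp (fun t => (hX.integral_sq t).le)
    u.continuous.measurable u.integrable hVm hV

lemma integral_eval_mul_sourceInput (hX : IsGaussianSource P X SX) (t : ℝ) (u : 𝓢(ℝ, ℝ)) :
    ((∫ ω, X t ω * sourceInput X u ω ∂P : ℝ) : ℂ) =
      ∫ f : ℝ, (SX f : ℂ) * Complex.exp (2 * Real.pi * Complex.I * f * t) *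
        (starRingEnd ℂ) (multiplier u f) := by
  rw [integral_mul_sourceInput hX u (hX.measurable_eval t) (hX.memLp t),
    ← integral_complex_ofReal, ← integral_mul_integral_exp]
  · refine integral_congr_ae (ae_of_all _ fun s => ?_)
    simp only [Complex.ofReal_mul]
    rw [hX.covariance]
    congr 1
    refine integral_congr_ae (ae_of_all _ fun f => ?_)
    simp only
    rw [mul_assoc (SX f : ℂ), ← Complex.exp_add]
    congr 2
    ring
  · refine hX.integrable.ofReal.mul_bdd (c := 1) (by fun_prop) (ae_of_all _ fun p => ?_)
    rw [norm_exp_two_pi_mul]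

lemma hasTemperateGrowth_of_integrable {S : ℝ → ℝ} (hm : Measurable S) (h0 : ∀ f, 0 ≤ S f)
    (hS : Integrable S) : (spectralMeasure S).HasTemperateGrowth :=
  hasTemperateGrowth_spectralMeasure (n := 0) hm h0 (by simpa using hS)

lemma integrable_mul_multiplier {S : ℝ → ℝ} (hm : Measurable S) (h0 : ∀ f, 0 ≤ S f)
    [(spectralMeasure S).HasTemperateGrowth] (u v : 𝓢(ℝ, ℝ)) :
    Integrable fun f => (S f : ℂ) * (multiplier u f * (starRingEnd ℂ) (multiplier v f)) := by
  have h := (memLp_multiplier (spectralMeasure S) u).integrable_mul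
    (q := 2) (memLp_multiplier (spectralMeasure S) v).star
  rw [integrable_spectralMeasure_iff hm h0] at h
  simpa [Complex.real_smul] using h

lemma integral_sourceInput_mul_sourceInput (hX : IsGaussianSource P X SX) (u v : 𝓢(ℝ, ℝ)) :
    ((∫ ω, sourceInput X u ω * sourceInput X v ω ∂P : ℝ) : ℂ) =
      ∫ f : ℝ, (SX f : ℂ) * (multiplier u f * (starRingEnd ℂ) (multiplier v f)) := by
  have hk : Integrable fun f => (SX f : ℂ) * multiplier u f := by
    obtain ⟨C, hC⟩ := exists_norm_multiplier_le u
    exact hX.integrable.ofReal.mul_bdd (c := C)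
      (continuous_multiplier u).aestronglyMeasurable (ae_of_all _ hC)
  rw [integral_mul_sourceInput hX v (measurable_sourceInput hX u) (memLp_sourceInput hX u),
    ← integral_complex_ofReal]
  -- The moment is real, so conjugating the known formula moves the conjugation from the multiplier
  -- to the exponential.
  have hswap : ∀ s, ((∫ ω, sourceInput X u ω * X s ω ∂P : ℝ) : ℂ) =
      ∫ f : ℝ, ((SX f : ℂ) * multiplier u f) *
        Complex.exp (-(2 * Real.pi * Complex.I * f * s)) := by
    intro s
    have h := congrArg (starRingEnd ℂ) (integral_eval_mul_sourceInput hX s u)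
    rw [Complex.conj_ofReal, ← integral_conj] at h
    simp only [mul_comm (sourceInput X u _)]
    rw [h]
    refine integral_congr_ae (ae_of_all _ fun f => ?_)
    simp only [map_mul, Complex.conj_ofReal, Complex.conj_conj, ← Complex.exp_conj,
      Complex.conj_I, map_ofNat]
    rw [mul_right_comm]
    congr 2
    ring
  simp only [Complex.ofReal_mul, hswap]
  rw [integral_mul_integral_exp v hk]
  simp only [mul_assoc]

variable (hX : IsGaussianSource P X SX) (hη : IsGaussianNoise P η Sη)
  (hindep : IndepFun (fun ω t => X t ω) (fun ω u => η u ω) P)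
include hX hη hindep

omit [IsProbabilityMeasure P] in
lemma integral_eval_mul_noise (t : ℝ) (u : 𝓢(ℝ, ℝ)) : ∫ ω, η u ω * X t ω ∂P = 0 := by
  have h : IndepFun (η u) (X t) P :=
    (hindep.comp (φ := fun x : ℝ → ℝ => x t) (ψ := fun y : 𝓢(ℝ, ℝ) → ℝ => y u)
      (measurable_pi_apply t) (measurable_pi_apply u)).symm
  have := h.integral_mul_eq_mul_integral (hη.measurable u).aestronglyMeasurable
    (hX.measurable_eval t).aestronglyMeasurable
  simpa [hX.centered t] using this

lemma integral_noise_mul_sourceInput (u v : 𝓢(ℝ, ℝ)) :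
    ∫ ω, η v ω * sourceInput X u ω ∂P = 0 := by
  rw [integral_mul_sourceInput hX u (hη.measurable v) (hη.memLp v)]
  simp [integral_eval_mul_noise hX hη hindep]

lemma integral_eval_mul_noisyInput (t : ℝ) (u : 𝓢(ℝ, ℝ)) :
    ((∫ ω, X t ω * noisyInput X η u ω ∂P : ℝ) : ℂ) =
      ∫ f : ℝ, (SX f : ℂ) * Complex.exp (2 * Real.pi * Complex.I * f * t) *
        (starRingEnd ℂ) (multiplier u f) := by
  rw [← integral_eval_mul_sourceInput hX]
  congr 1
  have h : ∀ ω, X t ω * noisyInput X η u ω = X t ω * sourceInput X u ω + η u ω * X t ω := by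
    intro ω; rw [noisyInput, sourceInput]; ring
  simp only [h]
  have i1 : Integrable (fun ω => X t ω * sourceInput X u ω) P :=
    (hX.memLp t).integrable_mul (memLp_sourceInput hX u)
  have i2 : Integrable (fun ω => η u ω * X t ω) P := (hη.memLp u).integrable_mul (hX.memLp t)
  rw [integral_add i1 i2, integral_eval_mul_noise hX hη hindep, add_zero]

/-- Independence and centering kill the cross terms, so the two densities add. This is the Gram
identity behind the spectral isometry. -/
lemma integral_noisyInput_mul_noisyInput (u v : 𝓢(ℝ, ℝ)) :
    ((∫ ω, noisyInput X η u ω * noisyInput X η v ω ∂P : ℝ) : ℂ) =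
      ∫ f : ℝ, ((SX f + Sη f : ℝ) : ℂ) *
        (multiplier u f * (starRingEnd ℂ) (multiplier v f)) := by
  have h : ∀ ω, noisyInput X η u ω * noisyInput X η v ω =
      (sourceInput X u ω * sourceInput X v ω + η u ω * η v ω) +
        (η v ω * sourceInput X u ω + η u ω * sourceInput X v ω) := by
    intro ω; simp only [noisyInput, sourceInput]; ring
  have i1 : Integrable (fun ω => sourceInput X u ω * sourceInput X v ω) P :=
    (memLp_sourceInput hX u).integrable_mul (memLp_sourceInput hX v)
  have i2 : Integrable (fun ω => η u ω * η v ω) P := (hη.memLp u).integrable_mul (hη.memLp v)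
  have i3 : Integrable (fun ω => η v ω * sourceInput X u ω) P :=
    (hη.memLp v).integrable_mul (memLp_sourceInput hX u)
  have i4 : Integrable (fun ω => η u ω * sourceInput X v ω) P :=
    (hη.memLp u).integrable_mul (memLp_sourceInput hX v)
  have h12 : ∫ ω, noisyInput X η u ω * noisyInput X η v ω ∂P =
      (∫ ω, sourceInput X u ω * sourceInput X v ω ∂P) + ∫ ω, η u ω * η v ω ∂P := by
    simp only [h]
    rw [integral_add (f := fun ω => _ + _) (g := fun ω => _ + _) (i1.add i2) (i3.add i4), integral_add i1 i2, integral_add i3 i4,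
      integral_noise_mul_sourceInput hX hη hindep, integral_noise_mul_sourceInput hX hη hindep,
      add_zero, add_zero]
  have := hasTemperateGrowth_of_integrable hX.psd.measurable hX.psd.nonneg hX.integrable
  obtain ⟨n, hn⟩ := hη.tempered
  have := hasTemperateGrowth_spectralMeasure hη.psd.measurable hη.psd.nonneg hn
  rw [h12, Complex.ofReal_add, integral_sourceInput_mul_sourceInput hX, hη.covariance,
    ← integral_add (integrable_mul_multiplier hX.psd.measurable hX.psd.nonneg u v)
      (integrable_mul_multiplier hη.psd.measurable hη.psd.nonneg u v)]
  simp only [Complex.ofReal_add, add_mul]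

end Covariance

/-! ### The spectral isometry -/

/-- The complex exponential `f ↦ e^{2πi f t}`. -/
def phase (t f : ℝ) : ℂ := Complex.exp (2 * Real.pi * Complex.I * f * t)

lemma norm_phase (t f : ℝ) : ‖phase t f‖ = 1 := norm_exp_two_pi_mul f t

lemma continuous_phase (t : ℝ) : Continuous (phase t) := by
  unfold phase; fun_prop

lemma inner_toLp_toLp {α : Type*} [MeasurableSpace α] {μ : Measure α} {f g : α → ℂ}
    (hf : MemLp f 2 μ) (hg : MemLp g 2 μ) :
    ⟪hf.toLp f, hg.toLp g⟫_ℂ = ∫ a, (starRingEnd ℂ) (f a) * g a ∂μ := by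
  rw [L2.inner_def]
  refine integral_congr_ae ?_
  filter_upwards [hf.coeFn_toLp, hg.coeFn_toLp] with a h1 h2
  rw [h1, h2, RCLike.inner_apply, mul_comm]

lemma norm_toLp_sq {α : Type*} [MeasurableSpace α] {μ : Measure α} {f : α → ℂ}
    (hf : MemLp f 2 μ) : ‖hf.toLp f‖ ^ 2 = ∫ a, ‖f a‖ ^ 2 ∂μ := by
  have h := inner_self_eq_norm_sq_to_K (𝕜 := ℂ) (hf.toLp f)
  rw [inner_toLp_toLp] at h
  have h2 : ∀ a, (starRingEnd ℂ) (f a) * f a = ((‖f a‖ ^ 2 : ℝ) : ℂ) := by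
    intro a
    rw [Complex.conj_mul']; push_cast; rfl
  simp only [h2, integral_complex_ofReal] at h
  exact Complex.ofReal_injective (by rw [h]; push_cast; rfl)

section Isometry

variable {Ω : Type*} [MeasurableSpace Ω] {P : Measure Ω}
  {X : ℝ → Ω → ℝ} {η : 𝓢(ℝ, ℝ) → Ω → ℝ} {SX Sη : ℝ → ℝ}

lemma measurable_noisyPSD (hX : IsGaussianSource P X SX) (hη : IsGaussianNoise P η Sη) :
    Measurable fun f => SX f + Sη f := hX.psd.measurable.add hη.psd.measurable

lemma noisyPSD_nonneg (hX : IsGaussianSource P X SX) (hη : IsGaussianNoise P η Sη) (f : ℝ) :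
    0 ≤ SX f + Sη f := add_nonneg (hX.psd.nonneg f) (hη.psd.nonneg f)

lemma hasTemperateGrowth_noisy (hX : IsGaussianSource P X SX) (hη : IsGaussianNoise P η Sη) :
    (spectralMeasure fun f => SX f + Sη f).HasTemperateGrowth := by
  obtain ⟨n, hn⟩ := hη.tempered
  refine hasTemperateGrowth_spectralMeasure (n := n) (measurable_noisyPSD hX hη)
    (noisyPSD_nonneg hX hη) ?_
  simp only [add_div]
  refine Integrable.add (hX.integrable.mono' ?_ (ae_of_all _ fun f => ?_)) hn
  · exact (hX.psd.measurable.div (by fun_prop)).aestronglyMeasurable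
  · rw [Real.norm_of_nonneg (div_nonneg (hX.psd.nonneg f) (by positivity))]
    exact div_le_self (hX.psd.nonneg f) (one_le_pow₀ (by nlinarith [sq_nonneg f]))

lemma ratioPSD_le_left (h0 : ∀ f, 0 ≤ SX f) (h1 : ∀ f, 0 ≤ Sη f) (f : ℝ) :
    ratioPSD SX Sη f ≤ SX f := by
  rw [ratioPSD]
  refine div_le_of_le_mul₀ (add_nonneg (h0 f) (h1 f)) (h0 f) ?_
  nlinarith [h0 f, h1 f, mul_nonneg (h0 f) (h1 f)]

lemma ratioPSD_nonneg (h0 : ∀ f, 0 ≤ SX f) (h1 : ∀ f, 0 ≤ Sη f) (f : ℝ) :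
    0 ≤ ratioPSD SX Sη f :=
  div_nonneg (sq_nonneg _) (add_nonneg (h0 f) (h1 f))

lemma measurable_ratioPSD (hm : Measurable SX) (hn : Measurable Sη) :
    Measurable (ratioPSD SX Sη) := by
  unfold ratioPSD; fun_prop

/-- The bound `ρ ≤ S_X` gives integrability even when the noise has infinite power. -/
lemma integrable_ratioPSD (hX : IsGaussianSource P X SX) (hη : IsGaussianNoise P η Sη) :
    Integrable (ratioPSD SX Sη) := by
  refine hX.integrable.mono'
    (measurable_ratioPSD hX.psd.measurable hη.psd.measurable).aestronglyMeasurable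
    (ae_of_all _ fun f => ?_)
  rw [Real.norm_of_nonneg (ratioPSD_nonneg hX.psd.nonneg hη.psd.nonneg f)]
  exact ratioPSD_le_left hX.psd.nonneg hη.psd.nonneg f

/-- The Wiener filter `S_X / S_{X+η}` with delay `t` is square integrable. -/
lemma memLp_wiener (hX : IsGaussianSource P X SX) (hη : IsGaussianNoise P η Sη) (t : ℝ) :
    MemLp (fun f => ((SX f / (SX f + Sη f) : ℝ) : ℂ) * phase t f) 2
      (spectralMeasure fun f => SX f + Sη f) := by
  have hm := hX.psd.measurable
  have hn := hη.psd.measurable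
  have hp := (continuous_phase t).measurable
  rw [memLp_two_spectralMeasure_iff (measurable_noisyPSD hX hη) (noisyPSD_nonneg hX hη)
    (by fun_prop)]
  -- Weighted by `S_{X+η}`, the squared modulus of the Wiener filter is `ρ`.
  refine (integrable_ratioPSD hX hη).congr (ae_of_all _ fun f => ?_)
  simp only [norm_mul, norm_phase, mul_one, Complex.norm_real, ratioPSD, Real.norm_eq_abs, sq_abs]
  by_cases h : SX f + Sη f = 0
  · simp [h]
  · field_simp

variable [IsProbabilityMeasure P] (hX : IsGaussianSource P X SX) (hη : IsGaussianNoise P η Sη)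

omit [IsProbabilityMeasure P] in
include hX in
lemma memLp_eval_ofReal (t : ℝ) : MemLp (fun ω => (X t ω : ℂ)) 2 P := (hX.memLp t).ofReal

include hX hη in
lemma memLp_noisyInput_ofReal (u : 𝓢(ℝ, ℝ)) : MemLp (fun ω => (noisyInput X η u ω : ℂ)) 2 P :=
  (memLp_noisyInput hX hη u).ofReal

include hX hη in
/-- The linear isometry from the spectral domain `L²(S_{X+η})` to `L²(P)` that sends the multiplier
of a test function `u` to the noisy input tested against `u`. -/
theorem exists_spectralIsometry
    (hindep : IndepFun (fun ω t => X t ω) (fun ω u => η u ω) P)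
    [(spectralMeasure fun f => SX f + Sη f).HasTemperateGrowth] :
    ∃ Ψ : Lp ℂ 2 (spectralMeasure fun f => SX f + Sη f) →ₗᵢ[ℂ] Lp ℂ 2 P,
      (∀ u, Ψ ((memLp_multiplier _ u).toLp _) = (memLp_noisyInput_ofReal hX hη u).toLp _) ∧
      ∀ t (g : ℝ → ℂ) (hg : MemLp g 2 (spectralMeasure fun f => SX f + Sη f)),
        ⟪(memLp_eval_ofReal hX t).toLp _, Ψ (hg.toLp g)⟫_ℂ =
          ∫ f, (SX f : ℂ) * (starRingEnd ℂ) (phase t f) * g f := by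
  set S : ℝ → ℝ := fun f => SX f + Sη f with hS
  set μ := spectralMeasure S with hμ
  have hSm : Measurable S := measurable_noisyPSD hX hη
  have hS0 : ∀ f, 0 ≤ S f := noisyPSD_nonneg hX hη
  have := isFiniteMeasureOnCompacts_of_hasTemperateGrowth μ
  let x : 𝓢(ℝ, ℝ) → Lp ℂ 2 μ := fun u => (memLp_multiplier μ u).toLp _
  let y : 𝓢(ℝ, ℝ) → Lp ℂ 2 P := fun u => (memLp_noisyInput_ofReal hX hη u).toLp _
  have hdense : Dense (Submodule.span ℂ (range x) : Set (Lp ℂ 2 μ)) := by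
    intro g
    rw [EMetric.mem_closure_iff]
    intro ε hε
    obtain ⟨δ, hδ0, hδ⟩ := exists_between hε
    obtain ⟨u, v, huv⟩ := exists_multiplier_eLpNorm_sub_le μ (Lp.memLp g) hδ0
    refine ⟨x u + Complex.I • x v, Submodule.add_mem _ (Submodule.subset_span ⟨u, rfl⟩)
      (Submodule.smul_mem _ _ (Submodule.subset_span ⟨v, rfl⟩)), ?_⟩
    rw [edist_comm, Lp.edist_def]
    refine lt_of_le_of_lt (le_trans (le_of_eq (eLpNorm_congr_ae ?_)) huv) hδ
    filter_upwards [(memLp_multiplier μ u).coeFn_toLp, (memLp_multiplier μ v).coeFn_toLp,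
      Lp.coeFn_add (x u) (Complex.I • x v), Lp.coeFn_smul Complex.I (x v)] with f h1 h2 h3 h4
    simp only [x] at h3 h4
    simp only [Pi.sub_apply, x, h3, Pi.add_apply, h1, h4, Pi.smul_apply, h2, smul_eq_mul]
  have hgram : ∀ u v, ⟪x u, x v⟫_ℂ = ⟪y u, y v⟫_ℂ := by
    intro u v
    have h := integral_noisyInput_mul_noisyInput hX hη hindep v u
    simp only [x, y, inner_toLp_toLp]
    rw [hμ, integral_spectralMeasure hSm hS0]
    simp only [Complex.conj_ofReal, ← Complex.ofReal_mul, integral_complex_ofReal,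
      Complex.real_smul]
    simp only [mul_comm (noisyInput X η u _), h, mul_comm ((starRingEnd ℂ) _)]
    rfl
  obtain ⟨Ψ, hΨ⟩ := exists_linearIsometry_of_inner_eq x y hdense hgram
  refine ⟨Ψ, hΨ, fun t g hg => ?_⟩
  -- The Wiener filter represents the functional on the right as an inner product and so shows that
  -- it is continuous; where `S` vanishes, `S_X` does too.
  have hwien : ∀ (g : ℝ → ℂ) (hg : MemLp g 2 μ),
      ⟪(memLp_wiener hX hη t).toLp _, hg.toLp g⟫_ℂ =
        ∫ f, (SX f : ℂ) * (starRingEnd ℂ) (phase t f) * g f := by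
    intro g hg
    rw [inner_toLp_toLp, integral_spectralMeasure hSm hS0]
    refine integral_congr_ae (ae_of_all _ fun f => ?_)
    simp only [map_mul, Complex.conj_ofReal, Complex.real_smul, ← mul_assoc,
      ← Complex.ofReal_mul]
    congr 3
    by_cases h : S f = 0
    · have : SX f = 0 := le_antisymm (by simp only [hS] at h; linarith [hη.psd.nonneg f])
        (hX.psd.nonneg f)
      simp [this]
    · simp only [hS] at h ⊢
      field_simp
  rw [← hwien g hg]
  -- Two continuous functionals that agree on the total family of multipliers are equal.
  have hext : (innerSL ℂ ((memLp_eval_ofReal hX t).toLp _)).comp Ψ.toContinuousLinearMap =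
      innerSL ℂ ((memLp_wiener hX hη t).toLp _) := by
    refine ContinuousLinearMap.ext_on hdense ?_
    rintro _ ⟨u, rfl⟩
    simp only [ContinuousLinearMap.comp_apply, innerSL_apply_apply,
      LinearIsometry.coe_toContinuousLinearMap, hΨ, x, y, hwien]
    have h := congrArg (starRingEnd ℂ) (integral_eval_mul_noisyInput hX hη hindep t u)
    rw [Complex.conj_ofReal, ← integral_conj] at h
    rw [inner_toLp_toLp]
    simp only [Complex.conj_ofReal, ← Complex.ofReal_mul, integral_complex_ofReal, h]
    refine integral_congr_ae (ae_of_all _ fun f => ?_)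
    simp only [map_mul, Complex.conj_ofReal, Complex.conj_conj, phase]
  exact DFunLike.congr_fun hext (hg.toLp g)

/-! ### Filter outputs -/

variable {H : ℝ → ℂ} {Z : ℝ → Ω → ℂ}

omit [IsProbabilityMeasure P] in
include hX hη in
lemma memLp_phase_mul (hH : IsAdmissible SX Sη H) (t : ℝ) :
    MemLp (fun f => phase t f * H f) 2 (spectralMeasure fun f => SX f + Sη f) := by
  have hm := hH.measurable
  have hp := (continuous_phase t).measurable
  rw [memLp_two_spectralMeasure_iff (measurable_noisyPSD hX hη) (noisyPSD_nonneg hX hη)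
    (by fun_prop)]
  simpa only [norm_mul, norm_phase, one_mul] using hH.integrable

section

variable [(spectralMeasure fun f => SX f + Sη f).HasTemperateGrowth]
  {Ψ : Lp ℂ 2 (spectralMeasure fun f => SX f + Sη f) →ₗᵢ[ℂ] Lp ℂ 2 P}
  (hΨ : ∀ u, Ψ ((memLp_multiplier _ u).toLp _) = (memLp_noisyInput_ofReal hX hη u).toLp _)

omit [(spectralMeasure fun f => SX f + Sη f).HasTemperateGrowth] in
include hX hη in
lemma memLp_noisyInput_add_I_mul (u v : 𝓢(ℝ, ℝ)) :
    MemLp (fun ω => (noisyInput X η u ω : ℂ) + Complex.I * (noisyInput X η v ω : ℂ)) 2 P :=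
  (memLp_noisyInput_ofReal hX hη u).add ((memLp_noisyInput_ofReal hX hη v).const_mul _)

lemma memLp_multiplier_add_I_mul (μ : Measure ℝ) [μ.HasTemperateGrowth] (u v : 𝓢(ℝ, ℝ)) :
    MemLp (fun f => multiplier u f + Complex.I * multiplier v f) 2 μ :=
  (memLp_multiplier μ u).add ((memLp_multiplier μ v).const_mul _)

include hΨ in
lemma spectralIsometry_multiplier_add (u v : 𝓢(ℝ, ℝ)) :
    Ψ ((memLp_multiplier_add_I_mul _ u v).toLp _) =
      (memLp_noisyInput_add_I_mul hX hη u v).toLp _ := by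
  have h1 : (memLp_multiplier_add_I_mul (spectralMeasure fun f => SX f + Sη f) u v).toLp _ =
      (memLp_multiplier _ u).toLp _ + Complex.I • (memLp_multiplier _ v).toLp _ := by
    rw [← MemLp.toLp_const_smul, ← MemLp.toLp_add]; rfl
  have h2 : (memLp_noisyInput_add_I_mul hX hη u v).toLp _ =
      (memLp_noisyInput_ofReal hX hη u).toLp _ +
        Complex.I • (memLp_noisyInput_ofReal hX hη v).toLp _ := by
    rw [← MemLp.toLp_const_smul, ← MemLp.toLp_add]; rfl
  rw [h1, h2, map_add, map_smul, hΨ, hΨ]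

omit [(spectralMeasure fun f => SX f + Sη f).HasTemperateGrowth] in
include hX hη in
-- Convergence of the distances to zero makes one of them finite, so `Z t` is a sum of two functions
-- in `L²`.
lemma IsFilterOutput.memLp (hZ : IsFilterOutput P X η SX Sη H Z) (t : ℝ) : MemLp (Z t) 2 P := by
  obtain ⟨u, v, -, h⟩ := hZ.approx t
  obtain ⟨j, hj⟩ := (h.eventually (gt_mem_nhds ENNReal.zero_lt_top)).exists
  have hW := memLp_noisyInput_add_I_mul hX hη (u j) (v j)
  have hd : MemLp (fun ω => Z t ω - ((noisyInput X η (u j) ω : ℂ)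
      + Complex.I * (noisyInput X η (v j) ω : ℂ))) 2 P :=
    ⟨(hZ.measurable t).aestronglyMeasurable.sub hW.1, hj⟩
  exact (hd.add hW).ae_eq (ae_of_all _ fun ω => by simp)

include hΨ in
/-- The output of the filter `H` is the image of `e^{2πi f t} H(f)` under the spectral
isometry. -/
lemma IsFilterOutput.toLp_eq (hH : IsAdmissible SX Sη H)
    (hZ : IsFilterOutput P X η SX Sη H Z) (t : ℝ) :
    Ψ ((memLp_phase_mul hX hη hH t).toLp _) = (hZ.memLp hX hη t).toLp _ := by
  obtain ⟨u, v, h1, h2⟩ := hZ.approx t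
  have t1 := (Lp.tendsto_Lp_iff_tendsto_eLpNorm'' _
    (fun j => memLp_multiplier_add_I_mul (spectralMeasure fun f => SX f + Sη f) (u j) (v j)) _
    (memLp_phase_mul hX hη hH t)).2 h1
  have t2 := (Lp.tendsto_Lp_iff_tendsto_eLpNorm'' _
    (fun j => memLp_noisyInput_add_I_mul hX hη (u j) (v j)) _ (hZ.memLp hX hη t)).2 (by
      refine h2.congr fun j => ?_
      rw [← eLpNorm_neg]
      congr 1 with ω
      simp)
  have t3 := (Ψ.continuous.tendsto _).comp t1
  simp only [Function.comp_def, spectralIsometry_multiplier_add hX hη hΨ] at t3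
  exact tendsto_nhds_unique t3 t2

include hX hη hΨ in
-- The isometric image of `e^{2πift} H` serves as output: density provides the test functions, and
-- the isometry transports their convergence to `L²(P)`.
lemma exists_isFilterOutput (hH : IsAdmissible SX Sη H) :
    ∃ Z, IsFilterOutput P X η SX Sη H Z := by
  have := isFiniteMeasureOnCompacts_of_hasTemperateGrowth (spectralMeasure fun f => SX f + Sη f)
  refine ⟨fun t => Ψ ((memLp_phase_mul hX hη hH t).toLp _), fun t =>
    (Lp.stronglyMeasurable _).measurable, fun t => ?_⟩
  obtain ⟨u, v, huv⟩ := exists_multiplier_tendsto _ (memLp_phase_mul hX hη hH t)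
  refine ⟨u, v, huv, ?_⟩
  have t1 := (Lp.tendsto_Lp_iff_tendsto_eLpNorm'' _
    (fun j => memLp_multiplier_add_I_mul (spectralMeasure fun f => SX f + Sη f) (u j) (v j)) _
    (memLp_phase_mul hX hη hH t)).2 huv
  have t3 := (Ψ.continuous.tendsto _).comp t1
  simp only [Function.comp_def, spectralIsometry_multiplier_add hX hη hΨ] at t3
  rw [Lp.tendsto_Lp_iff_tendsto_eLpNorm'] at t3
  refine t3.congr fun j => ?_
  rw [← eLpNorm_neg]
  refine eLpNorm_congr_ae ?_
  filter_upwards [(memLp_noisyInput_add_I_mul hX hη (u j) (v j)).coeFn_toLp] with ω h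
  simp [h]

/-! ### The error of linear estimators -/

/-- The trigonometric polynomial `∑ c_n e^{2πi f n / fs}`. -/
def trigPoly (fs : ℝ) (c : ℤ →₀ ℂ) (f : ℝ) : ℂ := c.sum fun n a => a * phase ((n : ℝ) / fs) f

lemma trigPoly_single (fs : ℝ) (n : ℤ) (a : ℂ) (f : ℝ) :
    trigPoly fs (Finsupp.single n a) f = a * phase ((n : ℝ) / fs) f := by
  rw [trigPoly, Finsupp.sum_single_index (by simp)]

lemma trigPoly_add (fs : ℝ) (c d : ℤ →₀ ℂ) (f : ℝ) :
    trigPoly fs (c + d) f = trigPoly fs c f + trigPoly fs d f := by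
  rw [trigPoly, Finsupp.sum_add_index' (by simp) (by intros; ring)]
  rfl

include hΨ in
-- Delaying by `n / fs` multiplies `H` by a phase; linearity of the isometry reduces everything to a
-- single sample. The integrability proofs sit inside the existential because they are built along
-- the same induction.
lemma spectralIsometry_trigPoly (hH : IsAdmissible SX Sη H)
    (hZ : IsFilterOutput P X η SX Sη H Z) (fs : ℝ) (c : ℤ →₀ ℂ) :
    ∃ (hg : MemLp (fun f => trigPoly fs c f * H f) 2 (spectralMeasure fun f => SX f + Sη f))
      (hY : MemLp (fun ω => c.sum fun n a => a * samples fs Z n ω) 2 P),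
      Ψ (hg.toLp _) = hY.toLp _ := by
  induction c using Finsupp.induction_linear with
  | zero =>
    have e1 : (fun f => trigPoly fs 0 f * H f) = 0 := by ext f; simp [trigPoly]
    have e2 : (fun ω => (0 : ℤ →₀ ℂ).sum fun n a => a * samples fs Z n ω) = 0 := by ext ω; simp
    simp only [e1, e2]
    exact ⟨MemLp.zero', MemLp.zero', by simp only [MemLp.toLp_zero, map_zero]⟩
  | add c d hc hd =>
    obtain ⟨g1, y1, e1⟩ := hc
    obtain ⟨g2, y2, e2⟩ := hd
    have h1 : (fun f => trigPoly fs (c + d) f * H f) =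
        (fun f => trigPoly fs c f * H f) + fun f => trigPoly fs d f * H f := by
      ext f; simp only [trigPoly_add, add_mul, Pi.add_apply]
    have h2 : (fun ω => (c + d).sum fun n a => a * samples fs Z n ω) =
        (fun ω => c.sum fun n a => a * samples fs Z n ω) +
          fun ω => d.sum fun n a => a * samples fs Z n ω := by
      ext ω
      rw [Finsupp.sum_add_index' (by simp) (by intros; ring)]
      rfl
    simp only [h1, h2]
    refine ⟨g1.add g2, y1.add y2, ?_⟩
    rw [MemLp.toLp_add g1 g2, MemLp.toLp_add y1 y2, map_add, e1, e2]
  | single n a =>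
    have h1 : (fun f => trigPoly fs (Finsupp.single n a) f * H f) =
        a • fun f => phase ((n : ℝ) / fs) f * H f := by
      ext f; simp only [trigPoly_single, Pi.smul_apply, smul_eq_mul, mul_assoc]
    have h2 : (fun ω => (Finsupp.single n a).sum fun n a => a * samples fs Z n ω) =
        a • Z ((n : ℝ) / fs) := by
      ext ω
      rw [Finsupp.sum_single_index (by simp)]
      rfl
    simp only [h1, h2]
    have g := memLp_phase_mul hX hη hH ((n : ℝ) / fs)
    refine ⟨g.const_smul a, (hZ.memLp hX hη _).const_smul a, ?_⟩
    rw [MemLp.toLp_const_smul a g, MemLp.toLp_const_smul, map_smul, hZ.toLp_eq hX hη hΨ hH]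

end

include hX hη in
/-- The linear estimation error in the spectral domain. -/
theorem linearError_eq_iInf (hindep : IndepFun (fun ω t => X t ω) (fun ω u => η u ω) P)
    (hH : IsAdmissible SX Sη H) (hZ : IsFilterOutput P X η SX Sη H Z) (fs t : ℝ) :
    linearError P X (samples fs Z) t = ⨅ c : ℤ →₀ ℂ,
      ((∫ f, SX f)
        - 2 * (∫ f, (SX f : ℂ) * (starRingEnd ℂ) (phase t f) * (trigPoly fs c f * H f)).re
        + ∫ f, (SX f + Sη f) * ‖trigPoly fs c f * H f‖ ^ 2) := by
  have := hasTemperateGrowth_noisy hX hη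
  obtain ⟨Ψ, hΨ, hinner⟩ := exists_spectralIsometry hX hη hindep
  rw [linearError]
  congr 1 with c
  obtain ⟨hg, hY, hc⟩ := spectralIsometry_trigPoly hX hη hΨ hH hZ fs c
  have hXt := memLp_eval_ofReal hX t
  have h1 := norm_toLp_sq (hXt.sub hY)
  rw [MemLp.toLp_sub hXt hY, ← hc, norm_sub_sq (𝕜 := ℂ), hinner, norm_toLp_sq, Ψ.norm_map,
    norm_toLp_sq, integral_spectralMeasure (measurable_noisyPSD hX hη) (noisyPSD_nonneg hX hη)] at h1
  simp only [Pi.sub_apply, Complex.norm_real, Real.norm_eq_abs, sq_abs, hX.integral_sq] at h1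
  exact h1.symm

end Isometry

/-! ### Periodization -/

/-- One period of frequencies. -/
def baseBand (fs : ℝ) : Set ℝ := Ioc (-fs / 2) (fs / 2)

/-- The periodization `∑_k g(f - fs k)`. -/
def wrap {E : Type*} [AddCommMonoid E] [TopologicalSpace E] (fs : ℝ) (g : ℝ → E) (f : ℝ) : E :=
  ∑' k : ℤ, g (f - fs * k)

lemma measurableSet_baseBand (fs : ℝ) : MeasurableSet (baseBand fs) := measurableSet_Ioc

lemma restrict_baseBand (fs : ℝ) :
    volume.restrict (baseBand fs) = volume.restrict (Ioo (-fs / 2) (fs / 2)) :=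
  Measure.restrict_congr_set Ioo_ae_eq_Ioc.symm

section Wrap

variable {fs : ℝ} (hfs : 0 < fs)

include hfs in
lemma lintegral_eq_tsum_baseBand (g : ℝ → ℝ≥0∞) :
    ∫⁻ f, g f = ∑' k : ℤ, ∫⁻ f in baseBand fs, g (f - fs * k) := by
  have hshift : ∀ k : ℤ, ∫⁻ f in Ioc (-fs / 2 + k • fs) (-fs / 2 + (k + 1) • fs), g f =
      ∫⁻ f in baseBand fs, g (f + fs * k) := by
    intro k
    rw [← (measurePreserving_add_right volume (fs * k)).setLIntegral_comp_preimage_emb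
      (measurableEmbedding_addRight _)]
    congr 2
    ext x
    simp only [mem_preimage, mem_Ioc, baseBand, zsmul_eq_mul, Int.cast_add, Int.cast_one]
    constructor <;> rintro ⟨h1, h2⟩ <;> constructor <;> linarith
  rw [← setLIntegral_univ, ← iUnion_Ioc_add_zsmul hfs (-fs / 2),
    lintegral_iUnion (fun _ => measurableSet_Ioc) (pairwise_disjoint_Ioc_add_zsmul _ _)]
  simp only [hshift]
  -- The tiles are translates by `+ fs * k`, the periodization uses `- fs * k`; negating the index
  -- reconciles them.
  rw [← (Equiv.neg ℤ).tsum_eq]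
  simp only [Equiv.neg_apply, Int.cast_neg, mul_neg, sub_eq_add_neg]

variable {E : Type*} [NormedAddCommGroup E] {g : ℝ → E}

include hfs in
lemma tsum_lintegral_enorm_ne_top (hg : Integrable g) :
    ∑' k : ℤ, ∫⁻ f in baseBand fs, ‖g (f - fs * k)‖ₑ ≠ ∞ := by
  rw [← lintegral_eq_tsum_baseBand hfs (fun f => ‖g f‖ₑ)]
  exact hg.2.ne

variable [NormedSpace ℝ E] [FiniteDimensional ℝ E] [MeasurableSpace E] [BorelSpace E]

omit [NormedSpace ℝ E] [FiniteDimensional ℝ E] in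
include hfs in
lemma ae_summable_norm_wrap (hm : Measurable g) (hg : Integrable g) :
    ∀ᵐ f ∂(volume.restrict (baseBand fs)), Summable fun k : ℤ => ‖g (f - fs * k)‖ := by
  have h := tsum_lintegral_enorm_ne_top hfs hg
  have hmk : ∀ k : ℤ, Measurable fun f => ‖g (f - fs * k)‖ₑ := fun k =>
    (hm.comp (measurable_id.sub_const _)).enorm
  rw [← lintegral_tsum fun k => (hmk k).aemeasurable] at h
  filter_upwards [ae_lt_top (Measurable.tsum hmk) h] with f hf
  exact tsum_enorm_ne_top_iff_summable_norm.1 hf.ne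

lemma measurable_wrap (fs : ℝ) (hm : Measurable g) : Measurable (wrap fs g) :=
  have := FiniteDimensional.proper_real E
  Measurable.tsum fun _ => hm.comp (measurable_id.sub_const _)

include hfs in
lemma integrable_wrap (hm : Measurable g) (hg : Integrable g) :
    IntegrableOn (wrap fs g) (baseBand fs) := by
  have h := tsum_lintegral_enorm_ne_top hfs hg
  have hmk : ∀ k : ℤ, Measurable fun f => ‖g (f - fs * k)‖ₑ := fun k =>
    (hm.comp (measurable_id.sub_const _)).enorm
  have := FiniteDimensional.proper_real E
  refine ⟨(measurable_wrap fs hm).aestronglyMeasurable, ?_⟩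
  rw [← lintegral_tsum fun k => (hmk k).aemeasurable] at h
  refine lt_of_le_of_lt (lintegral_mono_ae ?_) h.lt_top
  filter_upwards with f
  exact enorm_tsum_le_tsum_enorm

include hfs in
-- The line is tiled by translates of one period, and absolute integrability permits exchanging sum
-- and integral.
lemma integral_wrap (hm : Measurable g) (hg : Integrable g) :
    ∫ f in baseBand fs, wrap fs g f = ∫ f, g f := by
  have hshift : ∀ k : ℤ, ∫ f in Ioc (-fs / 2 + k • fs) (-fs / 2 + (k + 1) • fs), g f =
      ∫ f in baseBand fs, g (f + fs * k) := by
    intro k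
    rw [← (measurePreserving_add_right volume (fs * k)).setIntegral_preimage_emb
      (measurableEmbedding_addRight _)]
    congr 2
    ext x
    simp only [mem_preimage, mem_Ioc, baseBand, zsmul_eq_mul, Int.cast_add, Int.cast_one]
    constructor <;> rintro ⟨h1, h2⟩ <;> constructor <;> linarith
  have hsum := hasSum_integral_iUnion (μ := volume) (f := g)
    (fun k : ℤ => measurableSet_Ioc (a := -fs / 2 + k • fs) (b := -fs / 2 + (k + 1) • fs))
    (pairwise_disjoint_Ioc_add_zsmul (-fs / 2) fs) hg.integrableOn
  rw [iUnion_Ioc_add_zsmul hfs, setIntegral_univ] at hsum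
  simp only [wrap]
  rw [integral_tsum (f := fun (k : ℤ) x => g (x - fs * k)) (fun k => (hm.comp (measurable_id.sub_const _)).aestronglyMeasurable)
    (tsum_lintegral_enorm_ne_top hfs hg), ← hsum.tsum_eq]
  simp only [hshift]
  rw [← (Equiv.neg ℤ).tsum_eq]
  simp only [Equiv.neg_apply, Int.cast_neg, mul_neg, sub_neg_eq_add]

end Wrap

/-! ### Density of trigonometric polynomials -/

/-- This is the source of aliasing: a shift by `fs * k` changes the exponent by `2πi` times the
integer `-(n * k)`. -/
lemma phase_sub (fs : ℝ) (hfs : fs ≠ 0) (n k : ℤ) (f : ℝ) :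
    phase ((n : ℝ) / fs) (f - fs * k) = phase ((n : ℝ) / fs) f := by
  have hc : (fs : ℂ) ≠ 0 := by exact_mod_cast hfs
  simp only [phase]
  rw [Complex.exp_eq_exp_iff_exists_int]
  refine ⟨-(n * k), ?_⟩
  push_cast
  field_simp
  ring

lemma trigPoly_sub (fs : ℝ) (hfs : fs ≠ 0) (c : ℤ →₀ ℂ) (k : ℤ) (f : ℝ) :
    trigPoly fs c (f - fs * k) = trigPoly fs c f := by
  simp only [trigPoly, phase_sub fs hfs]

lemma continuous_trigPoly (fs : ℝ) (c : ℤ →₀ ℂ) : Continuous (trigPoly fs c) :=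
  continuous_finsetSum _ fun _ _ => continuous_const.mul (continuous_phase _)

lemma norm_trigPoly_le (fs : ℝ) (c : ℤ →₀ ℂ) (f : ℝ) :
    ‖trigPoly fs c f‖ ≤ c.sum fun _ a => ‖a‖ := by
  refine (norm_sum_le _ _).trans (le_of_eq (Finset.sum_congr rfl fun n _ => ?_))
  rw [norm_mul, norm_phase, mul_one]

/-- Trigonometric polynomials are uniformly dense in the continuous functions, and these are dense
in `L²` of any finite measure on the circle, not only Haar measure. -/
lemma exists_finsupp_fourier_eLpNorm_le {T : ℝ} [Fact (0 < T)] (ν : Measure (AddCircle T))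
    [IsFiniteMeasure ν] {φ : AddCircle T → ℂ} (hφ : MemLp φ 2 ν) {ε : ℝ≥0∞} (hε : 0 < ε) :
    ∃ c : ℤ →₀ ℂ, eLpNorm (fun x => (c.sum fun n a => a * fourier n x) - φ x) 2 ν < ε := by
  have hspan : (Submodule.span ℂ (range fun n : ℤ =>
      ContinuousMap.toLp 2 ν ℂ (fourier (T := T) n))).topologicalClosure = ⊤ := by
    have h1 := (ContinuousMap.toLp_denseRange ℂ ν ℂ (p := 2)
      ENNReal.ofNat_ne_top).topologicalClosure_map_submodule span_fourier_closure_eq_top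
    rw [Submodule.map_span] at h1
    rw [← h1]
    congr 2
    ext x
    simp [Set.mem_image]
  have hd : Dense (Submodule.span ℂ (range fun n : ℤ =>
      ContinuousMap.toLp 2 ν ℂ (fourier (T := T) n)) : Set (Lp ℂ 2 ν)) :=
    Submodule.dense_iff_topologicalClosure_eq_top.2 hspan
  obtain ⟨y, hy, hyε⟩ := EMetric.mem_closure_iff.1 (hd (hφ.toLp φ)) ε hε
  obtain ⟨c, rfl⟩ := (Finsupp.mem_span_range_iff_exists_finsupp).1 hy
  refine ⟨c, lt_of_le_of_lt (le_of_eq ?_) hyε⟩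
  have hc : (c.sum fun n a => a • ContinuousMap.toLp 2 ν ℂ (fourier (T := T) n)) =
      ContinuousMap.toLp 2 ν ℂ (c.sum fun n a => a • fourier (T := T) n) := by
    simp only [Finsupp.sum, map_sum, map_smul]
  rw [edist_comm, Lp.edist_def, hc]
  refine eLpNorm_congr_ae ?_
  filter_upwards [hφ.coeFn_toLp, ContinuousMap.coeFn_toLp ν
    (𝕜 := ℂ) (p := 2) (c.sum fun n a => a • fourier (T := T) n)] with x h1 h2
  rw [Pi.sub_apply, h1, h2]
  simp [Finsupp.sum, ContinuousMap.sum_apply]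

lemma fourier_coe_eq_phase (fs : ℝ) (n : ℤ) (f : ℝ) :
    fourier n (f : AddCircle fs) = phase ((n : ℝ) / fs) f := by
  rw [fourier_coe_apply, phase]
  congr 1
  push_cast
  ring

/-- Trigonometric polynomials are dense in `L²` of one period, with any integrable weight. -/
theorem exists_trigPoly_integral_lt {fs : ℝ} (hfs : 0 < fs) {A : ℝ → ℝ} (hAm : Measurable A)
    (hA0 : ∀ f, 0 ≤ A f) (hA : IntegrableOn A (baseBand fs)) {φ : ℝ → ℂ} (hφm : Measurable φ)
    (hφ : IntegrableOn (fun f => A f * ‖φ f‖ ^ 2) (baseBand fs)) {ε : ℝ} (hε : 0 < ε) :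
    ∃ c : ℤ →₀ ℂ, ∫ f in baseBand fs, A f * ‖trigPoly fs c f - φ f‖ ^ 2 < ε := by
  have : Fact (0 < fs) := ⟨hfs⟩
  let μ : Measure ℝ := (volume.restrict (baseBand fs)).withDensity fun f => ENNReal.ofReal (A f)
  have hμac : μ ≪ volume.restrict (baseBand fs) := withDensity_absolutelyContinuous _ _
  have : IsFiniteMeasure μ := isFiniteMeasure_withDensity_ofReal hA.2
  let ν : Measure (AddCircle fs) := μ.map (fun f : ℝ => (f : AddCircle fs))
  have hcoe : Measurable (fun f : ℝ => (f : AddCircle fs)) := AddCircle.measurable_mk'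
  have : IsFiniteMeasure ν := Measure.isFiniteMeasure_map _ _
  -- The weighted measure on one period is pushed to the circle, and `φ` is transported along the
  -- bijection of the half-open period with the circle.
  let ψ : AddCircle fs → ℂ := fun x => φ (AddCircle.measurableEquivIoc fs (-fs / 2) x)
  have hψm : Measurable ψ :=
    hφm.comp (measurable_subtype_coe.comp (AddCircle.measurableEquivIoc fs (-fs / 2)).measurable)
  have hψ : ∀ᵐ f : ℝ ∂μ, ψ (f : AddCircle fs) = φ f := by
    refine hμac.ae_le ?_
    filter_upwards [ae_restrict_mem (measurableSet_baseBand fs)] with f hf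
    have hf' : f ∈ Ioc (-fs / 2) (-fs / 2 + fs) := by
      rw [baseBand] at hf; convert hf using 2; ring
    change φ (AddCircle.equivIoc fs (-fs / 2) f) = φ f
    rw [AddCircle.equivIoc_coe_eq hf']
  have hint : ∀ g : ℝ → ℝ, ∫ f, g f ∂μ = ∫ f in baseBand fs, A f * g f := by
    intro g
    rw [integral_withDensity_eq_integral_toReal_smul (by fun_prop) (by simp)]
    simp only [ENNReal.toReal_ofReal (hA0 _), smul_eq_mul]
  have hφL : MemLp φ 2 μ := by
    rw [← memLp_norm_iff hφm.aestronglyMeasurable,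
      memLp_two_iff_integrable_sq hφm.norm.aestronglyMeasurable,
      integrable_withDensity_iff_integrable_smul' (by fun_prop) (by simp)]
    simpa only [ENNReal.toReal_ofReal (hA0 _), smul_eq_mul, IntegrableOn] using hφ
  have hψL : MemLp ψ 2 ν := by
    rw [memLp_map_measure_iff hψm.aestronglyMeasurable hcoe.aemeasurable]
    exact hφL.ae_eq (hψ.mono fun _ h => h.symm)
  -- The target is a squared norm, so the tolerance for the norm is `√ε`.
  obtain ⟨c, hc⟩ := exists_finsupp_fourier_eLpNorm_le ν hψL
    (ε := ENNReal.ofReal (Real.sqrt ε)) (by simpa using hε)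
  refine ⟨c, ?_⟩
  have hpm : Measurable (trigPoly fs c) := (continuous_trigPoly fs c).measurable
  have hdiff : MemLp (fun f => trigPoly fs c f - φ f) 2 μ := by
    refine MemLp.sub (MemLp.of_bound hpm.aestronglyMeasurable _
      (ae_of_all _ (norm_trigPoly_le fs c))) hφL
  have hmeas : Measurable fun x : AddCircle fs => (c.sum fun n a => a * fourier n x) - ψ x := by
    refine Measurable.sub (Continuous.measurable ?_) hψm
    exact continuous_finsetSum _ fun n _ => continuous_const.mul (fourier n).continuous
  rw [eLpNorm_map_measure hmeas.aestronglyMeasurable hcoe.aemeasurable] at hc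
  have hcongr : eLpNorm ((fun x : AddCircle fs => (c.sum fun n a => a * fourier n x) - ψ x) ∘
      fun f : ℝ => (f : AddCircle fs)) 2 μ = eLpNorm (fun f => trigPoly fs c f - φ f) 2 μ := by
    refine eLpNorm_congr_ae ?_
    filter_upwards [hψ] with f hf
    simp only [Function.comp_apply, fourier_coe_eq_phase, hf, trigPoly]
  rw [hcongr, ← Lp.enorm_toLp hdiff, ← ofReal_norm,
    ENNReal.ofReal_lt_ofReal_iff (Real.sqrt_pos.2 hε), Real.lt_sqrt (norm_nonneg _),
    norm_toLp_sq, hint] at hc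
  exact hc

/-! ### A Cauchy–Schwarz inequality for series -/

/-- Finite Cauchy–Schwarz for `√r` and `√a`, passed to the limit. Without summability of `z` its
`tsum` is zero by convention, so that case needs no argument. -/
lemma norm_tsum_sq_le_of_norm_sq_eq {ι : Type*} {z : ι → ℂ} {r a : ι → ℝ} (hr0 : ∀ i, 0 ≤ r i)
    (ha0 : ∀ i, 0 ≤ a i) (hr : Summable r) (ha : Summable a)
    (hz : ∀ i, ‖z i‖ ^ 2 = r i * a i) :
    ‖∑' i, z i‖ ^ 2 ≤ (∑' i, r i) * ∑' i, a i := by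
  have hzs : ∀ i, ‖z i‖ = √(r i) * √(a i) := fun i => by
    rw [← Real.sqrt_mul (hr0 i), ← hz, Real.sqrt_sq (norm_nonneg _)]
  by_cases hsum : Summable z
  · have h : ‖∑' i, z i‖ ≤ √(∑' i, r i) * √(∑' i, a i) := by
      refine le_of_tendsto hsum.hasSum.norm (Eventually.of_forall fun s => ?_)
      calc ‖∑ i ∈ s, z i‖ ≤ ∑ i ∈ s, √(r i) * √(a i) :=
            (norm_sum_le _ _).trans (le_of_eq (Finset.sum_congr rfl fun i _ => hzs i))
        _ ≤ √(∑ i ∈ s, r i) * √(∑ i ∈ s, a i) := Real.sum_sqrt_mul_sqrt_le _ hr0 ha0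
        _ ≤ _ := by
            gcongr
            · exact hr.sum_le_tsum _ fun i _ => hr0 i
            · exact ha.sum_le_tsum _ fun i _ => ha0 i
    calc ‖∑' i, z i‖ ^ 2 ≤ (√(∑' i, r i) * √(∑' i, a i)) ^ 2 := by gcongr
      _ = _ := by
          rw [mul_pow, Real.sq_sqrt (tsum_nonneg hr0), Real.sq_sqrt (tsum_nonneg ha0)]
  · rw [tsum_eq_zero_of_not_summable hsum]
    simpa using mul_nonneg (tsum_nonneg hr0) (tsum_nonneg ha0)

/-- Completing the square in `p`. Where `A = 0` the hypothesis removes the linear term and all terms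
vanish. -/
lemma neg_two_re_add_eq (z p : ℂ) {A : ℝ} (hz : A = 0 → z = 0) :
    -(2 * (p * z).re) + A * ‖p‖ ^ 2 =
      A * ‖p - (starRingEnd ℂ) z / (A : ℂ)‖ ^ 2 - ‖z‖ ^ 2 / A := by
  by_cases hA : A = 0
  · simp [hA, hz hA]
  · have h1 : (starRingEnd ℂ) z / (A : ℂ) = ((A⁻¹ : ℝ) : ℂ) * (starRingEnd ℂ) z := by
      push_cast; field_simp
    rw [h1, ← Complex.normSq_eq_norm_sq, ← Complex.normSq_eq_norm_sq, ← Complex.normSq_eq_norm_sq]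
    simp only [Complex.normSq_apply, Complex.mul_re, Complex.sub_re, Complex.sub_im,
      Complex.mul_im, Complex.ofReal_re, Complex.ofReal_im, Complex.conj_re, Complex.conj_im]
    field_simp
    ring

/-! ### The linear estimation error in closed form -/

/-- The cross spectral density of the source at time `t` and the output of the filter `H`. -/
def crossPSD (SX : ℝ → ℝ) (H : ℝ → ℂ) (t f : ℝ) : ℂ :=
  (SX f : ℂ) * (starRingEnd ℂ) (phase t f) * H f

/-- The power spectral density of the output of the filter `H`. -/
def outputPSD (SX Sη : ℝ → ℝ) (H : ℝ → ℂ) (f : ℝ) : ℝ := (SX f + Sη f) * ‖H f‖ ^ 2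

section ClosedForm

variable {Ω : Type*} [MeasurableSpace Ω] {P : Measure Ω}
  {X : ℝ → Ω → ℝ} {η : 𝓢(ℝ, ℝ) → Ω → ℝ} {SX Sη : ℝ → ℝ} {H : ℝ → ℂ} {Z : ℝ → Ω → ℂ} {fs : ℝ}

lemma norm_crossPSD (SX : ℝ → ℝ) (H : ℝ → ℂ) (t f : ℝ) :
    ‖crossPSD SX H t f‖ = |SX f| * ‖H f‖ := by
  rw [crossPSD, norm_mul, norm_mul, RCLike.norm_conj, norm_phase, mul_one, Complex.norm_real,
    Real.norm_eq_abs]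

/-- `S_X` vanishes wherever `S_{X+η}` does, so the latter cancels. The factorization feeds both the
Cauchy–Schwarz bound and the weighted-mean form of `estimatorPSD`. -/
lemma norm_crossPSD_sq (h0 : ∀ f, 0 ≤ SX f) (h1 : ∀ f, 0 ≤ Sη f) (t f : ℝ) :
    ‖crossPSD SX H t f‖ ^ 2 = ratioPSD SX Sη f * outputPSD SX Sη H f := by
  rw [norm_crossPSD, mul_pow, sq_abs, ratioPSD, outputPSD]
  by_cases h : SX f + Sη f = 0
  · have : SX f = 0 := le_antisymm (by linarith [h1 f]) (h0 f)
    simp [this]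
  · field_simp

lemma measurable_crossPSD (hm : Measurable SX) (hH : Measurable H) (t : ℝ) :
    Measurable (crossPSD SX H t) := by
  have := (continuous_phase t).measurable
  unfold crossPSD
  fun_prop

variable (hX : IsGaussianSource P X SX) (hη : IsGaussianNoise P η Sη)
  (hH : IsAdmissible SX Sη H)

include hX hη hH

lemma measurable_outputPSD : Measurable (outputPSD SX Sη H) :=
  (measurable_noisyPSD hX hη).mul (hH.measurable.norm.pow_const 2)

omit hH in
lemma outputPSD_nonneg (f : ℝ) : 0 ≤ outputPSD SX Sη H f :=
  mul_nonneg (noisyPSD_nonneg hX hη f) (sq_nonneg _)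

/-- The modulus is the geometric mean of `ρ` and the output density, hence at most their sum. -/
lemma integrable_crossPSD (t : ℝ) : Integrable (crossPSD SX H t) := by
  refine ((integrable_ratioPSD hX hη).add hH.integrable).mono'
    (measurable_crossPSD hX.psd.measurable hH.measurable t).aestronglyMeasurable
    (ae_of_all _ fun f => ?_)
  have h := norm_crossPSD_sq (H := H) hX.psd.nonneg hη.psd.nonneg t f
  have h1 := ratioPSD_nonneg hX.psd.nonneg hη.psd.nonneg f
  have h2 := outputPSD_nonneg hX hη (H := H) f
  simp only [outputPSD] at h h2
  simp only [Pi.add_apply]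
  refine abs_le_of_sq_le_sq' ?_ (by positivity) |>.2
  rw [h]
  nlinarith [sq_nonneg (ratioPSD SX Sη f - (SX f + Sη f) * ‖H f‖ ^ 2), mul_nonneg h1 h2,
    sq_nonneg (ratioPSD SX Sη f), sq_nonneg ((SX f + Sη f) * ‖H f‖ ^ 2)]

omit hH in
lemma summable_ratioPSD_wrap (hfs : 0 < fs) :
    ∀ᵐ f ∂(volume.restrict (baseBand fs)),
      Summable fun k : ℤ => ratioPSD SX Sη (f - fs * k) := by
  filter_upwards [ae_summable_norm_wrap hfs
    (measurable_ratioPSD hX.psd.measurable hη.psd.measurable) (integrable_ratioPSD hX hη)] with f h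
  exact h.of_norm

lemma summable_outputPSD_wrap (hfs : 0 < fs) :
    ∀ᵐ f ∂(volume.restrict (baseBand fs)),
      Summable fun k : ℤ => outputPSD SX Sη H (f - fs * k) := by
  filter_upwards [ae_summable_norm_wrap hfs (measurable_outputPSD hX hη hH) hH.integrable] with f h
  exact h.of_norm

omit hH in
lemma wrap_ratioPSD_nonneg (f : ℝ) : 0 ≤ wrap fs (ratioPSD SX Sη) f :=
  tsum_nonneg fun _ => ratioPSD_nonneg hX.psd.nonneg hη.psd.nonneg _

omit hH in
lemma wrap_outputPSD_nonneg (f : ℝ) : 0 ≤ wrap fs (outputPSD SX Sη H) f :=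
  tsum_nonneg fun _ => outputPSD_nonneg hX hη _

/-- Cauchy–Schwarz over the aliases. The two majorant series do not involve `t`, so one null set
serves all times; the time average relies on this. -/
lemma norm_wrap_crossPSD_sq_le (hfs : 0 < fs) :
    ∀ᵐ f ∂(volume.restrict (baseBand fs)), ∀ t, ‖wrap fs (crossPSD SX H t) f‖ ^ 2 ≤
      wrap fs (ratioPSD SX Sη) f * wrap fs (outputPSD SX Sη H) f := by
  filter_upwards [summable_ratioPSD_wrap hX hη hfs, summable_outputPSD_wrap hX hη hH hfs]
    with f h1 h2 t
  exact norm_tsum_sq_le_of_norm_sq_eq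
    (fun _ => ratioPSD_nonneg hX.psd.nonneg hη.psd.nonneg _)
    (fun _ => outputPSD_nonneg hX hη _) h1 h2
    (fun _ => norm_crossPSD_sq hX.psd.nonneg hη.psd.nonneg _ _)

lemma norm_wrap_crossPSD_sq_div_le (hfs : 0 < fs) :
    ∀ᵐ f ∂(volume.restrict (baseBand fs)), ∀ t,
      ‖wrap fs (crossPSD SX H t) f‖ ^ 2 / wrap fs (outputPSD SX Sη H) f ≤
      wrap fs (ratioPSD SX Sη) f := by
  filter_upwards [norm_wrap_crossPSD_sq_le hX hη hH hfs] with f h t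
  exact div_le_of_le_mul₀ (wrap_outputPSD_nonneg hX hη f) (wrap_ratioPSD_nonneg hX hη f) (h t)

lemma integrable_norm_wrap_crossPSD_sq_div (hfs : 0 < fs) (t : ℝ) :
    IntegrableOn (fun f => ‖wrap fs (crossPSD SX H t) f‖ ^ 2 / wrap fs (outputPSD SX Sη H) f)
      (baseBand fs) := by
  refine (integrable_wrap hfs (measurable_ratioPSD hX.psd.measurable hη.psd.measurable)
    (integrable_ratioPSD hX hη)).mono' ?_ ?_
  · exact (((measurable_wrap fs (measurable_crossPSD hX.psd.measurable hH.measurable t)).norm.pow_const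
      2).div (measurable_wrap fs (measurable_outputPSD hX hη hH))).aestronglyMeasurable
  · filter_upwards [norm_wrap_crossPSD_sq_div_le hX hη hH hfs] with f h
    rw [Real.norm_of_nonneg (div_nonneg (sq_nonneg _) (wrap_outputPSD_nonneg hX hη f))]
    exact h t

/-- The error of a linear estimator, by completing the square on one period. -/
lemma spectral_error_eq (hfs : 0 < fs) (t : ℝ) (c : ℤ →₀ ℂ) :
    IntegrableOn (fun f => wrap fs (outputPSD SX Sη H) f * ‖trigPoly fs c f -
      (starRingEnd ℂ) (wrap fs (crossPSD SX H t) f) / ((wrap fs (outputPSD SX Sη H) f : ℝ) : ℂ)‖ ^ 2)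
      (baseBand fs) ∧
    (∫ f, SX f)
        - 2 * (∫ f, (SX f : ℂ) * (starRingEnd ℂ) (phase t f) * (trigPoly fs c f * H f)).re
        + ∫ f, (SX f + Sη f) * ‖trigPoly fs c f * H f‖ ^ 2 =
      (∫ f, SX f) -
        (∫ f in baseBand fs,
          ‖wrap fs (crossPSD SX H t) f‖ ^ 2 / wrap fs (outputPSD SX Sη H) f) +
        ∫ f in baseBand fs, wrap fs (outputPSD SX Sη H) f * ‖trigPoly fs c f -
          (starRingEnd ℂ) (wrap fs (crossPSD SX H t) f) /
            ((wrap fs (outputPSD SX Sη H) f : ℝ) : ℂ)‖ ^ 2 := by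
  have hpm : Measurable (trigPoly fs c) := (continuous_trigPoly fs c).measurable
  have hKm := measurable_crossPSD hX.psd.measurable hH.measurable t
  have hK := integrable_crossPSD hX hη hH t
  have hAm := measurable_outputPSD hX hη hH
  have hA : Integrable (outputPSD SX Sη H) := hH.integrable
  have hpKm : Measurable fun f => trigPoly fs c f * crossPSD SX H t f := hpm.mul hKm
  have hpAm : Measurable fun f => ‖trigPoly fs c f‖ ^ 2 * outputPSD SX Sη H f :=
    (hpm.norm.pow_const 2).mul hAm
  have hpK : Integrable fun f => trigPoly fs c f * crossPSD SX H t f :=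
    hK.bdd_mul (c := c.sum fun _ a => ‖a‖) hpm.aestronglyMeasurable
      (ae_of_all _ (norm_trigPoly_le fs c))
  have hpA : Integrable fun f => ‖trigPoly fs c f‖ ^ 2 * outputPSD SX Sη H f := by
    refine hA.bdd_mul (c := (c.sum fun _ a => ‖a‖) ^ 2) (hpm.norm.pow_const 2).aestronglyMeasurable
      (ae_of_all _ fun f => ?_)
    rw [norm_pow, norm_norm]
    gcongr
    exact norm_trigPoly_le fs c f
  -- A periodic factor leaves the periodization; this is what reduces the problem to one period.
  have w1 : ∀ f, wrap fs (fun f => trigPoly fs c f * crossPSD SX H t f) f =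
      trigPoly fs c f * wrap fs (crossPSD SX H t) f := by
    intro f
    simp only [wrap, trigPoly_sub fs hfs.ne', tsum_mul_left]
  have w2 : ∀ f, wrap fs (fun f => ‖trigPoly fs c f‖ ^ 2 * outputPSD SX Sη H f) f =
      wrap fs (outputPSD SX Sη H) f * ‖trigPoly fs c f‖ ^ 2 := by
    intro f
    simp only [wrap, trigPoly_sub fs hfs.ne', tsum_mul_left]
    rw [mul_comm]
  have e1 : ∫ f, (SX f : ℂ) * (starRingEnd ℂ) (phase t f) * (trigPoly fs c f * H f) =
      ∫ f in baseBand fs, trigPoly fs c f * wrap fs (crossPSD SX H t) f := by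
    rw [← integral_congr_ae (ae_of_all _ w1), integral_wrap hfs hpKm hpK]
    refine integral_congr_ae (ae_of_all _ fun f => ?_)
    simp only [crossPSD]; ring
  have e2 : ∫ f, (SX f + Sη f) * ‖trigPoly fs c f * H f‖ ^ 2 =
      ∫ f in baseBand fs, wrap fs (outputPSD SX Sη H) f * ‖trigPoly fs c f‖ ^ 2 := by
    rw [← integral_congr_ae (ae_of_all _ w2),
      integral_wrap hfs hpAm hpA]
    refine integral_congr_ae (ae_of_all _ fun f => ?_)
    simp only [outputPSD, norm_mul]; ring
  have i1 : IntegrableOn (fun f => trigPoly fs c f * wrap fs (crossPSD SX H t) f)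
      (baseBand fs) :=
    (integrable_wrap hfs hpKm hpK).congr (ae_of_all _ w1)
  have i1' : IntegrableOn (fun f => (trigPoly fs c f * wrap fs (crossPSD SX H t) f).re)
      (baseBand fs) := i1.re
  have i2 : IntegrableOn (fun f => wrap fs (outputPSD SX Sη H) f * ‖trigPoly fs c f‖ ^ 2)
      (baseBand fs) :=
    (integrable_wrap hfs hpAm hpA).congr (ae_of_all _ w2)
  have i3 := integrable_norm_wrap_crossPSD_sq_div hX hη hH hfs t
  have hsq : ∀ᵐ f ∂(volume.restrict (baseBand fs)),
      -(2 * (trigPoly fs c f * wrap fs (crossPSD SX H t) f).re) +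
        wrap fs (outputPSD SX Sη H) f * ‖trigPoly fs c f‖ ^ 2 +
        ‖wrap fs (crossPSD SX H t) f‖ ^ 2 / wrap fs (outputPSD SX Sη H) f =
      wrap fs (outputPSD SX Sη H) f * ‖trigPoly fs c f -
        (starRingEnd ℂ) (wrap fs (crossPSD SX H t) f) /
          ((wrap fs (outputPSD SX Sη H) f : ℝ) : ℂ)‖ ^ 2 := by
    filter_upwards [norm_wrap_crossPSD_sq_le hX hη hH hfs] with f h
    rw [neg_two_re_add_eq, sub_add_cancel]
    -- Where the folded output density vanishes, Cauchy–Schwarz makes the folded cross density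
    -- vanish as well.
    intro h0
    have := h t
    rw [h0, mul_zero] at this
    simpa using le_antisymm this (sq_nonneg _)
  have i12 : IntegrableOn (fun f =>
      -(2 * (trigPoly fs c f * wrap fs (crossPSD SX H t) f).re) +
        wrap fs (outputPSD SX Sη H) f * ‖trigPoly fs c f‖ ^ 2) (baseBand fs) :=
    (i1'.const_mul 2).neg.add i2
  refine ⟨(i12.add i3).congr hsq, ?_⟩
  rw [← integral_congr_ae hsq, integral_add i12 i3,
    integral_add (f := fun f => -(2 * (trigPoly fs c f * wrap fs (crossPSD SX H t) f).re))
      (i1'.const_mul 2).neg i2, integral_neg, integral_const_mul, e1, e2]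
  have hre : ∫ f in baseBand fs, (trigPoly fs c f * wrap fs (crossPSD SX H t) f).re =
      (∫ f in baseBand fs, trigPoly fs c f * wrap fs (crossPSD SX H t) f).re :=
    integral_re i1
  rw [hre]
  ring

/-- The linear estimation error at time `t`. -/
theorem linearError_eq [IsProbabilityMeasure P]
    (hindep : IndepFun (fun ω t => X t ω) (fun ω u => η u ω) P)
    (hZ : IsFilterOutput P X η SX Sη H Z) (hfs : 0 < fs) (t : ℝ) :
    linearError P X (samples fs Z) t = (∫ f, SX f) -
      ∫ f in baseBand fs,
        ‖wrap fs (crossPSD SX H t) f‖ ^ 2 / wrap fs (outputPSD SX Sη H) f := by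
  rw [linearError_eq_iInf hX hη hindep hH hZ]
  simp only [(spectral_error_eq hX hη hH hfs t _).2]
  have hKm := measurable_wrap fs (measurable_crossPSD hX.psd.measurable hH.measurable t)
  have hAm := measurable_wrap fs (measurable_outputPSD hX hη hH)
  refine ciInf_eq_of_forall_ge_of_forall_gt_exists_lt (fun c => ?_) fun w hw => ?_
  · refine le_add_of_nonneg_right (integral_nonneg fun f => ?_)
    exact mul_nonneg (wrap_outputPSD_nonneg hX hη f) (sq_nonneg _)
  -- For `c = 0` the completed square is the weighted squared modulus of the optimal multiplier; its
  -- integrability is what density needs.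
  · have h0 := (spectral_error_eq hX hη hH hfs t 0).1
    simp only [trigPoly, Finsupp.sum_zero_index, zero_sub, norm_neg] at h0
    obtain ⟨c, hc⟩ := exists_trigPoly_integral_lt hfs hAm (wrap_outputPSD_nonneg hX hη)
      (integrable_wrap hfs (measurable_outputPSD hX hη hH) hH.integrable)
      ((Complex.continuous_conj.measurable.comp hKm).div
        (Complex.measurable_ofReal.comp hAm)) h0 (sub_pos.2 hw)
    refine ⟨c, ?_⟩
    simp only [Pi.div_apply, Function.comp_apply] at hc
    linarith

end ClosedForm

/-! ### Time averages of almost periodic functions -/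

/-- The average of `t ↦ e^{i x t}` over `[-T, T]`. -/
def expAverage (T x : ℝ) : ℂ :=
  ((2 * T)⁻¹ : ℝ) * ∫ t in (-T)..T, Complex.exp (x * t * Complex.I)

lemma norm_exp_mul_mul_I (x t : ℝ) : ‖Complex.exp (x * t * Complex.I)‖ = 1 := by
  rw [← Complex.ofReal_mul]; exact Complex.norm_exp_ofReal_mul_I _

lemma norm_expAverage_le {T : ℝ} (hT : 0 < T) (x : ℝ) : ‖expAverage T x‖ ≤ 1 := by
  have h : ‖∫ t in (-T)..T, Complex.exp (x * t * Complex.I)‖ ≤ 1 * |T - -T| :=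
    intervalIntegral.norm_integral_le_of_norm_le_const fun t _ => (norm_exp_mul_mul_I x t).le
  rw [one_mul, abs_of_pos (by linarith)] at h
  rw [expAverage, norm_mul, Complex.norm_real, Real.norm_of_nonneg (by positivity)]
  calc (2 * T)⁻¹ * _ ≤ (2 * T)⁻¹ * (T - -T) := by gcongr
    _ = 1 := by field_simp; ring

/-- For `x ≠ 0` the integral stays below `2 / |x|`, so the average decays like `1 / T`. -/
lemma tendsto_expAverage (x : ℝ) :
    Tendsto (fun T => expAverage T x) atTop (𝓝 (if x = 0 then 1 else 0)) := by
  split_ifs with hx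
  · refine tendsto_const_nhds.congr' ?_
    filter_upwards [eventually_gt_atTop 0] with T hT
    simp only [expAverage, hx, Complex.ofReal_zero, zero_mul, Complex.exp_zero,
      intervalIntegral.integral_const, Complex.real_smul, mul_one, ← Complex.ofReal_mul]
    rw [show (2 * T)⁻¹ * (T - -T) = 1 by field_simp; ring, Complex.ofReal_one]
  · have hc : (x * Complex.I : ℂ) ≠ 0 :=
      mul_ne_zero (by exact_mod_cast hx) Complex.I_ne_zero
    have hb : ∀ T : ℝ, ‖∫ t in (-T)..T, Complex.exp (x * t * Complex.I)‖ ≤ 2 / |x| := by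
      intro T
      have h1 : ∫ t in (-T)..T, Complex.exp (x * t * Complex.I) =
          ∫ t in (-T)..T, Complex.exp (x * Complex.I * t) := by
        congr 1 with t; ring_nf
      rw [h1, integral_exp_mul_complex hc, norm_div, norm_mul, Complex.norm_I, mul_one,
        Complex.norm_real, Real.norm_eq_abs]
      gcongr
      refine (norm_sub_le _ _).trans (le_of_eq ?_)
      rw [mul_right_comm, norm_exp_mul_mul_I, mul_right_comm, norm_exp_mul_mul_I]
      norm_num
    refine squeeze_zero_norm' (a := fun T : ℝ => (2 * T)⁻¹ * (2 / |x|)) ?_ ?_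
    · filter_upwards [eventually_gt_atTop 0] with T hT
      rw [expAverage, norm_mul, Complex.norm_real, Real.norm_of_nonneg (by positivity)]
      gcongr
      exact hb T
    · have : Tendsto (fun T : ℝ => (2 * T)⁻¹) atTop (𝓝 0) :=
        tendsto_inv_atTop_zero.comp (tendsto_id.const_mul_atTop two_pos)
      simpa using this.mul_const (2 / |x|)

/-- Parseval's identity for an absolutely convergent sum of exponentials with distinct
frequencies. -/
theorem tendsto_average_norm_tsum_sq {ι : Type*} [Countable ι] {a : ι → ℂ}
    (ha : Summable fun i => ‖a i‖) {x : ι → ℝ} (hx : Function.Injective x) :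
    Tendsto (fun T : ℝ => (2 * T)⁻¹ *
        ∫ t in (-T)..T, ‖∑' i, a i * Complex.exp (x i * t * Complex.I)‖ ^ 2)
      atTop (𝓝 (∑' i, ‖a i‖ ^ 2)) := by
  have hterm : ∀ t : ℝ, (Summable fun i => ‖a i * Complex.exp (x i * t * Complex.I)‖) := by
    intro t; simpa only [norm_mul, norm_exp_mul_mul_I, mul_one] using ha
  let b : ι × ι → ℂ := fun p => a p.1 * (starRingEnd ℂ) (a p.2)
  have hb : Summable fun p => ‖b p‖ := by
    simp only [b, norm_mul, RCLike.norm_conj]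
    exact ha.mul_of_nonneg ha (fun _ => norm_nonneg _) (fun _ => norm_nonneg _)
  have hexpand : ∀ t : ℝ, ((‖∑' i, a i * Complex.exp (x i * t * Complex.I)‖ ^ 2 : ℝ) : ℂ) =
      ∑' p : ι × ι, b p * Complex.exp ((x p.1 - x p.2 : ℝ) * t * Complex.I) := by
    intro t
    have hconj : Summable fun i => ‖(starRingEnd ℂ) (a i * Complex.exp (x i * t * Complex.I))‖ := by
      simpa only [RCLike.norm_conj] using hterm t
    rw [Complex.ofReal_pow, ← Complex.mul_conj', Complex.conj_tsum,
      tsum_mul_tsum_of_summable_norm (hterm t) hconj]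
    refine tsum_congr fun p => ?_
    simp only [b, map_mul, ← Complex.exp_conj, Complex.conj_I, Complex.conj_ofReal]
    rw [mul_mul_mul_comm, ← Complex.exp_add]
    congr 2
    push_cast
    ring
  have hint : ∀ T : ℝ, 0 < T → (((2 * T)⁻¹ *
      ∫ t in (-T)..T, ‖∑' i, a i * Complex.exp (x i * t * Complex.I)‖ ^ 2 : ℝ) : ℂ) =
      ∑' p : ι × ι, b p * expAverage T (x p.1 - x p.2) := by
    intro T hT
    have hs := intervalIntegral.tsum_intervalIntegral_eq_of_summable_norm (a := -T) (b := T)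
      (f := fun p : ι × ι => ⟨fun t : ℝ =>
        b p * Complex.exp ((x p.1 - x p.2 : ℝ) * t * Complex.I), by fun_prop⟩) (by
        refine hb.of_nonneg_of_le (fun _ => norm_nonneg _) fun p => ?_
        refine (ContinuousMap.norm_le _ (norm_nonneg _)).2 fun t => ?_
        simp only [ContinuousMap.restrict_apply, ContinuousMap.coe_mk, norm_mul (b p),
          norm_exp_mul_mul_I, mul_one, le_refl])
    simp only [ContinuousMap.coe_mk, intervalIntegral.integral_const_mul] at hs
    rw [Complex.ofReal_mul, ← intervalIntegral.integral_ofReal]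
    simp only [hexpand]
    rw [← hs, ← tsum_mul_left]
    refine tsum_congr fun p => ?_
    rw [expAverage]
    ring
  -- The averages have modulus at most one, so `‖b p‖` dominates and the limit is termwise;
  -- injectivity of `x` then leaves only the diagonal.
  have hlim : Tendsto (fun T : ℝ => ∑' p : ι × ι, b p * expAverage T (x p.1 - x p.2)) atTop
      (𝓝 (∑' p : ι × ι, b p * if x p.1 - x p.2 = 0 then 1 else 0)) := by
    refine tendsto_tsum_of_dominated_convergence hb
      (fun p => (tendsto_expAverage _).const_mul _) ?_
    filter_upwards [eventually_gt_atTop 0] with T hT p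
    rw [norm_mul]
    exact mul_le_of_le_one_right (norm_nonneg _) (norm_expAverage_le hT _)
  have hval : (∑' p : ι × ι, b p * if x p.1 - x p.2 = 0 then 1 else 0) =
      ((∑' i, ‖a i‖ ^ 2 : ℝ) : ℂ) := by
    have hs : Summable fun p : ι × ι => b p * if x p.1 - x p.2 = 0 then 1 else 0 := by
      refine Summable.of_norm_bounded hb fun p => ?_
      split_ifs <;> simp
    rw [hs.tsum_prod, Complex.ofReal_tsum]
    refine tsum_congr fun i => ?_
    rw [tsum_eq_single i]
    · simp [b, Complex.mul_conj']
    · intro j hj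
      rw [if_neg (fun h => hj (hx (sub_eq_zero.1 h)).symm), mul_zero]
  rw [hval] at hlim
  have hre := (Complex.continuous_re.tendsto _).comp hlim
  rw [Complex.ofReal_re] at hre
  refine hre.congr' ?_
  filter_upwards [eventually_gt_atTop 0] with T hT
  rw [Function.comp_apply, ← hint T hT, Complex.ofReal_re]

/-! ### The minimal mean squared error of linear estimation -/

section LinearMMSE

variable {Ω : Type*} [MeasurableSpace Ω] {P : Measure Ω}
  {X : ℝ → Ω → ℝ} {η : 𝓢(ℝ, ℝ) → Ω → ℝ} {SX Sη : ℝ → ℝ} {H : ℝ → ℂ} {Z : ℝ → Ω → ℂ} {fs : ℝ}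

lemma measurable_uncurry_wrap_crossPSD (hm : Measurable SX) (hH : Measurable H) (fs : ℝ) :
    Measurable fun p : ℝ × ℝ => wrap fs (crossPSD SX H p.1) p.2 := by
  refine Measurable.tsum fun k => ?_
  unfold crossPSD phase
  have h2 : Measurable fun p : ℝ × ℝ => p.2 - fs * k := by fun_prop
  refine ((Complex.measurable_ofReal.comp (hm.comp h2)).mul ?_).mul (hH.comp h2)
  refine Complex.continuous_conj.measurable.comp (Continuous.measurable ?_)
  fun_prop

lemma wrap_crossPSD_eq (SX : ℝ → ℝ) (H : ℝ → ℂ) (fs t f : ℝ) :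
    wrap fs (crossPSD SX H t) f = ∑' k : ℤ, ((SX (f - fs * k) : ℂ) * H (f - fs * k)) *
      Complex.exp ((-(2 * Real.pi * (f - fs * k)) : ℝ) * t * Complex.I) := by
  refine tsum_congr fun k => ?_
  simp only [crossPSD, phase, ← Complex.exp_conj, map_mul, Complex.conj_I, Complex.conj_ofReal,
    map_ofNat]
  rw [mul_right_comm]
  congr 2
  push_cast
  ring

variable (hX : IsGaussianSource P X SX) (hη : IsGaussianNoise P η Sη)
  (hH : IsAdmissible SX Sη H)

include hX hη hH

/-- At fixed `f` the aliases oscillate in `t` at distinct frequencies, and the denominator does not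
depend on `t`. The moduli do not either, so summability at `t = 0` suffices. -/
lemma tendsto_average_wrap_crossPSD (hfs : 0 < fs) :
    ∀ᵐ f ∂(volume.restrict (baseBand fs)),
      Tendsto (fun T : ℝ => (2 * T)⁻¹ * ∫ t in (-T)..T,
        ‖wrap fs (crossPSD SX H t) f‖ ^ 2 / wrap fs (outputPSD SX Sη H) f) atTop
        (𝓝 (estimatorPSD fs SX Sη H f)) := by
  filter_upwards [ae_summable_norm_wrap hfs
    (measurable_crossPSD hX.psd.measurable hH.measurable 0) (integrable_crossPSD hX hη hH 0)]
    with f hf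
  have hinj : Function.Injective fun k : ℤ => -(2 * Real.pi * (f - fs * k)) := by
    intro k l hkl
    have h : fs * (k : ℝ) = fs * l := by
      have := mul_left_cancel₀ (by positivity) (neg_injective hkl)
      linarith
    exact_mod_cast mul_left_cancel₀ hfs.ne' h
  have hs : Summable fun k : ℤ => ‖(SX (f - fs * k) : ℂ) * H (f - fs * k)‖ := by
    refine hf.congr fun k => ?_
    rw [norm_crossPSD, norm_mul, Complex.norm_real, Real.norm_eq_abs]
  have h := (tendsto_average_norm_tsum_sq hs hinj).div_const (wrap fs (outputPSD SX Sη H) f)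
  simp only [← wrap_crossPSD_eq] at h
  have hval : estimatorPSD fs SX Sη H f =
      (∑' k : ℤ, ‖(SX (f - fs * k) : ℂ) * H (f - fs * k)‖ ^ 2) /
        wrap fs (outputPSD SX Sη H) f := by
    simp only [estimatorPSD, wrap, outputPSD, norm_mul, mul_pow, Complex.norm_real,
      Real.norm_eq_abs, sq_abs]
  rw [hval]
  refine h.congr fun T => ?_
  rw [intervalIntegral.integral_div, mul_div_assoc]

lemma integrable_prod_wrap_crossPSD (hfs : 0 < fs) (T : ℝ) :
    Integrable (fun p : ℝ × ℝ =>
      ‖wrap fs (crossPSD SX H p.1) p.2‖ ^ 2 / wrap fs (outputPSD SX Sη H) p.2)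
      ((volume.restrict (Ioc (-T) T)).prod (volume.restrict (baseBand fs))) := by
  have hR : Integrable (fun p : ℝ × ℝ => (1 : ℝ) * wrap fs (ratioPSD SX Sη) p.2)
      ((volume.restrict (Ioc (-T) T)).prod (volume.restrict (baseBand fs))) :=
    (integrable_const 1).mul_prod (integrable_wrap hfs
      (measurable_ratioPSD hX.psd.measurable hη.psd.measurable) (integrable_ratioPSD hX hη))
  refine hR.mono' ?_ ?_
  · exact (((measurable_uncurry_wrap_crossPSD hX.psd.measurable hH.measurable fs).norm.pow_const
      2).div ((measurable_wrap fs (measurable_outputPSD hX hη hH)).comp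
        measurable_snd)).aestronglyMeasurable
  · have h := (Measure.quasiMeasurePreserving_snd (μ := volume.restrict (Ioc (-T) T))
      (ν := volume.restrict (baseBand fs))).ae (norm_wrap_crossPSD_sq_div_le hX hη hH hfs)
    filter_upwards [h] with p hp
    rw [Real.norm_of_nonneg (div_nonneg (sq_nonneg _) (wrap_outputPSD_nonneg hX hη _)), one_mul]
    exact hp p.1

/-- The minimal mean squared error of linear estimation. -/
theorem hasLinearMMSE [IsProbabilityMeasure P]
    (hindep : IndepFun (fun ω t => X t ω) (fun ω u => η u ω) P)
    (hZ : IsFilterOutput P X η SX Sη H Z) (hfs : 0 < fs) :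
    HasLinearMMSE P X (samples fs Z)
      ((∫ f, SX f) - ∫ f in baseBand fs, estimatorPSD fs SX Sη H f) := by
  set q : ℝ → ℝ → ℝ := fun t f =>
    ‖wrap fs (crossPSD SX H t) f‖ ^ 2 / wrap fs (outputPSD SX Sη H) f with hq
  have hq0 : ∀ t f, 0 ≤ q t f := fun t f =>
    div_nonneg (sq_nonneg _) (wrap_outputPSD_nonneg hX hη f)
  have hswap : ∀ T : ℝ, 0 < T → (2 * T)⁻¹ * ∫ t in (-T)..T, linearError P X (samples fs Z) t =
      (∫ f, SX f) - ∫ f in baseBand fs, (2 * T)⁻¹ * ∫ t in (-T)..T, q t f := by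
    intro T hT
    have hprod := integrable_prod_wrap_crossPSD hX hη hH hfs T
    simp only [linearError_eq hX hη hH hindep hZ hfs]
    rw [intervalIntegral.integral_sub (by simp), intervalIntegral.integral_const,
      integral_const_mul]
    · have h1 : ∫ t in (-T)..T, ∫ f in baseBand fs, q t f =
          ∫ f in baseBand fs, ∫ t in (-T)..T, q t f := by
        simp only [intervalIntegral.integral_of_le (show -T ≤ T by linarith)]
        exact integral_integral_swap hprod
      rw [h1, smul_eq_mul]
      field_simp
      ring
    · rw [intervalIntegrable_iff_integrableOn_Ioc_of_le (by linarith)]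
      exact hprod.integral_prod_left
  have hlim : Tendsto (fun T : ℝ => ∫ f in baseBand fs, (2 * T)⁻¹ * ∫ t in (-T)..T, q t f) atTop
      (𝓝 (∫ f in baseBand fs, estimatorPSD fs SX Sη H f)) := by
    -- The pointwise bound is uniform in `t`, hence survives averaging and dominates for every `T`.
    refine tendsto_integral_filter_of_dominated_convergence (wrap fs (ratioPSD SX Sη)) ?_ ?_
      (integrable_wrap hfs (measurable_ratioPSD hX.psd.measurable hη.psd.measurable)
        (integrable_ratioPSD hX hη)) (tendsto_average_wrap_crossPSD hX hη hH hfs)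
    · filter_upwards [eventually_gt_atTop 0] with T hT
      simp only [intervalIntegral.integral_of_le (show -T ≤ T by linarith)]
      exact (integrable_prod_wrap_crossPSD hX hη hH hfs T).integral_prod_right.1.const_mul _
    · filter_upwards [eventually_gt_atTop 0] with T hT
      filter_upwards [norm_wrap_crossPSD_sq_div_le hX hη hH hfs] with f hf
      have h2 : ‖∫ t in (-T)..T, q t f‖ ≤ wrap fs (ratioPSD SX Sη) f * |T - -T| :=
        intervalIntegral.norm_integral_le_of_norm_le_const fun t _ => by
          rw [Real.norm_of_nonneg (hq0 t f)]; exact hf t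
      rw [abs_of_pos (by linarith)] at h2
      rw [norm_mul, Real.norm_of_nonneg (by positivity : 0 ≤ (2 * T)⁻¹)]
      calc (2 * T)⁻¹ * _ ≤ (2 * T)⁻¹ * (wrap fs (ratioPSD SX Sη) f * (T - -T)) := by gcongr
        _ = _ := by field_simp; ring
  refine (hlim.const_sub (∫ f, SX f)).congr' ?_
  filter_upwards [eventually_gt_atTop 0] with T hT
  exact (hswap T hT).symm

end LinearMMSE

/-! ### Gaussian subspaces of `L²` -/

section GaussianSpace

variable {Ω : Type*} [MeasurableSpace Ω] {P : Measure Ω} [IsProbabilityMeasure P]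

/-- A characteristic function determines the law. In this form the property is a family of equations
that pass to limits in `L²`. -/
lemma hasGaussianLaw_and_integral_eq_zero_iff {V : Ω → ℝ} (hV : MemLp V 2 P) :
    (HasGaussianLaw V P ∧ ∫ ω, V ω ∂P = 0) ↔ ∀ s : ℝ,
      ∫ ω, Complex.exp (s * V ω * Complex.I) ∂P =
        Complex.exp (-((∫ ω, V ω ^ 2 ∂P : ℝ) * s ^ 2 / 2 : ℂ)) := by
  have hVm := hV.1.aemeasurable
  have h2 : 0 ≤ ∫ ω, V ω ^ 2 ∂P := integral_nonneg fun _ => sq_nonneg _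
  have hchar : ∀ s : ℝ, charFun (P.map V) s = ∫ ω, Complex.exp (s * V ω * Complex.I) ∂P := by
    intro s
    rw [charFun_apply_real, integral_map hVm (by fun_prop)]
  constructor
  · rintro ⟨hg, h0⟩ s
    rw [← hchar, hg.map_eq_gaussianReal, charFun_gaussianReal, h0,
      variance_of_integral_eq_zero hVm h0, Real.coe_toNNReal _ h2]
    congr 1
    push_cast
    ring
  · intro h
    have hmap : P.map V = gaussianReal 0 (∫ ω, V ω ^ 2 ∂P).toNNReal := by
      have := Measure.isProbabilityMeasure_map (μ := P) hVm
      refine Measure.ext_of_charFun ?_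
      ext s
      rw [hchar, h, charFun_gaussianReal, Real.coe_toNNReal _ h2]
      congr 1
      push_cast
      ring
    have hg : HasGaussianLaw V P := ⟨by rw [hmap]; infer_instance⟩
    refine ⟨hg, ?_⟩
    have := integral_map (μ := P) hVm (f := fun x : ℝ => x) (by fun_prop)
    rw [← this, hmap, integral_id_gaussianReal]

/-- Centered Gaussian variables form a closed subset of `L²`. -/
lemma isClosed_setOf_hasGaussianLaw :
    IsClosed {v : Lp ℝ 2 P | HasGaussianLaw v P ∧ ∫ ω, v ω ∂P = 0} := by
  simp only [hasGaussianLaw_and_integral_eq_zero_iff (Lp.memLp _)]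
  have hnorm : ∀ v : Lp ℝ 2 P, ∫ ω, v ω ^ 2 ∂P = ‖v‖ ^ 2 := by
    intro v
    rw [← real_inner_self_eq_norm_sq, L2.inner_def]
    refine integral_congr_ae (ae_of_all _ fun ω => ?_)
    simp [sq]
  simp only [hnorm, ofPred_forall]
  refine isClosed_iInter fun s => isClosed_eq ?_ (by fun_prop)
  have hint : ∀ v : Lp ℝ 2 P, Integrable (fun ω => Complex.exp (s * v ω * Complex.I)) P := by
    intro v
    have := (Lp.aestronglyMeasurable v).aemeasurable
    refine Integrable.of_bound (C := 1) (by fun_prop) (ae_of_all _ fun ω => ?_)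
    rw [← Complex.ofReal_mul, Complex.norm_exp_ofReal_mul_I]
  -- The constant comes from `|e^{isx} - e^{isy}| ≤ |s| |x - y|`, since the `L¹` norm is at most the
  -- `L²` norm for a probability measure.
  refine (LipschitzWith.of_dist_le_mul (K := ‖s‖₊) fun v w => ?_).continuous
  rw [dist_eq_norm, ← integral_sub (hint v) (hint w), coe_nnnorm]
  have hpt : ∀ x y : ℝ, ‖Complex.exp (s * x * Complex.I) - Complex.exp (s * y * Complex.I)‖ ≤
      ‖s‖ * ‖x - y‖ := by
    intro x y
    have h : Complex.exp (s * x * Complex.I) - Complex.exp (s * y * Complex.I) =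
        Complex.exp ((s * y : ℝ) * Complex.I) *
          (Complex.exp (Complex.I * ((s * (x - y) : ℝ) : ℂ)) - 1) := by
      rw [mul_sub, ← Complex.exp_add, mul_one]
      push_cast
      ring_nf
    rw [h, norm_mul, Complex.norm_exp_ofReal_mul_I, one_mul, ← norm_mul]
    exact Real.norm_exp_I_mul_ofReal_sub_one_le
  have hd : MemLp (fun ω => ‖v ω - w ω‖) 2 P := ((Lp.memLp v).sub (Lp.memLp w)).norm
  calc ‖∫ ω, Complex.exp (s * v ω * Complex.I) - Complex.exp (s * w ω * Complex.I) ∂P‖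
      ≤ ∫ ω, ‖s‖ * ‖v ω - w ω‖ ∂P :=
        norm_integral_le_of_norm_le ((hd.integrable (by norm_num)).const_mul _)
          (ae_of_all _ fun ω => hpt _ _)
    _ = ‖s‖ * ∫ ω, ‖v ω - w ω‖ ∂P := integral_const_mul _ _
    _ ≤ ‖s‖ * dist v w := by
        gcongr
        have h1 : ∫ ω, ‖v ω - w ω‖ ∂P = (eLpNorm (⇑v - ⇑w) 1 P).toReal := by
          rw [eLpNorm_one_eq_lintegral_enorm,
            integral_norm_eq_lintegral_enorm (f := fun ω => v ω - w ω)
              ((Lp.aestronglyMeasurable v).sub (Lp.aestronglyMeasurable w))]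
          rfl
        rw [h1, Lp.dist_def]
        exact ENNReal.toReal_mono ((Lp.memLp v).sub (Lp.memLp w)).2.ne
          (eLpNorm_le_eLpNorm_of_exponent_le (by norm_num)
            ((Lp.aestronglyMeasurable v).sub (Lp.aestronglyMeasurable w)))

/-- A subspace of `L²` that consists of centered Gaussian variables. -/
def IsGaussianSpace (G : Submodule ℝ (Lp ℝ 2 P)) : Prop :=
  ∀ v ∈ G, HasGaussianLaw v P ∧ ∫ ω, v ω ∂P = 0

lemma IsGaussianSpace.topologicalClosure {G : Submodule ℝ (Lp ℝ 2 P)} (hG : IsGaussianSpace G) :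
    IsGaussianSpace G.topologicalClosure := fun _ hv =>
  closure_minimal (s := (G : Set (Lp ℝ 2 P))) hG isClosed_setOf_hasGaussianLaw hv

omit [IsProbabilityMeasure P] in
lemma sum_mul_toLp_mem {ι : Type*} {Y : ι → Ω → ℝ} (hY : ∀ i, MemLp (Y i) 2 P)
    {G : Submodule ℝ (Lp ℝ 2 P)} (hG : ∀ i, (hY i).toLp (Y i) ∈ G) (I : Finset ι) (c : ι → ℝ) :
    ∃ h : MemLp (fun ω => ∑ i ∈ I, c i * Y i ω) 2 P, h.toLp _ ∈ G ∧
      h.toLp _ = ∑ i ∈ I, c i • (hY i).toLp (Y i) := by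
  classical
  induction I using Finset.induction_on with
  | empty =>
    simp only [Finset.sum_empty]
    exact ⟨MemLp.zero', by simpa only [MemLp.toLp_zero] using! G.zero_mem, MemLp.toLp_zero _⟩
  | insert a s ha ih =>
    obtain ⟨h, h1, h2⟩ := ih
    simp only [Finset.sum_insert ha]
    have h3 := (hY a).const_smul (c a)
    have he : (h3.add h).toLp _ = c a • (hY a).toLp (Y a) + h.toLp _ := by
      rw [← MemLp.toLp_const_smul, ← MemLp.toLp_add]
    refine ⟨h3.add h, ?_, ?_⟩
    · exact he ▸ G.add_mem (G.smul_mem _ (hG a)) h1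
    · exact he.trans (by rw [h2])

omit [IsProbabilityMeasure P] in
/-- Variables of a Gaussian space are jointly Gaussian. -/
lemma IsGaussianSpace.isGaussianProcess {G : Submodule ℝ (Lp ℝ 2 P)} (hG : IsGaussianSpace G)
    {ι : Type*} {Y : ι → Ω → ℝ} (hY : ∀ i, MemLp (Y i) 2 P)
    (hmem : ∀ i, (hY i).toLp (Y i) ∈ G) : IsGaussianProcess Y P := by
  refine ⟨fun I => ⟨isGaussian_of_isGaussian_map fun L => ?_⟩⟩
  have hm : AEMeasurable (fun ω => I.restrict (Y · ω)) P :=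
    aemeasurable_pi_lambda _ fun i => (hY i).1.aemeasurable
  rw [AEMeasurable.map_map_of_aemeasurable (by fun_prop) hm]
  classical
  -- Joint normality is tested on linear functionals `L`; these are the coefficients of `L`,
  -- extended by zero.
  let c : ι → ℝ := fun i => if h : i ∈ I then L (Pi.single ⟨i, h⟩ 1) else 0
  obtain ⟨h, hGm, -⟩ := sum_mul_toLp_mem hY hmem I c
  have hlaw := ((hG _ hGm).1.congr h.coeFn_toLp).isGaussian_map
  convert! hlaw using 2
  ext ω
  have h1 : I.restrict (Y · ω) = ∑ i : I, Y i ω • (Pi.single i (1 : ℝ) : I → ℝ) := by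
    ext j
    simp [Finset.sum_apply, Pi.single_apply]
  rw [Function.comp_apply, h1, map_sum, ← Finset.sum_coe_sort I]
  refine Finset.sum_congr rfl fun i _ => ?_
  rw [map_smul, smul_eq_mul, mul_comm]
  simp [c]

omit [IsProbabilityMeasure P] in
/-- The span of a centered Gaussian process in `L²`. -/
lemma exists_sum_of_mem_span {ι : Type*} {Y : ι → Ω → ℝ} (hY : ∀ i, MemLp (Y i) 2 P)
    {v : Lp ℝ 2 P} (hv : v ∈ Submodule.span ℝ (range fun i => (hY i).toLp (Y i))) :
    ∃ c : ι →₀ ℝ, v =ᵐ[P] fun ω => ∑ i ∈ c.support, c i * Y i ω := by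
  obtain ⟨c, rfl⟩ := Finsupp.mem_span_range_iff_exists_finsupp.1 hv
  obtain ⟨h, -, h2⟩ := sum_mul_toLp_mem hY (G := ⊤) (fun _ => trivial) c.support c
  refine ⟨c, ?_⟩
  rw [Finsupp.sum, ← h2]
  exact h.coeFn_toLp

omit [IsProbabilityMeasure P] in
lemma hasGaussianLaw_sum_mul {ι : Type*} {Y : ι → Ω → ℝ} (hY : IsGaussianProcess Y P)
    (I : Finset ι) (c : ι → ℝ) : HasGaussianLaw (fun ω => ∑ i ∈ I, c i * Y i ω) P := by
  let L : (I → ℝ) →L[ℝ] ℝ := ∑ i : I, c i • ContinuousLinearMap.proj i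
  convert! (hY.hasGaussianLaw I).map_fun L using 2 with ω
  rw [← Finset.sum_coe_sort I]
  simp [L]

/-- Two independent centered Gaussian processes span a Gaussian space. -/
lemma isGaussianSpace_span_sup_span {ι κ : Type*} {Y : ι → Ω → ℝ} {W : κ → Ω → ℝ}
    (hYg : IsGaussianProcess Y P) (hWg : IsGaussianProcess W P)
    (hY0 : ∀ i, ∫ ω, Y i ω ∂P = 0) (hW0 : ∀ k, ∫ ω, W k ω ∂P = 0)
    (hY : ∀ i, MemLp (Y i) 2 P) (hW : ∀ k, MemLp (W k) 2 P)
    (hind : IndepFun (fun ω i => Y i ω) (fun ω k => W k ω) P) :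
    IsGaussianSpace (Submodule.span ℝ (range fun i => (hY i).toLp (Y i)) ⊔
      Submodule.span ℝ (range fun k => (hW k).toLp (W k))) := by
  intro v hv
  obtain ⟨y, hy, w, hw, rfl⟩ := Submodule.mem_sup.1 hv
  obtain ⟨c, hc⟩ := exists_sum_of_mem_span hY hy
  obtain ⟨d, hd⟩ := exists_sum_of_mem_span hW hw
  have hsum : ⇑(y + w) =ᵐ[P] (fun ω => ∑ i ∈ c.support, c i * Y i ω) +
      fun ω => ∑ k ∈ d.support, d k * W k ω :=
    (Lp.coeFn_add y w).trans (hc.add hd)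
  have h1 := hasGaussianLaw_sum_mul hYg c.support c
  have h2 := hasGaussianLaw_sum_mul hWg d.support d
  -- Two Gaussian summands alone do not give a Gaussian sum; independence makes the pair jointly
  -- Gaussian.
  have h12 : IndepFun (fun ω => ∑ i ∈ c.support, c i * Y i ω)
      (fun ω => ∑ k ∈ d.support, d k * W k ω) P :=
    hind.comp (φ := fun x : ι → ℝ => ∑ i ∈ c.support, c i * x i)
      (ψ := fun x : κ → ℝ => ∑ k ∈ d.support, d k * x k) (by fun_prop) (by fun_prop)
  refine ⟨(h12.hasGaussianLaw h1 h2).add.congr hsum.symm, ?_⟩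
  rw [integral_congr_ae hsum]
  simp only [Pi.add_apply]
  rw [integral_add h1.integrable h2.integrable,
    integral_finsetSum _ fun i _ => ((hY i).integrable (by norm_num)).const_mul _,
    integral_finsetSum _ fun k _ => ((hW k).integrable (by norm_num)).const_mul _]
  simp [integral_const_mul, hY0, hW0]

omit [IsProbabilityMeasure P] in
lemma inner_toLp_toLp_real {f g : Ω → ℝ} (hf : MemLp f 2 P) (hg : MemLp g 2 P) :
    ⟪hf.toLp f, hg.toLp g⟫_ℝ = ∫ ω, f ω * g ω ∂P := by
  rw [L2.inner_def]
  refine integral_congr_ae ?_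
  filter_upwards [hf.coeFn_toLp, hg.coeFn_toLp] with a h1 h2
  rw [h1, h2, RCLike.inner_apply, mul_comm]
  rfl

end GaussianSpace

/-- In a Gaussian space, the conditional expectation given a family of variables is the orthogonal
projection to their closed span. -/
theorem IsGaussianSpace.condExp_eq_starProjection {Ω : Type*} {m m0 : MeasurableSpace Ω}
    {P : Measure Ω} [IsProbabilityMeasure P] {G : Submodule ℝ (Lp ℝ 2 P)}
    (hG : IsGaussianSpace G) (hGc : IsClosed (G : Set (Lp ℝ 2 P))) {ι : Type*} {Y : ι → Ω → ℝ}
    (hYm : ∀ i, Measurable (Y i)) (hY : ∀ i, MemLp (Y i) 2 P) (hYG : ∀ i, (hY i).toLp (Y i) ∈ G)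
    {x : Lp ℝ 2 P} (hx : x ∈ G) {K : Submodule ℝ (Lp ℝ 2 P)} [K.HasOrthogonalProjection]
    (hm : m = ⨆ i, MeasurableSpace.comap (Y i) inferInstance)
    (hK : K = (Submodule.span ℝ (range fun i => (hY i).toLp (Y i))).topologicalClosure) :
    P[x | m] =ᵐ[P] K.starProjection x := by
  have hle : m ≤ m0 := hm ▸ iSup_le fun i => (hYm i).comap_le
  have hspan : Submodule.span ℝ (range fun i => (hY i).toLp (Y i)) ≤ G :=
    Submodule.span_le.2 (range_subset_iff.2 hYG)
  have hKG : K ≤ G := hK ▸ Submodule.topologicalClosure_minimal _ hspan hGc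
  set w := K.starProjection x with hw
  have hwK : w ∈ K := K.starProjection_apply_mem x
  have hzG : x - w ∈ G := G.sub_mem hx (hKG hwK)
  -- The functions measurable with respect to `m` form a closed subspace of `L²` that contains the
  -- generators of `K`.
  have hwm : AEStronglyMeasurable[m] w P := by
    have hsub : Submodule.span ℝ (range fun i => (hY i).toLp (Y i)) ≤ lpMeas ℝ ℝ m 2 P := by
      refine Submodule.span_le.2 (range_subset_iff.2 fun i => ?_)
      refine AEStronglyMeasurable.congr (f := Y i) ?_ (hY i).coeFn_toLp.symm
      have : Measurable[m] (Y i) :=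
        measurable_iff_comap_le.2 (hm ▸ le_iSup (fun i => MeasurableSpace.comap (Y i) inferInstance) i)
      exact this.stronglyMeasurable.aestronglyMeasurable
    have h2 : K ≤ lpMeas ℝ ℝ m 2 P :=
      hK ▸ Submodule.topologicalClosure_minimal _ hsub (isClosed_aestronglyMeasurable hle)
    exact h2 hwK
  have hz2 : MemLp (⇑(x - w)) 2 P := Lp.memLp _
  have hzY : ∀ i, ∫ ω, (x - w : Lp ℝ 2 P) ω * Y i ω ∂P = 0 := by
    intro i
    have h1 : (hY i).toLp (Y i) ∈ K :=
      hK ▸ Submodule.le_topologicalClosure _ (Submodule.subset_span ⟨i, rfl⟩)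
    have h2 := K.starProjection_inner_eq_zero x _ h1
    rw [← hw, ← Lp.toLp_coeFn (x - w) hz2, inner_toLp_toLp_real] at h2
    exact h2
  have hgauss : IsGaussianProcess (Sum.elim (fun _ : Unit => ⇑(x - w)) Y) P := by
    refine hG.isGaussianProcess (Y := Sum.elim (fun _ : Unit => ⇑(x - w)) Y) ?_ ?_
    · rintro (_ | i)
      · exact hz2
      · exact hY i
    · rintro (_ | i)
      · exact (Lp.toLp_coeFn (x - w) hz2).symm ▸ hzG
      · exact hYG i
  -- The residual is orthogonal to every `Y i` and jointly Gaussian with the family, so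
  -- orthogonality becomes independence; its conditional expectation is then its mean, zero.
  have hind : IndepFun (fun ω (_ : Unit) => (x - w : Lp ℝ 2 P) ω) (fun ω i => Y i ω) P := by
    refine hgauss.indepFun_of_covariance_eq_zero (fun _ => hz2.1.aemeasurable)
      (fun i => (hYm i).aemeasurable) fun _ i => ?_
    rw [covariance_eq_sub hz2 (hY i), (hG _ hzG).2, zero_mul, sub_zero]
    exact hzY i
  have hzm : Measurable (⇑(x - w)) := (Lp.stronglyMeasurable _).measurable
  have hind' : Indep (MeasurableSpace.comap (⇑(x - w)) inferInstance) m P := by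
    have hev : Measurable fun y : Unit → ℝ => y () := measurable_pi_apply ()
    have h1 := hind.comp (φ := fun y : Unit → ℝ => y ()) (ψ := id) hev measurable_id
    have h2 : MeasurableSpace.comap (fun ω i => Y i ω) MeasurableSpace.pi = m := by
      simp only [MeasurableSpace.pi, MeasurableSpace.comap_iSup, MeasurableSpace.comap_comp, hm]
      rfl
    rw [IndepFun_iff_Indep] at h1
    rw [← h2]
    exact h1
  have hz0 : P[⇑(x - w) | m] =ᵐ[P] fun _ => (0 : ℝ) := by
    have := condExp_indep_eq hzm.comap_le hle (f := ⇑(x - w))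
      (comap_measurable _).stronglyMeasurable hind'
    rwa [(hG _ hzG).2] at this
  have hwi : Integrable (⇑w) P := (Lp.memLp w).integrable (by norm_num)
  have hxeq : ⇑x =ᵐ[P] ⇑(x - w) + ⇑w := by
    filter_upwards [Lp.coeFn_sub x w] with ω h
    rw [Pi.add_apply, h]
    simp
  calc P[x | m] =ᵐ[P] P[⇑(x - w) + ⇑w | m] := condExp_congr_ae hxeq
    _ =ᵐ[P] P[⇑(x - w) | m] + P[⇑w | m] := condExp_add (hz2.integrable (by norm_num)) hwi _
    _ =ᵐ[P] (fun _ => (0 : ℝ)) + ⇑w := hz0.add (condExp_of_aestronglyMeasurable' hle hwm hwi)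
    _ =ᵐ[P] w := by
        filter_upwards with ω
        simp

/-! ### Real filters -/

lemma multiplier_neg (u : 𝓢(ℝ, ℝ)) (f : ℝ) :
    multiplier u (-f) = (starRingEnd ℂ) (multiplier u f) := by
  rw [conj_multiplier, multiplier]
  refine integral_congr_ae (ae_of_all _ fun s => ?_)
  simp only
  rw [mul_comm]
  congr 2
  push_cast
  ring

lemma phase_neg (t f : ℝ) : phase t (-f) = (starRingEnd ℂ) (phase t f) := by
  simp only [phase, ← Complex.exp_conj, map_mul, Complex.conj_I, Complex.conj_ofReal, map_ofNat]
  congr 1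
  push_cast
  ring

lemma measurePreserving_neg_spectralMeasure {S : ℝ → ℝ} (hm : Measurable S)
    (he : ∀ᵐ f, S (-f) = S f) :
    MeasurePreserving (fun f : ℝ => -f) (spectralMeasure S) (spectralMeasure S) := by
  refine ⟨measurable_neg, ?_⟩
  ext s hs
  rw [Measure.map_apply measurable_neg hs, spectralMeasure,
    withDensity_apply _ (measurable_neg hs), withDensity_apply _ hs,
    ← (Measure.measurePreserving_neg volume).setLIntegral_comp_preimage hs (by fun_prop)]
  refine lintegral_congr_ae (ae_restrict_of_ae ?_)
  filter_upwards [he] with f hf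
  rw [hf]

/-- Multipliers that approximate a function with conjugate symmetry have small imaginary
parts. -/
lemma two_mul_eLpNorm_multiplier_le {S : ℝ → ℝ} (hm : Measurable S) (he : ∀ᵐ f, S (-f) = S f)
    [(spectralMeasure S).HasTemperateGrowth] (u v : 𝓢(ℝ, ℝ)) {g : ℝ → ℂ}
    (hgm : MemLp g 2 (spectralMeasure S))
    (hg : ∀ᵐ f, g (-f) = (starRingEnd ℂ) (g f)) :
    2 * eLpNorm (multiplier v) 2 (spectralMeasure S) ≤ 2 *
      eLpNorm (fun f => multiplier u f + Complex.I * multiplier v f - g f) 2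
        (spectralMeasure S) := by
  set μ := spectralMeasure S
  set d : ℝ → ℂ := fun f => multiplier u f + Complex.I * multiplier v f - g f with hd
  have hdm : MemLp d 2 μ := (memLp_multiplier_add_I_mul μ u v).sub hgm
  have hneg := measurePreserving_neg_spectralMeasure hm he
  set d' : ℝ → ℂ := fun f => (starRingEnd ℂ) (d (-f)) with hd'
  have hd'm : AEStronglyMeasurable d' μ :=
    Complex.continuous_conj.comp_aestronglyMeasurable (hdm.1.comp_measurePreserving hneg)
  have hd'n : eLpNorm d' 2 μ = eLpNorm d 2 μ := by
    rw [← eLpNorm_comp_measurePreserving hdm.1 hneg]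
    refine eLpNorm_congr_norm_ae (ae_of_all _ fun f => ?_)
    simp only [hd', RCLike.norm_conj, Function.comp_apply]
  -- Reflection with conjugation fixes `g` and the multiplier of `u` but changes the sign of `i`
  -- times that of `v`.
  have heq : (fun f => (2 * Complex.I) • multiplier v f) =ᵐ[μ] d - d' := by
    filter_upwards [(spectralMeasure_absolutelyContinuous S).ae_le hg] with f hf
    simp only [hd, hd', Pi.sub_apply, map_sub, map_add, map_mul, multiplier_neg,
      Complex.conj_conj, Complex.conj_I, hf, smul_eq_mul]
    ring
  have h2 : eLpNorm (fun f => (2 * Complex.I) • multiplier v f) 2 μ =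
      2 * eLpNorm (multiplier v) 2 μ := by
    have h := eLpNorm_const_smul (2 * Complex.I) (multiplier v) 2 μ
    have h3 : ‖(2 * Complex.I : ℂ)‖ₑ = 2 := by
      rw [← ofReal_norm, norm_mul, Complex.norm_I, mul_one]
      simp
    rw [h3] at h
    exact h
  rw [← h2, eLpNorm_congr_ae heq]
  calc eLpNorm (d - d') 2 μ ≤ eLpNorm d 2 μ + eLpNorm d' 2 μ :=
        eLpNorm_sub_le hdm.1 hd'm (by norm_num)
    _ = 2 * eLpNorm d 2 μ := by rw [hd'n, two_mul]

section RealFilter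

variable {Ω : Type*} [MeasurableSpace Ω] {P : Measure Ω} [IsProbabilityMeasure P]
  {X : ℝ → Ω → ℝ} {η : 𝓢(ℝ, ℝ) → Ω → ℝ} {SX Sη : ℝ → ℝ} {H : ℝ → ℂ} {Z : ℝ → Ω → ℂ}
  (hX : IsGaussianSource P X SX) (hη : IsGaussianNoise P η Sη)

/-- The output of a real filter is real. -/
lemma IsFilterOutput.im_eq_zero (hX : IsGaussianSource P X SX) (hη : IsGaussianNoise P η Sη)
    (hindep : IndepFun (fun ω t => X t ω) (fun ω u => η u ω) P)
    (hH : IsAdmissible SX Sη H) (hreal : IsRealFilter H)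
    (hZ : IsFilterOutput P X η SX Sη H Z) (t : ℝ) : ∀ᵐ ω ∂P, (Z t ω).im = 0 := by
  have := hasTemperateGrowth_noisy hX hη
  obtain ⟨Ψ, hΨ, -⟩ := exists_spectralIsometry hX hη hindep
  obtain ⟨u, v, h1, h2⟩ := hZ.approx t
  have he : ∀ᵐ f, SX (-f) + Sη (-f) = SX f + Sη f := by
    filter_upwards [hX.psd.even, hη.psd.even] with f h3 h4
    rw [h3, h4]
  have hv : ∀ j, eLpNorm (fun ω => (noisyInput X η (v j) ω : ℂ)) 2 P =
      eLpNorm (multiplier (v j)) 2 (spectralMeasure fun f => SX f + Sη f) := by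
    intro j
    rw [← Lp.enorm_toLp (memLp_noisyInput_ofReal hX hη (v j)),
      ← Lp.enorm_toLp (memLp_multiplier _ (v j)), ← hΨ]
    exact Ψ.enorm_map _
  have hv0 : Tendsto (fun j => eLpNorm (fun ω => (noisyInput X η (v j) ω : ℂ)) 2 P) atTop
      (𝓝 0) := by
    refine tendsto_of_tendsto_of_tendsto_of_le_of_le tendsto_const_nhds h1
      (fun _ => zero_le) fun j => ?_
    have hle := two_mul_eLpNorm_multiplier_le (measurable_noisyPSD hX hη) he (u j) (v j)
      (memLp_phase_mul hX hη hH t) (by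
        filter_upwards [hreal] with f hf
        rw [phase_neg, hf, map_mul])
    rw [ENNReal.mul_le_mul_iff_right (by norm_num) (by norm_num)] at hle
    simp only [hv]
    exact hle
  have him : eLpNorm (fun ω => (Z t ω).im) 2 P ≤ 0 := by
    have hsum := h2.add hv0
    rw [add_zero] at hsum
    refine ge_of_tendsto hsum (Eventually.of_forall fun j => ?_)
    have hW := memLp_noisyInput_add_I_mul hX hη (u j) (v j)
    have hm : AEStronglyMeasurable (fun ω => Z t ω - ((noisyInput X η (u j) ω : ℂ)
        + Complex.I * (noisyInput X η (v j) ω : ℂ))) P :=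
      (hZ.measurable t).aestronglyMeasurable.sub hW.1
    -- The imaginary part of the approximant is the input tested against `v j`, so both summands
    -- tend to zero in `L²`.
    have e : (fun ω => (Z t ω).im) = (fun ω => (Z t ω - ((noisyInput X η (u j) ω : ℂ)
        + Complex.I * (noisyInput X η (v j) ω : ℂ))).im) + noisyInput X η (v j) := by
      ext ω
      simp
    rw [e]
    refine (eLpNorm_add_le (Complex.continuous_im.comp_aestronglyMeasurable hm)
      (memLp_noisyInput hX hη (v j)).1 (by norm_num)).trans (add_le_add ?_ (le_of_eq ?_))
    · exact eLpNorm_mono fun ω => Complex.abs_im_le_norm _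
    · exact eLpNorm_congr_norm_ae (ae_of_all _ fun ω => by simp)
  have h0 := (eLpNorm_eq_zero_iff (Complex.continuous_im.comp_aestronglyMeasurable
    (hZ.measurable t).aestronglyMeasurable) (by norm_num)).1 (le_antisymm him zero_le)
  filter_upwards [h0] with ω h
  exact h

/-- The Gaussian Hilbert space generated by the source and the noise. -/
def processSpace (hX : IsGaussianSource P X SX) (hη : IsGaussianNoise P η Sη) :
    Submodule ℝ (Lp ℝ 2 P) :=
  (Submodule.span ℝ (range fun t => (hX.memLp t).toLp (X t)) ⊔
    Submodule.span ℝ (range fun u => (hη.memLp u).toLp (η u))).topologicalClosure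

omit [IsProbabilityMeasure P] in
lemma isClosed_processSpace : IsClosed (processSpace hX hη : Set (Lp ℝ 2 P)) :=
  Submodule.isClosed_topologicalClosure _

lemma isGaussianSpace_processSpace
    (hindep : IndepFun (fun ω t => X t ω) (fun ω u => η u ω) P) :
    IsGaussianSpace (processSpace hX hη) :=
  (isGaussianSpace_span_sup_span hX.gaussian hη.gaussian hX.centered hη.centered hX.memLp hη.memLp
    hindep).topologicalClosure

omit [IsProbabilityMeasure P] in
lemma toLp_source_mem_processSpace (t : ℝ) :
    (hX.memLp t).toLp (X t) ∈ processSpace hX hη :=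
  Submodule.le_topologicalClosure _ (Submodule.mem_sup_left (Submodule.subset_span ⟨t, rfl⟩))

/-- No Riemann sums are needed: by Fubini, whatever is orthogonal to every `X s` is orthogonal to `∫
X(s) u(s) ds`, and the double orthogonal complement is the closure. -/
lemma toLp_noisyInput_mem_processSpace (u : 𝓢(ℝ, ℝ)) :
    (memLp_noisyInput hX hη u).toLp (noisyInput X η u) ∈ processSpace hX hη := by
  have h1 : (memLp_sourceInput hX u).toLp _ ∈ processSpace hX hη := by
    have hmono : (Submodule.span ℝ (range fun t => (hX.memLp t).toLp (X t))).topologicalClosure ≤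
        processSpace hX hη := Submodule.topologicalClosure_mono le_sup_left
    refine hmono ?_
    rw [← Submodule.orthogonal_orthogonal_eq_closure, Submodule.mem_orthogonal]
    intro v hv
    have hvm : Measurable v := (Lp.stronglyMeasurable v).measurable
    rw [← Lp.toLp_coeFn v (Lp.memLp v), inner_toLp_toLp_real,
      integral_mul_sourceInput hX u hvm (Lp.memLp v)]
    have h0 : ∀ s, ∫ ω, v ω * X s ω ∂P = 0 := by
      intro s
      rw [← inner_toLp_toLp_real (Lp.memLp v) (hX.memLp s), Lp.toLp_coeFn, real_inner_comm]
      exact (Submodule.mem_orthogonal _ _).1 hv _ (Submodule.subset_span ⟨s, rfl⟩)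
    simp [h0]
  have h2 : (hη.memLp u).toLp _ ∈ processSpace hX hη :=
    Submodule.le_topologicalClosure _ (Submodule.mem_sup_right (Submodule.subset_span ⟨u, rfl⟩))
  exact (processSpace hX hη).add_mem h1 h2

lemma IsFilterOutput.memLp_re (hX : IsGaussianSource P X SX) (hη : IsGaussianNoise P η Sη)
    (hZ : IsFilterOutput P X η SX Sη H Z) (t : ℝ) : MemLp (fun ω => (Z t ω).re) 2 P :=
  (hZ.memLp hX hη t).re

/-- The real part of an approximant is the input tested against `u j`, taking real parts is a
contraction, and the space is closed. -/
lemma IsFilterOutput.toLp_re_mem_processSpace (hZ : IsFilterOutput P X η SX Sη H Z) (t : ℝ) :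
    (hZ.memLp_re hX hη t).toLp _ ∈ processSpace hX hη := by
  obtain ⟨u, v, -, h2⟩ := hZ.approx t
  refine (isClosed_processSpace hX hη).mem_of_tendsto (b := atTop)
    ((Lp.tendsto_Lp_iff_tendsto_eLpNorm'' _ (fun j => memLp_noisyInput hX hη (u j)) _
      (hZ.memLp_re hX hη t)).2 ?_)
    (Eventually.of_forall fun j => toLp_noisyInput_mem_processSpace hX hη (u j))
  refine tendsto_of_tendsto_of_tendsto_of_le_of_le tendsto_const_nhds h2
    (fun _ => zero_le) fun j => ?_
  refine eLpNorm_mono fun ω => ?_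
  rw [Pi.sub_apply, norm_sub_rev, Real.norm_eq_abs]
  refine le_trans (le_of_eq ?_) (Complex.abs_re_le_norm _)
  simp

omit [MeasurableSpace Ω] in
-- Rewrites the information in complex samples through a real family, to which the Gaussian
-- projection theorem applies.
lemma sampleSigma_eq_iSup (Y : ℤ → Ω → ℂ) :
    sampleSigma Y = ⨆ i : ℤ ⊕ ℤ, MeasurableSpace.comap
      (Sum.elim (fun n ω => (Y n ω).re) (fun n ω => (Y n ω).im) i) inferInstance := by
  have h : ∀ n, MeasurableSpace.comap (Y n) inferInstance =
      MeasurableSpace.comap (fun ω => (Y n ω).re) inferInstance ⊔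
        MeasurableSpace.comap (fun ω => (Y n ω).im) inferInstance := by
    intro n
    have hc : (inferInstance : MeasurableSpace ℂ) =
        MeasurableSpace.comap Complex.re inferInstance ⊔
          MeasurableSpace.comap Complex.im inferInstance := by
      have h1 := Complex.measurableEquivRealProd.measurableEmbedding.comap_eq
      change MeasurableSpace.comap _ (MeasurableSpace.comap Prod.fst _ ⊔
        MeasurableSpace.comap Prod.snd _) = _ at h1
      rw [MeasurableSpace.comap_sup, MeasurableSpace.comap_comp, MeasurableSpace.comap_comp] at h1
      exact h1.symm
    rw [hc, MeasurableSpace.comap_sup, MeasurableSpace.comap_comp, MeasurableSpace.comap_comp]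
    rfl
  rw [sampleSigma, iSup_sum]
  simp only [h, iSup_sup_eq, Sum.elim_inl, Sum.elim_inr]

include hX hη in
/-- For real filters, estimation by the conditional expectation is linear estimation. -/
theorem condError_eq_linearError
    (hindep : IndepFun (fun ω t => X t ω) (fun ω u => η u ω) P)
    (hH : IsAdmissible SX Sη H) (hreal : IsRealFilter H)
    (hZ : IsFilterOutput P X η SX Sη H Z) (fs t : ℝ) :
    condError P X (samples fs Z) t = linearError P X (samples fs Z) t := by
  set Y := samples fs Z with hYdef
  have hYm : ∀ n, Measurable (Y n) := fun n => hZ.measurable _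
  have him : ∀ n, ∀ᵐ ω ∂P, (Y n ω).im = 0 := fun n =>
    hZ.im_eq_zero hX hη hindep hH hreal _
  have hre2 : ∀ n, MemLp (fun ω => (Y n ω).re) 2 P := fun n => hZ.memLp_re hX hη _
  have him2 : ∀ n, MemLp (fun ω => (Y n ω).im) 2 P := fun n => (hZ.memLp hX hη _).im
  have him0 : ∀ n, (him2 n).toLp _ = 0 := fun n => by
    rw [← MemLp.toLp_zero (μ := P) (p := 2) MemLp.zero', MemLp.toLp_eq_toLp_iff]
    exact him n
  set W : ℤ ⊕ ℤ → Ω → ℝ := Sum.elim (fun n ω => (Y n ω).re) (fun n ω => (Y n ω).im) with hW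
  have hWm : ∀ i, Measurable (W i) := by
    rintro (n | n)
    · exact Complex.measurable_re.comp (hYm n)
    · exact Complex.measurable_im.comp (hYm n)
  have hW2 : ∀ i, MemLp (W i) 2 P := by
    rintro (n | n)
    · exact hre2 n
    · exact him2 n
  have hWG : ∀ i, (hW2 i).toLp (W i) ∈ processSpace hX hη := by
    rintro (n | n)
    · exact hZ.toLp_re_mem_processSpace hX hη _
    · exact (him0 n).symm ▸ (processSpace hX hη).zero_mem
  set K₀ : Submodule ℝ (Lp ℝ 2 P) :=
    Submodule.span ℝ (range fun n => (hre2 n).toLp fun ω => (Y n ω).re) with hK₀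
  -- The imaginary parts may enlarge the σ-algebra by null sets, but they are zero in `L²` and do
  -- not enlarge the span.
  have hspan : Submodule.span ℝ (range fun i => (hW2 i).toLp (W i)) = K₀ := by
    refine le_antisymm (Submodule.span_le.2 (range_subset_iff.2 ?_))
      (Submodule.span_mono (range_subset_iff.2 fun n => ⟨Sum.inl n, rfl⟩))
    rintro (n | n)
    · exact Submodule.subset_span ⟨n, rfl⟩
    · exact (him0 n).symm ▸ K₀.zero_mem
  set x : Lp ℝ 2 P := (hX.memLp t).toLp (X t) with hx
  have hclosed : IsClosed (K₀.topologicalClosure : Set (Lp ℝ 2 P)) :=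
    Submodule.isClosed_topologicalClosure _
  have : CompleteSpace K₀.topologicalClosure := hclosed.completeSpace_coe
  set w := K₀.topologicalClosure.starProjection x with hw
  have hcond : P[X t | sampleSigma Y] =ᵐ[P] w :=
    (condExp_congr_ae (hX.memLp t).coeFn_toLp.symm).trans
      ((isGaussianSpace_processSpace hX hη hindep).condExp_eq_starProjection
        (isClosed_processSpace hX hη) hWm hW2 hWG (toLp_source_mem_processSpace hX hη t)
        (sampleSigma_eq_iSup Y) (by rw [hspan]))
  have hnorm : ∀ {g : Ω → ℝ} (hg : MemLp g 2 P), ‖hg.toLp g‖ ^ 2 = ∫ ω, g ω ^ 2 ∂P := by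
    intro g hg
    rw [← real_inner_self_eq_norm_sq, inner_toLp_toLp_real]
    simp only [sq]
  have hsub : ∀ v : Lp ℝ 2 P, ‖x - v‖ ^ 2 = ∫ ω, (X t ω - v ω) ^ 2 ∂P := by
    intro v
    have h2 : MemLp (fun ω => X t ω - v ω) 2 P := (hX.memLp t).sub (Lp.memLp v)
    have h3 : x - v = h2.toLp _ := by
      refine Lp.ext ?_
      filter_upwards [Lp.coeFn_sub x v, h2.coeFn_toLp, (hX.memLp t).coeFn_toLp] with ω h4 h5 h6
      rw [h4, h5, Pi.sub_apply, hx, h6]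
    rw [h3, hnorm]
  have hcondErr : condError P X Y t = ‖x - w‖ ^ 2 := by
    rw [hsub, condError]
    refine integral_congr_ae ?_
    filter_upwards [hcond] with ω h
    rw [h]
  have hwK : w ∈ K₀.topologicalClosure := Submodule.starProjection_apply_mem _ x
  have hpyth : ∀ v ∈ K₀.topologicalClosure, ‖x - v‖ ^ 2 = ‖x - w‖ ^ 2 + ‖w - v‖ ^ 2 := by
    intro v hv
    have h := K₀.topologicalClosure.starProjection_inner_eq_zero x _ (Submodule.sub_mem _ hwK hv)
    have h2 := norm_add_sq_eq_norm_sq_add_norm_sq_real h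
    rw [← hw, sub_add_sub_cancel] at h2
    rw [sq, sq, sq, h2]
  have hYae : ∀ᵐ ω ∂P, ∀ n, (Y n ω).im = 0 := ae_all_iff.2 him
  rw [hcondErr, linearError]
  refine (ciInf_eq_of_forall_ge_of_forall_gt_exists_lt (fun c => ?_) fun b hb => ?_).symm
  -- With a real target and real samples, replacing the coefficients by their real parts cannot
  -- increase the error.
  · obtain ⟨hv2, hvK, -⟩ := sum_mul_toLp_mem hre2 (G := K₀)
      (fun n => Submodule.subset_span ⟨n, rfl⟩) c.support fun n => (c n).re
    have hd2 := (hX.memLp t).sub hv2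
    have h1 : ‖x - w‖ ^ 2 ≤ ‖hd2.toLp _‖ ^ 2 := by
      rw [MemLp.toLp_sub (hX.memLp t) hv2, hpyth _ (Submodule.le_topologicalClosure _ hvK)]
      exact le_add_of_nonneg_right (sq_nonneg _)
    rw [hnorm] at h1
    refine h1.trans (integral_mono_ae hd2.integrable_sq ?_ ?_)
    · have hS : MemLp (fun ω => c.sum fun n a => a * Y n ω) 2 P :=
        memLp_finsetSum _ fun n _ => (hZ.memLp hX hη _).const_mul _
      have := ((memLp_eval_ofReal hX t).sub hS).norm.integrable_sq
      exact this
    · filter_upwards [hYae] with ω h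
      rw [Pi.sub_apply, ← sq_abs]
      refine pow_le_pow_left₀ (abs_nonneg _) (le_trans (le_of_eq ?_) (Complex.abs_re_le_norm _)) 2
      simp [Finsupp.sum, Complex.re_sum, h]
  -- By Pythagoras this tolerance is exactly what keeps the squared error of `v` below `b`.
  · obtain ⟨v, hv, hvw⟩ : ∃ v ∈ K₀, ‖w - v‖ < √(b - ‖x - w‖ ^ 2) := by
      obtain ⟨v, hv, h⟩ := Metric.mem_closure_iff.1 hwK (√(b - ‖x - w‖ ^ 2))
        (Real.sqrt_pos.2 (sub_pos.2 hb))
      exact ⟨v, hv, by rwa [dist_eq_norm] at h⟩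
    obtain ⟨c, hc⟩ := exists_sum_of_mem_span hre2 hv
    refine ⟨c.mapRange (fun r : ℝ => (r : ℂ)) Complex.ofReal_zero, ?_⟩
    have h1 : ∫ ω, ‖(X t ω : ℂ) - (c.mapRange (fun r : ℝ => (r : ℂ)) Complex.ofReal_zero).sum
        (fun n a => a * Y n ω)‖ ^ 2 ∂P = ‖x - v‖ ^ 2 := by
      rw [hsub]
      refine integral_congr_ae ?_
      filter_upwards [hc, hYae] with ω h4 h5
      have h6 : ∀ n, Y n ω = ((Y n ω).re : ℂ) := fun n =>
        Complex.ext rfl (by rw [h5 n, Complex.ofReal_im])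
      have h7 : (c.mapRange (fun r : ℝ => (r : ℂ)) Complex.ofReal_zero).sum
          (fun n a => a * Y n ω) = ((v ω : ℝ) : ℂ) := by
        rw [Finsupp.sum_mapRange_index (by simp), h4]
        push_cast
        exact Finset.sum_congr rfl fun n _ => by rw [← h6]
      rw [h7, ← Complex.ofReal_sub, Complex.norm_real, Real.norm_eq_abs, sq_abs]
    rw [h1, hpyth _ (Submodule.le_topologicalClosure _ hv)]
    have := (Real.lt_sqrt (norm_nonneg _)).1 hvw
    linarith

end RealFilter

/-! ### The supremum over the aliases -/

section Supremum

variable {fs : ℝ} {ρ : ℝ → ℝ}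

lemma le_supPSD (h0 : ∀ f, 0 ≤ ρ f) {f : ℝ} (h : Summable fun k : ℤ => ρ (f - fs * k)) (k : ℤ) :
    ρ (f - fs * k) ≤ supPSD fs ρ f :=
  le_ciSup (f := fun k : ℤ => ρ (f - fs * k))
    ⟨∑' k : ℤ, ρ (f - fs * k), forall_mem_range.2 fun k => h.le_tsum k fun _ _ => h0 _⟩ k

lemma supPSD_nonneg (h0 : ∀ f, 0 ≤ ρ f) (f : ℝ) : 0 ≤ supPSD fs ρ f :=
  Real.iSup_nonneg fun _ => h0 _

lemma supPSD_le_wrap (h0 : ∀ f, 0 ≤ ρ f) {f : ℝ} (h : Summable fun k : ℤ => ρ (f - fs * k)) :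
    supPSD fs ρ f ≤ wrap fs ρ f :=
  ciSup_le fun k => h.le_tsum k fun _ _ => h0 _

lemma measurable_supPSD (fs : ℝ) (hm : Measurable ρ) : Measurable (supPSD fs ρ) :=
  Measurable.iSup fun _ => hm.comp (measurable_id.sub_const _)

lemma ae_summable_wrap (hfs : 0 < fs) (hm : Measurable ρ) (hi : Integrable ρ) :
    ∀ᵐ f ∂(volume.restrict (baseBand fs)), Summable fun k : ℤ => ρ (f - fs * k) := by
  filter_upwards [ae_summable_norm_wrap hfs hm hi] with f h
  exact h.of_norm

lemma integrable_supPSD (hfs : 0 < fs) (hm : Measurable ρ) (h0 : ∀ f, 0 ≤ ρ f)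
    (hi : Integrable ρ) : IntegrableOn (supPSD fs ρ) (baseBand fs) := by
  refine (integrable_wrap hfs hm hi).mono' (measurable_supPSD fs hm).aestronglyMeasurable ?_
  filter_upwards [ae_summable_wrap hfs hm hi] with f h
  rw [Real.norm_of_nonneg (supPSD_nonneg h0 f)]
  exact supPSD_le_wrap h0 h

/-- The supremum is attained; `k` is the last index at which this happens. -/
lemma exists_eq_supPSD (h0 : ∀ f, 0 ≤ ρ f) {f : ℝ} (h : Summable fun k : ℤ => ρ (f - fs * k))
    (hpos : 0 < supPSD fs ρ f) :
    ∃ k : ℤ, ρ (f - fs * k) = supPSD fs ρ f ∧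
      ∀ l : ℤ, k < l → ρ (f - fs * l) < supPSD fs ρ f := by
  -- Summability makes positive superlevel sets finite, so both a maximum and a last maximizing
  -- index exist.
  have hfin : ∀ c : ℝ, 0 < c → {k : ℤ | c ≤ ρ (f - fs * k)}.Finite := by
    intro c hc
    have := eventually_cofinite.1 (h.tendsto_cofinite_zero.eventually (gt_mem_nhds hc))
    simpa only [not_lt] using this
  obtain ⟨k₀, hk₀⟩ : ∃ k : ℤ, 0 < ρ (f - fs * k) := by
    by_contra! hcon
    exact absurd (ciSup_le hcon) (not_le.2 hpos)
  obtain ⟨k₁, hk₁, hmax⟩ := exists_max_image _ (fun k : ℤ => ρ (f - fs * k)) (hfin _ hk₀)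
    ⟨k₀, mem_ofPred.2 le_rfl⟩
  have hsup : supPSD fs ρ f = ρ (f - fs * k₁) := by
    refine le_antisymm (ciSup_le fun k => ?_) (le_supPSD h0 h k₁)
    rcases le_total (ρ (f - fs * k₀)) (ρ (f - fs * k)) with h1 | h1
    · exact hmax k h1
    · exact h1.trans hk₁
  obtain ⟨k₂, hk₂, hlast⟩ := exists_max_image _ (id : ℤ → ℤ) (hfin _ hpos) ⟨k₁, hsup.le⟩
  refine ⟨k₂, le_antisymm (le_supPSD h0 h k₂) hk₂, fun l hl => ?_⟩
  by_contra! hcon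
  exact absurd (hlast l hcon) (not_le.2 hl)

end Supremum

/-! ### Aliasing-free sets -/

section AliasingFree

variable {fs : ℝ} {F : Set ℝ}

lemma IsAliasingFree.inter (hF : IsAliasingFree fs F) {B : Set ℝ} (hB : MeasurableSet B) :
    IsAliasingFree fs (F ∩ B) := by
  obtain ⟨hm, N, hN, h⟩ := hF
  exact ⟨hm.inter hB, N, hN, fun f₁ h₁ f₂ h₂ => h f₁ ⟨h₁.1.1, h₁.2⟩ f₂ ⟨h₂.1.1, h₂.2⟩⟩

lemma IsAliasingFree.inter_Icc_mem_AF (hF : IsAliasingFree fs F) (a b : ℝ) :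
    F ∩ Icc a b ∈ AF fs :=
  ⟨hF.inter measurableSet_Icc, (Metric.isBounded_Icc a b).subset inter_subset_right⟩

lemma ae_forall_sub {p : ℝ → Prop} (h : ∀ᵐ f, p f) (fs : ℝ) : ∀ᵐ f, ∀ k : ℤ, p (f - fs * k) :=
  ae_all_iff.2 fun k => (measurePreserving_sub_right volume (fs * k)).quasiMeasurePreserving.ae h

/-- Almost every frequency has at most one alias in an aliasing-free set. -/
lemma IsAliasingFree.ae_eq (hF : IsAliasingFree fs F) (hfs : fs ≠ 0) :
    ∀ᵐ f, ∀ k l : ℤ, f - fs * k ∈ F → f - fs * l ∈ F → k = l := by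
  obtain ⟨-, N, hN, h⟩ := hF
  filter_upwards [ae_forall_sub (measure_eq_zero_iff_ae_notMem.1 hN) fs] with f hf k l hk hl
  by_contra hne
  refine h _ ⟨hk, hf k⟩ _ ⟨hl, hf l⟩ (fun h' => hne ?_) (l - k) (by push_cast; ring)
  have h2 : fs * ((k : ℝ) - l) = 0 := by linear_combination -h'
  exact_mod_cast sub_eq_zero.1 ((mul_eq_zero.1 h2).resolve_left hfs)

lemma wrap_indicator_eq {f : ℝ} {k : ℤ} (g : ℝ → ℝ) (hk : f - fs * k ∈ F)
    (h : ∀ l : ℤ, f - fs * l ∈ F → l = k) : wrap fs (F.indicator g) f = g (f - fs * k) := by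
  rw [wrap, tsum_eq_single k fun l hl => indicator_of_notMem (fun h' => hl (h l h')) _,
    indicator_of_mem hk]

lemma wrap_indicator_eq_zero {f : ℝ} (g : ℝ → ℝ) (h : ∀ l : ℤ, f - fs * l ∉ F) :
    wrap fs (F.indicator g) f = 0 := by
  rw [wrap, tsum_congr fun l => indicator_of_notMem (h l) _, tsum_zero]

variable {ρ : ℝ → ℝ}

/-- Almost everywhere the periodization has at most one term coming from a point of `F`. -/
lemma IsAliasingFree.wrap_indicator_le_supPSD (hF : IsAliasingFree fs F) (hfs : 0 < fs)
    (hm : Measurable ρ) (h0 : ∀ f, 0 ≤ ρ f) (hi : Integrable ρ) :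
    ∀ᵐ f ∂(volume.restrict (baseBand fs)), wrap fs (F.indicator ρ) f ≤ supPSD fs ρ f := by
  filter_upwards [ae_restrict_of_ae (hF.ae_eq hfs.ne'), ae_summable_wrap hfs hm hi] with f h1 h2
  by_cases h : ∃ k : ℤ, f - fs * k ∈ F
  · obtain ⟨k, hk⟩ := h
    rw [wrap_indicator_eq ρ hk fun l hl => h1 l k hl hk]
    exact le_supPSD h0 h2 k
  · rw [wrap_indicator_eq_zero ρ (not_exists.1 h)]
    exact supPSD_nonneg h0 f

lemma setIntegral_eq_integral_wrap (hFm : MeasurableSet F) (hfs : 0 < fs)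
    (hm : Measurable ρ) (hi : Integrable ρ) :
    ∫ f in F, ρ f = ∫ f in baseBand fs, wrap fs (F.indicator ρ) f := by
  rw [integral_wrap hfs (hm.indicator hFm) (hi.indicator hFm), integral_indicator hFm]

lemma IsAliasingFree.setIntegral_le (hF : IsAliasingFree fs F) (hfs : 0 < fs)
    (hm : Measurable ρ) (h0 : ∀ f, 0 ≤ ρ f) (hi : Integrable ρ) :
    ∫ f in F, ρ f ≤ ∫ f in baseBand fs, supPSD fs ρ f := by
  rw [setIntegral_eq_integral_wrap hF.1 hfs hm hi]
  exact integral_mono_ae (integrable_wrap hfs (hm.indicator hF.1) (hi.indicator hF.1))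
    (integrable_supPSD hfs hm h0 hi) (hF.wrap_indicator_le_supPSD hfs hm h0 hi)

/-- Bounded truncations exhaust the integral; thus an unbounded set can realize a supremum over
bounded ones. -/
lemma tendsto_setIntegral_inter_Icc (hFm : MeasurableSet F) (hi : Integrable ρ) :
    Tendsto (fun n : ℕ => ∫ f in F ∩ Icc (-n : ℝ) n, ρ f) atTop (𝓝 (∫ f in F, ρ f)) := by
  have hU : ⋃ n : ℕ, F ∩ Icc (-n : ℝ) n = F := by
    rw [← inter_iUnion]
    refine inter_eq_left.2 fun x _ => ?_
    obtain ⟨n, hn⟩ := exists_nat_ge |x|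
    exact mem_iUnion.2 ⟨n, abs_le.1 hn⟩
  have h := tendsto_setIntegral_of_monotone (μ := volume) (f := ρ)
    (s := fun n : ℕ => F ∩ Icc (-n : ℝ) n) (fun n => hFm.inter measurableSet_Icc)
    (fun m n hmn => inter_subset_inter_right _ (Icc_subset_Icc
      (neg_le_neg (Nat.cast_le.2 hmn)) (Nat.cast_le.2 hmn))) hi.integrableOn
  rwa [hU] at h

/-! ### A symmetric maximal aliasing-free set -/

/-- The frequencies in `(0, fs / 2) + fs ℤ` at which `ρ` exceeds its values at all aliases; a tie
is decided in favour of the smallest frequency. -/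
def dominantSet (fs : ℝ) (ρ : ℝ → ℝ) : Set ℝ :=
  {x | Int.fract (x / fs) ∈ Ioo (0 : ℝ) (1 / 2) ∧
    ∀ k : ℤ, ρ (x - fs * k) ≤ ρ x ∧ (0 < k → ρ (x - fs * k) < ρ x)}

lemma measurableSet_dominantSet (fs : ℝ) (hm : Measurable ρ) :
    MeasurableSet (dominantSet fs ρ) := by
  have h1 : Measurable fun x : ℝ => Int.fract (x / fs) :=
    measurable_fract.comp (measurable_id.div_const fs)
  have h2 : ∀ k : ℤ, Measurable fun x : ℝ => ρ (x - fs * k) := fun k =>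
    hm.comp (measurable_id.sub_const _)
  have h3 : dominantSet fs ρ = (fun x : ℝ => Int.fract (x / fs)) ⁻¹' Ioo (0 : ℝ) (1 / 2) ∩
      ⋂ k : ℤ, {x | ρ (x - fs * k) ≤ ρ x} ∩ {x | 0 < k → ρ (x - fs * k) < ρ x} := by
    ext x
    simp [dominantSet]
  rw [h3]
  refine (h1 measurableSet_Ioo).inter (MeasurableSet.iInter fun k =>
    (measurableSet_le (h2 k) hm).inter ?_)
  by_cases hk : 0 < k
  · simpa [hk] using measurableSet_lt (h2 k) hm
  · simp [hk]

/-- If `k > 0`, membership of `x` gives `ρ y < ρ x` and that of `y` gives `ρ x ≤ ρ y`; for `k < 0`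
the roles swap. -/
lemma eq_of_mem_dominantSet {x y : ℝ} (hx : x ∈ dominantSet fs ρ) (hy : y ∈ dominantSet fs ρ)
    {k : ℤ} (h : x - y = fs * k) : x = y := by
  rcases lt_trichotomy k 0 with hk | hk | hk
  · have h1 := (hx.2 k).1
    have h2 := (hy.2 (-k)).2 (by omega)
    rw [show x - fs * k = y by linarith] at h1
    rw [show y - fs * ((-k : ℤ) : ℝ) = x by push_cast; linarith] at h2
    exact absurd h1 (not_le.2 h2)
  · rw [hk, Int.cast_zero, mul_zero] at h
    exact sub_eq_zero.1 h
  · have h1 := (hx.2 k).2 hk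
    have h2 := (hy.2 (-k)).1
    rw [show x - fs * k = y by linarith] at h1
    rw [show y - fs * ((-k : ℤ) : ℝ) = x by push_cast; linarith] at h2
    exact absurd h2 (not_le.2 h1)

/-- Modulo `fs` the dominant set lies in the open lower half of the period and its reflection in the
open upper half. -/
lemma sub_ne_of_mem_dominantSet (hfs : fs ≠ 0) {x y : ℝ} (hx : x ∈ dominantSet fs ρ)
    (hy : -y ∈ dominantSet fs ρ) (k : ℤ) : x - y ≠ fs * k := by
  intro h
  have hxy : x / fs = k - -y / fs := by
    rw [eq_sub_iff_add_eq, ← add_div, ← sub_eq_add_neg, h, mul_div_cancel_left₀ _ hfs]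
  have h1 := hx.1
  have h2 := hy.1
  rw [hxy, sub_eq_add_neg, Int.fract_intCast_add, Int.fract_neg h2.1.ne'] at h1
  linarith [h1.2, h2.2]

/-- The symmetric hull of the dominant set. -/
def symmDominantSet (fs : ℝ) (ρ : ℝ → ℝ) : Set ℝ :=
  {x | x ∈ dominantSet fs ρ ∨ -x ∈ dominantSet fs ρ}

lemma neg_mem_symmDominantSet {x : ℝ} : -x ∈ symmDominantSet fs ρ ↔ x ∈ symmDominantSet fs ρ := by
  simp [symmDominantSet, or_comm]

lemma isAliasingFree_symmDominantSet (hfs : fs ≠ 0) (hm : Measurable ρ) :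
    IsAliasingFree fs (symmDominantSet fs ρ) := by
  have hD := measurableSet_dominantSet fs hm
  refine ⟨hD.union (measurable_neg hD), ∅, measure_empty, ?_⟩
  rintro x ⟨hx | hx, -⟩ y ⟨hy | hy, -⟩ hne k h
  · exact hne (eq_of_mem_dominantSet hx hy h)
  · exact sub_ne_of_mem_dominantSet hfs hx hy k h
  · exact sub_ne_of_mem_dominantSet hfs hy hx (-k) (by push_cast; linarith)
  · exact hne (neg_injective (eq_of_mem_dominantSet hx hy (k := -k) (by push_cast; linarith)))

lemma exists_mem_dominantSet (hfs : fs ≠ 0) (h0 : ∀ f, 0 ≤ ρ f) {f : ℝ}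
    (h : Summable fun k : ℤ => ρ (f - fs * k)) (hpos : 0 < supPSD fs ρ f)
    (hf : Int.fract (f / fs) ∈ Ioo (0 : ℝ) (1 / 2)) :
    ∃ k : ℤ, f - fs * k ∈ dominantSet fs ρ ∧ ρ (f - fs * k) = supPSD fs ρ f := by
  obtain ⟨k, hk, hlast⟩ := exists_eq_supPSD h0 h hpos
  have hshift : ∀ l : ℤ, f - fs * k - fs * l = f - fs * ((k + l : ℤ) : ℝ) := fun l => by
    push_cast; ring
  refine ⟨k, ⟨?_, fun l => ⟨?_, fun hl => ?_⟩⟩, hk⟩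
  · rwa [sub_div, mul_div_cancel_left₀ _ hfs, Int.fract_sub_intCast]
  · rw [hshift, hk]
    exact le_supPSD h0 h _
  · rw [hshift, hk]
    exact hlast _ (by omega)

/-- The excluded classes are those fixed by reflection, on which the choice of a half period fails;
they form a countable set. -/
lemma ae_fract_div_ne (hfs : fs ≠ 0) :
    ∀ᵐ f : ℝ, Int.fract (f / fs) ≠ 0 ∧ Int.fract (f / fs) ≠ 1 / 2 := by
  have h : (range (fun k : ℤ => fs * k) ∪ range fun k : ℤ => fs * (k + 1 / 2)).Countable :=
    (countable_range _).union (countable_range _)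
  filter_upwards [h.ae_notMem volume] with f hf
  have hfr : ∀ c, Int.fract (f / fs) = c → fs * (⌊f / fs⌋ + c) = f := fun c hc => by
    rw [← hc, Int.floor_add_fract, mul_div_cancel₀ _ hfs]
  exact ⟨fun h1 => hf (Or.inl ⟨⌊f / fs⌋, by simpa using hfr 0 h1⟩),
    fun h1 => hf (Or.inr ⟨⌊f / fs⌋, hfr _ h1⟩)⟩

lemma supPSD_neg {f : ℝ} (he : ∀ k : ℤ, ρ (-(f - fs * k)) = ρ (f - fs * k)) :
    supPSD fs ρ (-f) = supPSD fs ρ f := by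
  rw [supPSD, supPSD, ← (Equiv.neg ℤ).iSup_comp]
  refine iSup_congr fun k => ?_
  rw [← he k]
  congr 1
  simp only [Equiv.neg_apply, Int.cast_neg]
  ring

/-- Either `f` or `-f` has its class in the lower half period, and evenness of `ρ` transfers the
maximizing alias between them. -/
lemma exists_mem_symmDominantSet (hfs : 0 < fs) (hm : Measurable ρ) (h0 : ∀ f, 0 ≤ ρ f)
    (hi : Integrable ρ) (he : ∀ᵐ f, ρ (-f) = ρ f) :
    ∀ᵐ f ∂(volume.restrict (baseBand fs)), 0 < supPSD fs ρ f →
      ∃ k : ℤ, f - fs * k ∈ symmDominantSet fs ρ ∧ ρ (f - fs * k) = supPSD fs ρ f := by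
  filter_upwards [ae_summable_wrap hfs hm hi, ae_restrict_of_ae (ae_fract_div_ne hfs.ne'),
    ae_restrict_of_ae (ae_forall_sub he fs)] with f hs hfr hev hpos
  have hnn := Int.fract_nonneg (f / fs)
  rcases lt_or_gt_of_ne hfr.2 with hlt | hgt
  · obtain ⟨k, hk, hk'⟩ := exists_mem_dominantSet hfs.ne' h0 hs hpos
      ⟨lt_of_le_of_ne hnn hfr.1.symm, hlt⟩
    exact ⟨k, Or.inl hk, hk'⟩
  · have hcomp : ∀ k : ℤ, ρ (-f - fs * k) = ρ (f - fs * ((-k : ℤ) : ℝ)) := fun k => by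
      rw [← hev (-k)]
      congr 1
      push_cast
      ring
    have hs' : Summable fun k : ℤ => ρ (-f - fs * k) := by
      simp only [hcomp]
      exact (Equiv.neg ℤ).summable_iff.2 hs
    obtain ⟨k, hk, hk'⟩ := exists_mem_dominantSet hfs.ne' h0 hs' (by rwa [supPSD_neg hev]) (by
      rw [neg_div, Int.fract_neg hfr.1]
      exact ⟨by linarith [Int.fract_lt_one (f / fs)], by linarith⟩)
    refine ⟨-k, Or.inr ?_, ?_⟩
    · convert hk using 1
      push_cast
      ring
    · rw [← hcomp, hk', supPSD_neg hev]

lemma setIntegral_symmDominantSet (hfs : 0 < fs) (hm : Measurable ρ) (h0 : ∀ f, 0 ≤ ρ f)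
    (hi : Integrable ρ) (he : ∀ᵐ f, ρ (-f) = ρ f) :
    ∫ f in symmDominantSet fs ρ, ρ f = ∫ f in baseBand fs, supPSD fs ρ f := by
  have hF := isAliasingFree_symmDominantSet (ρ := ρ) hfs.ne' hm
  rw [setIntegral_eq_integral_wrap hF.1 hfs hm hi]
  refine integral_congr_ae ?_
  filter_upwards [exists_mem_symmDominantSet hfs hm h0 hi he,
    hF.wrap_indicator_le_supPSD hfs hm h0 hi, ae_restrict_of_ae (hF.ae_eq hfs.ne')]
    with f h1 h2 h3
  rcases (supPSD_nonneg (fs := fs) h0 f).eq_or_lt with hz | hpos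
  · refine le_antisymm h2 ?_
    rw [← hz]
    exact tsum_nonneg fun k => indicator_nonneg (fun x _ => h0 x) _
  · obtain ⟨k, hk, hk'⟩ := h1 hpos
    rw [wrap_indicator_eq ρ hk fun l hl => h3 l k hl hk, hk']

theorem exists_symmetric_aliasingFree (hfs : 0 < fs) (hm : Measurable ρ) (h0 : ∀ f, 0 ≤ ρ f)
    (hi : Integrable ρ) (he : ∀ᵐ f, ρ (-f) = ρ f) :
    ∃ F, IsAliasingFree fs F ∧ (∀ f, -f ∈ F ↔ f ∈ F) ∧
      ∫ f in F, ρ f = ∫ f in baseBand fs, supPSD fs ρ f ∧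
      ((∃ B : ℝ, ∀ᵐ f, B < |f| → ρ f = 0) → Bornology.IsBounded F) := by
  have hF := isAliasingFree_symmDominantSet (ρ := ρ) hfs.ne' hm
  have hint := setIntegral_symmDominantSet hfs hm h0 hi he
  by_cases hB : ∃ B : ℝ, ∀ᵐ f, B < |f| → ρ f = 0
  · obtain ⟨B, hB⟩ := hB
    -- Cutting to a symmetric interval that carries `ρ` keeps the symmetry and the integral.
    refine ⟨symmDominantSet fs ρ ∩ Icc (-B) B, hF.inter measurableSet_Icc, fun f => ?_, ?_,
      fun _ => (Metric.isBounded_Icc _ _).subset inter_subset_right⟩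
    · rw [mem_inter_iff, mem_inter_iff, neg_mem_symmDominantSet]
      simp only [mem_Icc, neg_le_neg_iff, neg_le (a := f), and_comm]
    · rw [← hint]
      refine (setIntegral_eq_of_subset_of_ae_sdiff_eq_zero hF.1.nullMeasurableSet
        inter_subset_left ?_).symm
      filter_upwards [hB] with f hf hmem
      refine hf ?_
      by_contra! hle
      exact hmem.2 ⟨hmem.1, abs_le.1 hle⟩
  · exact ⟨_, hF, fun f => neg_mem_symmDominantSet, hint, fun h => absurd h hB⟩

theorem isLUB_setIntegral_AF (hfs : 0 < fs) (hm : Measurable ρ) (h0 : ∀ f, 0 ≤ ρ f)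
    (hi : Integrable ρ) (he : ∀ᵐ f, ρ (-f) = ρ f) :
    IsLUB ((fun G : Set ℝ => ∫ f in G, ρ f) '' AF fs) (∫ f in baseBand fs, supPSD fs ρ f) := by
  refine ⟨forall_mem_image.2 fun G hG => hG.1.setIntegral_le hfs hm h0 hi, fun b hb => ?_⟩
  obtain ⟨F, hF, -, hint, -⟩ := exists_symmetric_aliasingFree hfs hm h0 hi he
  rw [← hint]
  exact le_of_tendsto' (tendsto_setIntegral_inter_Icc hF.1 hi) fun n =>
    hb (mem_image_of_mem _ (hF.inter_Icc_mem_AF _ _))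

end AliasingFree

/-! ### The estimator spectrum -/

section Estimator

variable {Ω : Type*} [MeasurableSpace Ω] {P : Measure Ω}
  {X : ℝ → Ω → ℝ} {η : 𝓢(ℝ, ℝ) → Ω → ℝ} {SX Sη : ℝ → ℝ} {H : ℝ → ℂ} {fs : ℝ} {F : Set ℝ}
  (hX : IsGaussianSource P X SX) (hη : IsGaussianNoise P η Sη)

include hX hη

lemma ae_ratioPSD_neg : ∀ᵐ f, ratioPSD SX Sη (-f) = ratioPSD SX Sη f := by
  filter_upwards [hX.psd.even, hη.psd.even] with f h1 h2
  rw [ratioPSD, ratioPSD, h1, h2]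

lemma sq_mul_sq_eq_ratioPSD_mul_outputPSD (f : ℝ) :
    SX f ^ 2 * ‖H f‖ ^ 2 = ratioPSD SX Sη f * outputPSD SX Sη H f := by
  rw [← norm_crossPSD_sq hX.psd.nonneg hη.psd.nonneg 0, norm_crossPSD, mul_pow, sq_abs]

/-- In this form the estimator spectrum is a mean of `ρ` over the aliases, weighted by the output
density; all its bounds follow from that. -/
lemma estimatorPSD_eq_wrap_div (f : ℝ) : estimatorPSD fs SX Sη H f =
    wrap fs (fun f => ratioPSD SX Sη f * outputPSD SX Sη H f) f /
      wrap fs (outputPSD SX Sη H) f := by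
  simp only [estimatorPSD, sq_mul_sq_eq_ratioPSD_mul_outputPSD hX hη]
  rfl

/-- No filter has an estimator spectrum above the supremum of the ratio over the aliases. -/
theorem estimatorPSD_le_supPSD (hH : IsAdmissible SX Sη H) (hfs : 0 < fs) :
    ∀ᵐ f ∂(volume.restrict (baseBand fs)),
      estimatorPSD fs SX Sη H f ≤ supPSD fs (ratioPSD SX Sη) f := by
  have h0 := ratioPSD_nonneg hX.psd.nonneg hη.psd.nonneg
  filter_upwards [summable_ratioPSD_wrap hX hη hfs, summable_outputPSD_wrap hX hη hH hfs]
    with f h1 h2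
  rw [estimatorPSD_eq_wrap_div hX hη]
  refine div_le_of_le_mul₀ (wrap_outputPSD_nonneg hX hη f) (supPSD_nonneg h0 f) ?_
  rw [wrap, wrap, ← tsum_mul_left]
  have hle : ∀ k : ℤ, ratioPSD SX Sη (f - fs * k) * outputPSD SX Sη H (f - fs * k) ≤
      supPSD fs (ratioPSD SX Sη) f * outputPSD SX Sη H (f - fs * k) := fun k =>
    mul_le_mul_of_nonneg_right (le_supPSD h0 h1 k) (outputPSD_nonneg hX hη _)
  have h3 := h2.mul_left (supPSD fs (ratioPSD SX Sη) f)
  exact Summable.tsum_le_tsum hle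
    (h3.of_nonneg_of_le (fun k => mul_nonneg (h0 _) (outputPSD_nonneg hX hη _)) hle) h3

lemma estimatorPSD_nonneg (f : ℝ) : 0 ≤ estimatorPSD fs SX Sη H f := by
  rw [estimatorPSD_eq_wrap_div hX hη]
  exact div_nonneg (tsum_nonneg fun _ => mul_nonneg
    (ratioPSD_nonneg hX.psd.nonneg hη.psd.nonneg _) (outputPSD_nonneg hX hη _))
    (wrap_outputPSD_nonneg hX hη f)

theorem integral_estimatorPSD_le (hH : IsAdmissible SX Sη H) (hfs : 0 < fs) :
    ∫ f in baseBand fs, estimatorPSD fs SX Sη H f ≤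
      ∫ f in baseBand fs, supPSD fs (ratioPSD SX Sη) f :=
  integral_mono_of_nonneg (ae_of_all _ fun f => estimatorPSD_nonneg hX hη f)
    (integrable_supPSD hfs (measurable_ratioPSD hX.psd.measurable hη.psd.measurable)
      (ratioPSD_nonneg hX.psd.nonneg hη.psd.nonneg) (integrable_ratioPSD hX hη))
    (estimatorPSD_le_supPSD hX hη hH hfs)

omit hX hη in
lemma isAdmissible_indicatorFilter (hF : MeasurableSet F)
    (hi : IntegrableOn (fun f => SX f + Sη f) F) : IsAdmissible SX Sη (indicatorFilter F) := by
  refine ⟨measurable_const.indicator hF, ?_⟩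
  refine (hi.integrable_indicator hF).congr (ae_of_all _ fun f => ?_)
  by_cases h : f ∈ F <;> simp [indicatorFilter, h]

/-- The tempered weight is bounded below on a bounded set, so noise of infinite power does no harm
there. -/
lemma integrableOn_noisyPSD_of_isBounded (hF : Bornology.IsBounded F) :
    IntegrableOn (fun f => SX f + Sη f) F := by
  refine hX.integrable.integrableOn.add ?_
  obtain ⟨n, hn⟩ := hη.tempered
  obtain ⟨B, hB⟩ := hF.exists_norm_le
  refine IntegrableOn.mono_set (t := Metric.closedBall 0 B) ?_
    fun f hf => mem_closedBall_zero_iff.2 (hB f hf)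
  refine (hn.integrableOn.const_mul ((1 + B ^ 2) ^ n)).mono'
    hη.psd.measurable.aestronglyMeasurable ?_
  filter_upwards [ae_restrict_mem Metric.isClosed_closedBall.measurableSet] with f hf
  have hfB : f ^ 2 ≤ B ^ 2 := by
    rw [← sq_abs]
    exact pow_le_pow_left₀ (abs_nonneg f) (mem_closedBall_zero_iff.1 hf) 2
  rw [Real.norm_of_nonneg (hη.psd.nonneg f), ← mul_div_assoc, le_div_iff₀ (by positivity), mul_comm]
  exact mul_le_mul_of_nonneg_right (pow_le_pow_left₀ (by positivity) (by linarith) n)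
    (hη.psd.nonneg f)

/-- A weighted mean with at most one term is the value at that term; when its weight is zero, `ρ` is
zero there too. -/
lemma estimatorPSD_indicatorFilter (hF : IsAliasingFree fs F) (hfs : 0 < fs) :
    ∀ᵐ f ∂(volume.restrict (baseBand fs)),
      estimatorPSD fs SX Sη (indicatorFilter F) f = wrap fs (F.indicator (ratioPSD SX Sη)) f := by
  have h1 : outputPSD SX Sη (indicatorFilter F) = F.indicator fun f => SX f + Sη f := by
    ext f
    by_cases h : f ∈ F <;> simp [outputPSD, indicatorFilter, h]
  have h2 : (fun f => ratioPSD SX Sη f * outputPSD SX Sη (indicatorFilter F) f) =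
      F.indicator fun f => ratioPSD SX Sη f * (SX f + Sη f) := by
    ext f
    by_cases h : f ∈ F <;> simp [h1, h]
  filter_upwards [ae_restrict_of_ae (hF.ae_eq hfs.ne')] with f h
  rw [estimatorPSD_eq_wrap_div hX hη, h2, h1]
  by_cases hk : ∃ k : ℤ, f - fs * k ∈ F
  · obtain ⟨k, hk⟩ := hk
    have huniq := fun l hl => h l k hl hk
    rw [wrap_indicator_eq _ hk huniq, wrap_indicator_eq _ hk huniq, wrap_indicator_eq _ hk huniq]
    by_cases hS : SX (f - fs * k) + Sη (f - fs * k) = 0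
    · simp [ratioPSD, hS]
    · rw [mul_div_cancel_right₀ _ hS]
  · have hno := not_exists.1 hk
    rw [wrap_indicator_eq_zero _ hno, wrap_indicator_eq_zero _ hno, zero_div,
      wrap_indicator_eq_zero _ hno]

theorem integral_estimatorPSD_indicatorFilter (hF : IsAliasingFree fs F) (hfs : 0 < fs) :
    ∫ f in baseBand fs, estimatorPSD fs SX Sη (indicatorFilter F) f =
      ∫ f in F, ratioPSD SX Sη f := by
  rw [setIntegral_eq_integral_wrap hF.1 hfs
    (measurable_ratioPSD hX.psd.measurable hη.psd.measurable) (integrable_ratioPSD hX hη)]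
  exact integral_congr_ae (estimatorPSD_indicatorFilter hX hη hF hfs)

/-- The estimator spectrum of a maximal aliasing-free set. -/
theorem estimatorPSD_eq_supPSD (hF : IsAliasingFree fs F) (hfs : 0 < fs)
    (hmax : ∫ f in F, ratioPSD SX Sη f = ∫ f in baseBand fs, supPSD fs (ratioPSD SX Sη) f) :
    ∀ᵐ f ∂(volume.restrict (baseBand fs)),
      estimatorPSD fs SX Sη (indicatorFilter F) f = supPSD fs (ratioPSD SX Sη) f := by
  have hm := measurable_ratioPSD hX.psd.measurable hη.psd.measurable
  have h0 := ratioPSD_nonneg hX.psd.nonneg hη.psd.nonneg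
  have hi := integrable_ratioPSD hX hη
  rw [setIntegral_eq_integral_wrap hF.1 hfs hm hi] at hmax
  -- A pointwise inequality between functions with equal integrals is an equality almost everywhere.
  have h := (integral_eq_iff_of_ae_le
    (integrable_wrap hfs (hm.indicator hF.1) (hi.indicator hF.1))
    (integrable_supPSD hfs hm h0 hi) (hF.wrap_indicator_le_supPSD hfs hm h0 hi)).1 hmax
  filter_upwards [h, estimatorPSD_indicatorFilter hX hη hF hfs] with f h1 h2
  rw [h2, h1]

omit hX hη in
lemma isRealFilter_indicatorFilter (h : ∀ f, -f ∈ F ↔ f ∈ F) :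
    IsRealFilter (indicatorFilter F) := by
  refine ae_of_all _ fun f => ?_
  by_cases hf : f ∈ F
  · simp [indicatorFilter, hf, (h f).2 hf]
  · simp [indicatorFilter, hf, mt (h f).1 hf]

end Estimator

/-! ### The minimal mean squared error -/

section MMSE

variable {Ω : Type*} [MeasurableSpace Ω] {P : Measure Ω} [IsProbabilityMeasure P]
  {X : ℝ → Ω → ℝ} {η : 𝓢(ℝ, ℝ) → Ω → ℝ} {SX Sη : ℝ → ℝ} {H : ℝ → ℂ} {Z : ℝ → Ω → ℂ}
  {fs m : ℝ} {F : Set ℝ}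
  (hX : IsGaussianSource P X SX) (hη : IsGaussianNoise P η Sη)
  (hindep : IndepFun (fun ω t => X t ω) (fun ω u => η u ω) P)

include hX hη hindep

theorem IsAdmissible.exists_isFilterOutput (hH : IsAdmissible SX Sη H) :
    ∃ Z, IsFilterOutput P X η SX Sη H Z := by
  have := hasTemperateGrowth_noisy hX hη
  obtain ⟨Ψ, hΨ, -⟩ := exists_spectralIsometry hX hη hindep
  exact SubNyquist.exists_isFilterOutput hX hη hΨ hH

variable (hH : IsAdmissible SX Sη H) (hZ : IsFilterOutput P X η SX Sη H Z)

include hH hZ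

theorem hasMMSE_iff (hreal : IsRealFilter H) :
    HasMMSE P X (samples fs Z) m ↔ HasLinearMMSE P X (samples fs Z) m := by
  simp only [HasMMSE, HasLinearMMSE, condError_eq_linearError hX hη hindep hH hreal hZ]

theorem le_of_hasLinearMMSE (hfs : 0 < fs) (hm : HasLinearMMSE P X (samples fs Z) m) :
    (∫ f, SX f) - ∫ f in baseBand fs, supPSD fs (ratioPSD SX Sη) f ≤ m := by
  rw [tendsto_nhds_unique hm (hasLinearMMSE hX hη hH hindep hZ hfs)]
  exact sub_le_sub_left (integral_estimatorPSD_le hX hη hH hfs) _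

omit hH hZ in
theorem hasLinearMMSE_indicatorFilter (hF : IsAliasingFree fs F)
    (hH : IsAdmissible SX Sη (indicatorFilter F))
    (hZ : IsFilterOutput P X η SX Sη (indicatorFilter F) Z) (hfs : 0 < fs) :
    HasLinearMMSE P X (samples fs Z) ((∫ f, SX f) - ∫ f in F, ratioPSD SX Sη f) := by
  rw [← integral_estimatorPSD_indicatorFilter hX hη hF hfs]
  exact hasLinearMMSE hX hη hH hindep hZ hfs

end MMSE

end

end SubNyquist

open SubNyquist in
theorem mainTheorem11 {Ω : Type*} [MeasurableSpace Ω] (P : Measure Ω) [IsProbabilityMeasure P]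
    (X : ℝ → Ω → ℝ) (η : 𝓢(ℝ, ℝ) → Ω → ℝ) (SX Sη : ℝ → ℝ)
    (hX : IsGaussianSource P X SX) (hη : IsGaussianNoise P η Sη)
    (hindep : IndepFun (fun ω t => X t ω) (fun ω u => η u ω) P)
    (fs : ℝ) (hfs : 0 < fs) :
    -- every admissible filter has an output, and the MMSE given its samples exists
    (∀ H : ℝ → ℂ, IsAdmissible SX Sη H →
      (∃ Z, IsFilterOutput P X η SX Sη H Z) ∧
      ∀ Z, IsFilterOutput P X η SX Sη H Z →
        ∃ m, HasLinearMMSE P X (samples fs Z) m ∧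
          (IsRealFilter H → HasMMSE P X (samples fs Z) m)) ∧
    -- the indicator of a maximal aliasing-free set is optimal
    (∀ F : Set ℝ, IsMaximalAliasingFree fs (ratioPSD SX Sη) F →
      (Bornology.IsBounded F ∨ IntegrableOn (fun f => SX f + Sη f) F) →
      IsAdmissible SX Sη (indicatorFilter F) ∧
      -- it maximizes the estimator spectrum
      (∀ H : ℝ → ℂ, IsAdmissible SX Sη H →
        ∀ᵐ f ∂(volume.restrict (Ioo (-fs / 2) (fs / 2))),
          estimatorPSD fs SX Sη H f ≤ estimatorPSD fs SX Sη (indicatorFilter F) f) ∧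
      (∀ᵐ f ∂(volume.restrict (Ioo (-fs / 2) (fs / 2))),
        estimatorPSD fs SX Sη (indicatorFilter F) f = supPSD fs (ratioPSD SX Sη) f) ∧
      -- the MMSE that it achieves
      (∀ Z, IsFilterOutput P X η SX Sη (indicatorFilter F) Z →
        HasLinearMMSE P X (samples fs Z) ((∫ f, SX f) - ∫ f in F, ratioPSD SX Sη f) ∧
        (IsRealFilter (indicatorFilter F) →
          HasMMSE P X (samples fs Z) ((∫ f, SX f) - ∫ f in F, ratioPSD SX Sη f))) ∧
      -- no other filter achieves less
      (∀ (H : ℝ → ℂ) (Z : ℝ → Ω → ℂ) (m : ℝ), IsAdmissible SX Sη H →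
        IsFilterOutput P X η SX Sη H Z →
        (HasLinearMMSE P X (samples fs Z) m →
          (∫ f, SX f) - ∫ f in F, ratioPSD SX Sη f ≤ m) ∧
        (IsRealFilter H → HasMMSE P X (samples fs Z) m →
          (∫ f, SX f) - ∫ f in F, ratioPSD SX Sη f ≤ m)) ∧
      (∫ f in F, ratioPSD SX Sη f) =
        ∫ f in Ioo (-fs / 2) (fs / 2), supPSD fs (ratioPSD SX Sη) f) ∧
    -- the optimal MMSE, whether or not it is attained
    IsLUB ((fun G : Set ℝ => ∫ f in G, ratioPSD SX Sη f) '' AF fs)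
      (∫ f in Ioo (-fs / 2) (fs / 2), supPSD fs (ratioPSD SX Sη) f) ∧
    IsGLB {m : ℝ | ∃ H Z, IsAdmissible SX Sη H ∧ IsFilterOutput P X η SX Sη H Z ∧
        HasLinearMMSE P X (samples fs Z) m}
      ((∫ f, SX f) - ∫ f in Ioo (-fs / 2) (fs / 2), supPSD fs (ratioPSD SX Sη) f) ∧
    IsGLB {m : ℝ | ∃ H Z, IsAdmissible SX Sη H ∧ IsRealFilter H ∧
        IsFilterOutput P X η SX Sη H Z ∧ HasMMSE P X (samples fs Z) m}
      ((∫ f, SX f) - ∫ f in Ioo (-fs / 2) (fs / 2), supPSD fs (ratioPSD SX Sη) f) ∧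
    -- a symmetric maximal aliasing-free set exists, a bounded one if the source is bandlimited
    (∃ F : Set ℝ, IsMaximalAliasingFree fs (ratioPSD SX Sη) F ∧
      (∀ f, -f ∈ F ↔ f ∈ F) ∧
      ((∃ B : ℝ, ∀ᵐ f, B < |f| → SX f = 0) → Bornology.IsBounded F)) := by
  have hm := measurable_ratioPSD hX.psd.measurable hη.psd.measurable
  have h0 := ratioPSD_nonneg hX.psd.nonneg hη.psd.nonneg
  have hi := integrable_ratioPSD hX hη
  have he := ae_ratioPSD_neg hX hη
  have hlub := isLUB_setIntegral_AF hfs hm h0 hi he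
  have hout : ∀ H, IsAdmissible SX Sη H → ∃ Z, IsFilterOutput P X η SX Sη H Z :=
    fun H hH => hH.exists_isFilterOutput hX hη hindep
  have hbdd : ∀ G ∈ AF fs, IsAdmissible SX Sη (indicatorFilter G) := fun G hG =>
    isAdmissible_indicatorFilter hG.1.1 (integrableOn_noisyPSD_of_isBounded hX hη hG.2)
  obtain ⟨F₀, hF₀, hsymm, hint₀, hbd₀⟩ := exists_symmetric_aliasingFree hfs hm h0 hi he
  rw [← restrict_baseBand]
  refine ⟨fun H hH => ⟨hout H hH, fun Z hZ => ?_⟩, fun F hF hFi => ?_, hlub, ⟨?_, fun b hb => ?_⟩,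
    ⟨?_, fun b hb => ?_⟩, F₀, ⟨hF₀, hint₀ ▸ hlub⟩, hsymm, ?_⟩
  · have h := hasLinearMMSE hX hη hH hindep hZ hfs
    exact ⟨_, h, fun hr => (hasMMSE_iff hX hη hindep hH hZ hr).2 h⟩
  -- Least upper bounds are unique, so every maximal set carries the integral of the supremum.
  · have hint := hF.2.unique hlub
    have hadm : IsAdmissible SX Sη (indicatorFilter F) :=
      isAdmissible_indicatorFilter hF.1.1
        (hFi.elim (integrableOn_noisyPSD_of_isBounded hX hη) id)
    have hsup := estimatorPSD_eq_supPSD hX hη hF.1 hfs hint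
    refine ⟨hadm, fun H hH => ?_, hsup, fun Z hZ => ?_, fun H Z m hH hZ => ?_, hint⟩
    · filter_upwards [hsup, estimatorPSD_le_supPSD hX hη hH hfs] with f h1 h2
      rwa [h1]
    · have h := hasLinearMMSE_indicatorFilter hX hη hindep hF.1 hadm hZ hfs
      exact ⟨h, fun hr => (hasMMSE_iff hX hη hindep hadm hZ hr).2 h⟩
    · rw [hint]
      exact ⟨le_of_hasLinearMMSE hX hη hindep hH hZ hfs, fun hr h =>
        le_of_hasLinearMMSE hX hη hindep hH hZ hfs ((hasMMSE_iff hX hη hindep hH hZ hr).1 h)⟩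
  · rintro m ⟨H, Z, hH, hZ, h⟩
    exact le_of_hasLinearMMSE hX hη hindep hH hZ hfs h
  · rw [← hint₀]
    -- The indicator of `F₀` need not be admissible; its bounded truncations are, and their errors
    -- converge to the bound.
    refine ge_of_tendsto' ((tendsto_setIntegral_inter_Icc hF₀.1 hi).const_sub _) fun n => hb ?_
    have hG := hF₀.inter_Icc_mem_AF (-n : ℝ) n
    obtain ⟨Z, hZ⟩ := hout _ (hbdd _ hG)
    exact ⟨_, Z, hbdd _ hG, hZ, hasLinearMMSE_indicatorFilter hX hη hindep hG.1 (hbdd _ hG) hZ hfs⟩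
  · rintro m ⟨H, Z, hH, hr, hZ, h⟩
    exact le_of_hasLinearMMSE hX hη hindep hH hZ hfs ((hasMMSE_iff hX hη hindep hH hZ hr).1 h)
  · rw [← hint₀]
    refine ge_of_tendsto' ((tendsto_setIntegral_inter_Icc hF₀.1 hi).const_sub _) fun n => hb ?_
    have hG := hF₀.inter_Icc_mem_AF (-n : ℝ) n
    -- Truncation to a symmetric interval keeps the filter real.
    have hr : IsRealFilter (indicatorFilter (F₀ ∩ Icc (-n : ℝ) n)) := by
      refine isRealFilter_indicatorFilter fun f => ?_
      rw [mem_inter_iff, mem_inter_iff, hsymm, mem_Icc, mem_Icc, neg_le_neg_iff,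
        neg_le (a := f), and_comm (a := f ≤ n)]
    obtain ⟨Z, hZ⟩ := hout _ (hbdd _ hG)
    exact ⟨_, Z, hbdd _ hG, hr, hZ, (hasMMSE_iff hX hη hindep (hbdd _ hG) hZ hr).2
      (hasLinearMMSE_indicatorFilter hX hη hindep hG.1 (hbdd _ hG) hZ hfs)⟩
  · rintro ⟨B, hB⟩
    refine hbd₀ ⟨B, ?_⟩
    filter_upwards [hB] with f hf hlt
    rw [ratioPSD, hf hlt]
    simp
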